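/- **Setting.** For even $N\ge 2$ let $H=\sum_{n=1}^{N}(\sigma_n^x\sigma_{n+1}^x+\sigma_n^y\sigma_{n+1}^y)$, $\vec\sigma_{N+1}\equiv\vec\sigma_1$, be the XX Hamiltonian on $(\mathbb C^2)^{\otimes N}$, let $|\Omega\rangle=2^{-N/2}\binom11^{\otimes N}$, and let $$S_N(t)=\langle\Omega|e^{iHt}\sigma_1^x e^{-iHt}|\Omega\rangle ,\qquad t\in\mathbb R .$$ Put $\varepsilon_p=4\cos p$, let $B_\pm$ be the set of $p\in[-\pi,\pi)$ with $e^{ipN}=\pm1$, and let $$\Phi^{(N)}_{m,n}(t)=\frac1{N^2}\sum_{p\in B_+,\,q\in B_-}\frac{(1+e^{-ip})(1+e^{iq})\,e^{i[2(mp-nq)+t(\varepsilon_p-\varepsilon_q)]}}{e^{i(p-q)}-1}.$$ Let $J_k$ be the Bessel function of the first kind of integer order $k$, and write $J_k=J_k(4t)$. For integers $m\ne n$ let $$\begin{aligned}K_{m,n}(t)={}&\frac{t}{m-n}\bigl(J_{2m}J_{2n-1}-J_{2n}J_{2m-1}\bigr)+\frac{t}{m-n}\bigl(J_{2m-1}J_{2n-2}-J_{2n-1}J_{2m-2}\bigr)\\&+\frac{it}{m-n-1/2}\bigl(J_{2m-2}J_{2n}-J_{2n-1}J_{2m-1}\bigr)-\frac{it}{m-n+1/2}\bigl(J_{2m-1}J_{2n-1}-J_{2n-2}J_{2m}\bigr),\end{aligned}$$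 and for $n\ge1$ let $$K_{n,n}(t)=-1-J_0^2+J_{2n-1}^2+2\sum_{j=0}^{2n-2}J_j^2 .$$ Finally let $A_{m,n}(t)=\delta_{m,n}+K_{m,n}(t)+K_{m,1-n}(t)$ for $m,n\ge1$, and $S(r,t)=\bigl|\det_{m,n=1,\dots,r}A_{m,n}(t)\bigr|^2$. **Claim.** For every $t\in\mathbb R$: 1. for all integers $m,n\ge1$, as $N\to\infty$ through even integers, $\Phi^{(N)}_{m,n}(t)\to(-1)^{m-n}\bigl(\delta_{m,n}+K_{m,n}(t)\bigr)$; 2. the limit $S(t)=\lim_{N\to\infty}S_N(t)$ (over even $N$) exists and is real, the limit $D(t)=\lim_{r\to\infty}\det_{m,n=1,\dots,r}A_{m,n}(t)$ exists, and $$S(t)=\lim_{r\to\infty}S(r,t)=D(t)\,\overline{D(t)},$$ a product of two infinite determinants. -/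

import Mathlib

open Filter Topology

noncomputable section

namespace SpinHelix

/-! ### The XX chain on a ring of `N` qubits

The Hilbert space `(ℂ²)^{⊗N}` is written in the computational basis: a basis vector is a
configuration `s : Fin N → Fin 2`, a state is a function of `s`, an operator is a matrix. -/

/-- The configurations of `N` qubits, indexing the computational basis. -/
abbrev Config (N : ℕ) : Type := Fin N → Fin 2

/-- The Pauli matrix `σ^x`. -/
def sigmaX : Matrix (Fin 2) (Fin 2) ℂ := !![0, 1; 1, 0]

/-- The Pauli matrix `σ^y`. -/
def sigmaY : Matrix (Fin 2) (Fin 2) ℂ := !![0, -Complex.I; Complex.I, 0]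

/-- The tensor product `A₁ ⊗ ⋯ ⊗ A_N` of one-qubit operators. -/
def tensorOp {N : ℕ} (A : Fin N → Matrix (Fin 2) (Fin 2) ℂ) :
    Matrix (Config N) (Config N) ℂ :=
  Matrix.of fun s s' => ∏ k, A k (s k) (s' k)

/-- The tensor product `v₁ ⊗ ⋯ ⊗ v_N` of one-qubit states. -/
def tensorState {N : ℕ} (v : Fin N → Fin 2 → ℂ) : Config N → ℂ :=
  fun s => ∏ k, v k (s k)

/-- The operator acting as `A` on the qubit at site `n` and as the identity elsewhere. -/
def siteOp {N : ℕ} (A : Matrix (Fin 2) (Fin 2) ℂ) (n : Fin N) :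
    Matrix (Config N) (Config N) ℂ :=
  tensorOp (Function.update (fun _ => 1) n A)

/-- The XX Hamiltonian `∑ₙ (σₙ^x σₙ₊₁^x + σₙ^y σₙ₊₁^y)` with periodic boundary conditions;
`finRotate N n` is the site following `n` on the ring. -/
def hamiltonian (N : ℕ) : Matrix (Config N) (Config N) ℂ :=
  ∑ n : Fin N, (siteOp sigmaX n * siteOp sigmaX (finRotate N n)
    + siteOp sigmaY n * siteOp sigmaY (finRotate N n))

/-- The state `Ω` with all spins polarized in the positive `x` direction. -/
def omega (N : ℕ) : Config N → ℂ :=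
  ((1 / Real.sqrt (2 ^ N) : ℝ) : ℂ) • tensorState fun _ => ![1, 1]

/-- `S_N(t) = ⟨Ω| e^{iHt} σ₁^x e^{-iHt} |Ω⟩`; the first site has index `0`. -/
def relaxationN (N : ℕ) [NeZero N] (t : ℝ) : ℂ :=
  star (omega N) ⬝ᵥ
    ((NormedSpace.exp ((Complex.I * t) • hamiltonian N) * siteOp sigmaX (0 : Fin N)
      * NormedSpace.exp (-(Complex.I * t) • hamiltonian N)).mulVec (omega N))

/-! ### The finite-size matrix -/

/-- The quasi-momenta `p ∈ [-π, π)` with `e^{ipN} = z`; the sets `B₊`, `B₋` are those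
for `z = 1`, `z = -1`. -/
def quasiMomenta (N : ℕ) (z : ℂ) : Set ℝ :=
  {p | p ∈ Set.Ico (-Real.pi) Real.pi ∧ Complex.exp (Complex.I * p * N) = z}

/-- The dispersion `ε_p = 4 cos p`. -/
def dispersion (p : ℝ) : ℝ := 4 * Real.cos p

/-- The entries `Φ^{(N)}_{m,n}(t)`. For `N ≥ 1` both sums are over sets of `N` points, and no
denominator vanishes. -/
def PhiN (N : ℕ) (m n : ℤ) (t : ℝ) : ℂ :=
  1 / (N : ℂ) ^ 2 * ∑ᶠ (p : ℝ) (_ : p ∈ quasiMomenta N 1), ∑ᶠ (q : ℝ) (_ : q ∈ quasiMomenta N (-1)),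
    (1 + Complex.exp (-(Complex.I * p))) * (1 + Complex.exp (Complex.I * q))
      * Complex.exp (Complex.I * (2 * (m * p - n * q) + t * (dispersion p - dispersion q)))
      / (Complex.exp (Complex.I * (p - q)) - 1)

/-! ### The Bessel kernel -/

/-- The Bessel function of the first kind `J_k(x)` of integer order, by Bessel's integral. -/
def besselJ (k : ℤ) (x : ℝ) : ℝ :=
  1 / (2 * Real.pi) * ∫ θ in (-Real.pi)..Real.pi, Real.cos (k * θ - x * Real.sin θ)

/-- The kernel `K_{m,n}(t)`. On the diagonal it is meant for `n ≥ 1` only, where the sum runs over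
`0 ≤ j ≤ 2n - 2`. -/
def kernelK (m n : ℤ) (t : ℝ) : ℂ :=
  let J : ℤ → ℂ := fun k => (besselJ k (4 * t) : ℂ)
  if m = n then
    -1 - J 0 ^ 2 + J (2 * n - 1) ^ 2 + 2 * ∑ j ∈ Finset.range (2 * n - 1).toNat, J j ^ 2
  else
    t / (m - n) * (J (2 * m) * J (2 * n - 1) - J (2 * n) * J (2 * m - 1))
      + t / (m - n) * (J (2 * m - 1) * J (2 * n - 2) - J (2 * n - 1) * J (2 * m - 2))
      + Complex.I * t / (m - n - 1 / 2)
        * (J (2 * m - 2) * J (2 * n) - J (2 * n - 1) * J (2 * m - 1))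
      - Complex.I * t / (m - n + 1 / 2)
        * (J (2 * m - 1) * J (2 * n - 1) - J (2 * n - 2) * J (2 * m))

/-- The Kronecker symbol. -/
def kronecker (m n : ℤ) : ℂ := if m = n then 1 else 0

/-- The matrix `A_{m,n}(t) = δ_{m,n} + K_{m,n}(t) + K_{m,1-n}(t)`, `m, n = 1, …, r`; the row and
column indexed by `i : Fin r` are those with `m = i + 1`, `n = i + 1`. -/
def matrixA (r : ℕ) (t : ℝ) : Matrix (Fin r) (Fin r) ℂ :=
  Matrix.of fun i j =>
    let m : ℤ := (i : ℕ) + 1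
    let n : ℤ := (j : ℕ) + 1
    kronecker m n + kernelK m n t + kernelK m (1 - n) t

/-- `S(r,t) = |det_{m,n=1,…,r} A_{m,n}(t)|²`. -/
def relaxationTrunc (r : ℕ) (t : ℝ) : ℝ := ‖(matrixA r t).det‖ ^ 2

end SpinHelix

end

noncomputable section

namespace SpinHelix

/-! ### Bessel functions of integer order -/

/-! Finite size. In a product basis of eigenvectors of σ^x on even sites and of σ^y on odd sites
(counted from 0), -iH becomes a real hopping of domain walls on the ring of bonds
(`wallHamiltonian_mulVec`). Walls exclude one another and their number is conserved, so Slater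
determinants of one-wall orbitals solve the Schrödinger equation (`hasDerivAt_wallState`). In the
sector η = ±1 of the global spin flip, a wall crossing the cut of the ring acquires η from the
flipped first spin and (-1)^L from reordering the columns, which dictates the twist of the orbitals.
In the new basis Ω is a half-filled Slater state restricted to first spin 0, hence an equal
superposition of both sectors (`wallOmega_eq`). The observable is the sign (-1)^(s 0), so only cross
terms between the sectors survive, and Cauchy–Binet turns them into the real part of one determinant
of overlaps of orbitals with opposite twists (`relaxationN_eq_det`). Undoing the denominator of Φ by
a geometric sum produces the same kind of overlap (`PhiN_eq_overlapN`).

Limit of the entries. The orbitals are sums over images of J_k(4t). A product of two orbitals of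
opposite twists is antiperiodic, so half of the ring enters an overlap with a minus sign, and the
limit is the difference of two half-line sums (`tendsto_overlapN`). The two half-lines together give
the Kronecker symbol by orthonormality, and a single half-line is evaluated by a Christoffel–Darboux
identity for Bessel functions (`sub_mul_halfSum`); this gives δ + K.

Limit of the determinant. The size of the matrix grows, so convergence of entries is not enough. The
time derivative of an overlap telescopes to a current through one bond, which is small unless both
indices are near 0. Hence the deviation from a signed identity is at most C·w(m)·w(n), uniformly in
N, once the indices are centred at the origin (`exists_overlapN_bound`). The expansion in principal
minors then passes to the limit by dominated convergence (`tendsto_det_one_add`), and truncations of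
the limit kernel to [1-r, r] have the same limit `fredholmDet`.

Factorization. The limit kernel is Hermitian and, since J_{-k} = (-1)^k J_k, odd under (m, n) ↦
(1-m, 1-n). On [1-r, r] the signed kernel therefore has block form (P Q; Q P) with P + Q = A and P -
Q = A*, so its determinant is exactly |det A|² for every r (`det_limitKernel_eq`). -/

theorem two_pi_mul_besselJ (k : ℤ) (x : ℝ) :
    2 * Real.pi * besselJ k x = ∫ θ in (-Real.pi)..Real.pi, Real.cos (k * θ - x * Real.sin θ) := by
  unfold besselJ
  field_simp [Real.pi_ne_zero]

theorem abs_besselJ_le_one (k : ℤ) (x : ℝ) : |besselJ k x| ≤ 1 := by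
  have h : ‖∫ θ in (-Real.pi)..Real.pi, Real.cos (k * θ - x * Real.sin θ)‖
      ≤ 1 * |Real.pi - -Real.pi| :=
    intervalIntegral.norm_integral_le_of_norm_le_const fun θ _ => Real.abs_cos_le_one _
  rw [← two_pi_mul_besselJ, Real.norm_eq_abs, abs_mul, abs_of_pos Real.two_pi_pos,
    show Real.pi - -Real.pi = 2 * Real.pi by ring, abs_of_pos Real.two_pi_pos] at h
  have := Real.two_pi_pos
  nlinarith

/-- By periodicity the integral may be taken over [0, 2π]; translating by π reverses the sign of the
sine and produces the phase kπ. -/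
theorem besselJ_neg (k : ℤ) (x : ℝ) : besselJ (-k) x = (-1) ^ k * besselJ k x := by
  have hper : Function.Periodic (fun θ : ℝ => Real.cos (((-k : ℤ) : ℝ) * θ - x * Real.sin θ))
      (2 * Real.pi) := by
    intro θ
    simp only [Real.sin_add_two_pi]
    rw [show ((-k : ℤ) : ℝ) * (θ + 2 * Real.pi) - x * Real.sin θ
      = (((-k : ℤ) : ℝ) * θ - x * Real.sin θ) + (-k : ℤ) * (2 * Real.pi) by ring,
      Real.cos_add_int_mul_two_pi]
  have h1 := hper.intervalIntegral_add_eq (-Real.pi) 0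
  rw [show -Real.pi + 2 * Real.pi = Real.pi by ring, zero_add] at h1
  have h2 : ∫ θ in (0 : ℝ)..(2 * Real.pi), Real.cos (((-k : ℤ) : ℝ) * θ - x * Real.sin θ)
      = ∫ θ in (-Real.pi)..Real.pi,
        Real.cos (((-k : ℤ) : ℝ) * (θ + Real.pi) - x * Real.sin (θ + Real.pi)) := by
    rw [intervalIntegral.integral_comp_add_right
      (fun θ : ℝ => Real.cos (((-k : ℤ) : ℝ) * θ - x * Real.sin θ))]
    congr 1 <;> ring
  unfold besselJ
  rw [h1, h2, mul_left_comm, ← intervalIntegral.integral_const_mul ((-1 : ℝ) ^ k)]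
  congr 1
  refine intervalIntegral.integral_congr fun θ _ => ?_
  simp only [Real.sin_add_pi]
  rw [show ((-k : ℤ) : ℝ) * (θ + Real.pi) - x * -Real.sin θ
      = -((k * θ - x * Real.sin θ) + k * Real.pi) by push_cast; ring, Real.cos_neg,
    Real.cos_add_int_mul_pi]

/-- The function cos(kθ - x sin θ)(k - x cos θ) is the derivative of sin(kθ - x sin θ), which
vanishes at both ends ±π. -/
theorem besselJ_recurrence (k : ℤ) (x : ℝ) :
    2 * k * besselJ k x = x * (besselJ (k - 1) x + besselJ (k + 1) x) := by
  have h1 : ∫ θ in (-Real.pi)..Real.pi, Real.cos (k * θ - x * Real.sin θ) * (k - x * Real.cos θ)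
      = Real.sin (k * Real.pi - x * Real.sin Real.pi)
        - Real.sin (k * (-Real.pi) - x * Real.sin (-Real.pi)) := by
    refine intervalIntegral.integral_eq_sub_of_hasDerivAt
      (f := fun θ : ℝ => Real.sin (k * θ - x * Real.sin θ)) (fun θ _ => ?_) ?_
    · have := (((hasDerivAt_id θ).const_mul (k : ℝ)).sub
        ((Real.hasDerivAt_sin θ).const_mul x)).sin
      simpa using this
    · exact Continuous.intervalIntegrable (by fun_prop) _ _
  have h2 : Real.sin (k * Real.pi - x * Real.sin Real.pi)
        - Real.sin (k * (-Real.pi) - x * Real.sin (-Real.pi)) = 0 := by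
    simp [Real.sin_int_mul_pi]
  have h3 : ∫ θ in (-Real.pi)..Real.pi, Real.cos (k * θ - x * Real.sin θ) * (k - x * Real.cos θ)
      = k * (2 * Real.pi * besselJ k x) - x / 2 * (2 * Real.pi * besselJ (k - 1) x
        + 2 * Real.pi * besselJ (k + 1) x) := by
    simp only [two_pi_mul_besselJ]
    rw [← intervalIntegral.integral_add, ← intervalIntegral.integral_const_mul,
      ← intervalIntegral.integral_const_mul, ← intervalIntegral.integral_sub]
    · refine intervalIntegral.integral_congr fun θ _ => ?_
      rw [show ((k - 1 : ℤ) : ℝ) * θ - x * Real.sin θ = (k * θ - x * Real.sin θ) - θ by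
          push_cast; ring,
        show ((k + 1 : ℤ) : ℝ) * θ - x * Real.sin θ = (k * θ - x * Real.sin θ) + θ by
          push_cast; ring, Real.cos_sub _ θ, Real.cos_add _ θ]
      ring
    all_goals exact Continuous.intervalIntegrable (by fun_prop) _ _
  have h4 := h3.symm.trans (h1.trans h2)
  have h5 : Real.pi * (2 * k * besselJ k x - x * (besselJ (k - 1) x + besselJ (k + 1) x)) = 0 := by
    linear_combination h4
  rcases mul_eq_zero.mp h5 with h | h
  · exact absurd h Real.pi_ne_zero
  · linarith

theorem hasDerivAt_besselJ (k : ℤ) (x : ℝ) :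
    HasDerivAt (besselJ k) ((besselJ (k - 1) x - besselJ (k + 1) x) / 2) x := by
  have h := (intervalIntegral.hasDerivAt_integral_of_dominated_loc_of_deriv_le
    (μ := MeasureTheory.volume) (a := -Real.pi) (b := Real.pi) (x₀ := x) (s := Set.univ)
    (F := fun x θ : ℝ => Real.cos (k * θ - x * Real.sin θ))
    (F' := fun x θ : ℝ => Real.sin (k * θ - x * Real.sin θ) * Real.sin θ)
    (bound := fun _ => 1) Filter.univ_mem
    (Filter.Eventually.of_forall fun y => Continuous.aestronglyMeasurable (by fun_prop))
    (Continuous.intervalIntegrable (by fun_prop) _ _)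
    (Continuous.aestronglyMeasurable (by fun_prop))
    (Filter.Eventually.of_forall fun θ _ y _ => ?_) (by simp)
    (Filter.Eventually.of_forall fun θ _ y _ => ?_)).2
  · have h' := h.const_mul (1 / (2 * Real.pi))
    refine h'.congr_deriv ?_
    unfold besselJ
    rw [← mul_sub, mul_div_assoc, ← intervalIntegral.integral_sub
      (Continuous.intervalIntegrable (by fun_prop) _ _)
      (Continuous.intervalIntegrable (by fun_prop) _ _), ← intervalIntegral.integral_div]
    congr 1
    refine intervalIntegral.integral_congr fun θ _ => ?_
    rw [show ((k - 1 : ℤ) : ℝ) * θ - x * Real.sin θ = (k * θ - x * Real.sin θ) - θ by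
          push_cast; ring,
        show ((k + 1 : ℤ) : ℝ) * θ - x * Real.sin θ = (k * θ - x * Real.sin θ) + θ by
          push_cast; ring, Real.cos_sub _ θ, Real.cos_add _ θ]
    ring
  · rw [norm_mul]
    exact mul_le_one₀ (Real.abs_sin_le_one _) (norm_nonneg _) (Real.abs_sin_le_one _)
  · have := (((hasDerivAt_id y).mul_const (Real.sin θ)).const_sub (k * θ)).cos
    simpa using this

theorem besselJ_zero_right (k : ℤ) : besselJ k 0 = if k = 0 then 1 else 0 := by
  split_ifs with h
  · subst h
    have := two_pi_mul_besselJ 0 0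
    simp only [Int.cast_zero, zero_mul, sub_zero, Real.cos_zero, intervalIntegral.integral_const,
      smul_eq_mul, mul_one] at this
    have h2 := Real.two_pi_pos
    have h3 : 2 * Real.pi * (besselJ 0 0 - 1) = 0 := by linarith
    rcases mul_eq_zero.mp h3 with h | h <;> linarith
  · have := besselJ_recurrence k 0
    have hk : (k : ℝ) ≠ 0 := by exact_mod_cast h
    rw [zero_mul] at this
    simpa [hk] using this

/-- A summable weight on the integers. -/
def wt (k : ℤ) : ℝ := ((1 + |(k : ℝ)|) ^ 2)⁻¹

theorem wt_pos (k : ℤ) : 0 < wt k := by unfold wt; positivity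

theorem wt_le_one (k : ℤ) : wt k ≤ 1 := by
  unfold wt
  apply inv_le_one_of_one_le₀
  nlinarith [abs_nonneg (k : ℝ)]

theorem summable_wt : Summable wt := by
  have h : Summable fun k : ℤ => (|(k : ℝ)| ^ (2 : ℝ))⁻¹ := by
    have := Real.summable_abs_int_rpow (b := 2) (by norm_num)
    refine this.congr fun k => ?_
    rw [Real.rpow_neg (abs_nonneg _)]
  have h2 : Summable fun k : ℤ => (|(k : ℝ)| ^ (2 : ℝ))⁻¹ + if k = 0 then (1 : ℝ) else 0 := by
    refine h.add ?_
    exact summable_of_ne_finset_zero (s := {0}) fun b hb => by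
      simp at hb; simp [hb]
  refine Summable.of_nonneg_of_le (fun k => (wt_pos k).le) (fun k => ?_) h2
  by_cases hk : k = 0
  · subst hk; simp [wt]
  · have : 0 < |(k : ℝ)| := abs_pos.mpr (by exact_mod_cast hk)
    simp only [hk, if_false, add_zero, wt]
    rw [show (2 : ℝ) = ((2 : ℕ) : ℝ) by norm_num, Real.rpow_natCast]
    gcongr
    linarith

theorem wt_le_mul_wt {a b : ℤ} {c : ℝ} (h : 1 + |(b : ℝ)| ≤ c * (1 + |(a : ℝ)|)) :
    wt a ≤ c ^ 2 * wt b := by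
  unfold wt
  rw [inv_le_iff_one_le_mul₀ (by positivity), mul_assoc, mul_comm, mul_assoc,
    inv_mul_eq_div, one_le_div (by positivity), ← mul_pow, mul_comm]
  gcongr

/-- A Peetre-type inequality: translation by a fixed amount costs only a constant factor. -/
theorem wt_add_le (a b : ℤ) : wt (a + b) ≤ (1 + |(b : ℝ)|) ^ 2 * wt a := by
  refine wt_le_mul_wt ?_
  have : |(a : ℝ)| ≤ |((a + b : ℤ) : ℝ)| + |(b : ℝ)| := by
    push_cast
    simpa using abs_sub ((a : ℝ) + b) b
  nlinarith [abs_nonneg ((a + b : ℤ) : ℝ), abs_nonneg (b : ℝ)]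

/-- The recurrence trades one factor of the order for a shift of the order by one, so decay faster
than any power follows by induction, uniformly for bounded argument. -/
theorem exists_besselJ_bound (X : ℝ) (p : ℕ) : ∃ C : ℝ, 0 ≤ C ∧
    ∀ (k : ℤ) (x : ℝ), |x| ≤ X → (1 + |(k : ℝ)|) ^ p * |besselJ k x| ≤ C := by
  induction p with
  | zero => exact ⟨1, zero_le_one, fun k x _ => by simpa using abs_besselJ_le_one k x⟩
  | succ p ih =>
    obtain ⟨C, hC, h⟩ := ih
    refine ⟨C + |X| * (2 ^ p * C), by positivity, fun k x hx => ?_⟩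
    have hs : ∀ l : ℤ, 1 + |(k : ℝ)| ≤ 2 * (1 + |(l : ℝ)|) →
        (1 + |(k : ℝ)|) ^ p * |besselJ l x| ≤ 2 ^ p * C := fun l hl => by
      calc (1 + |(k : ℝ)|) ^ p * |besselJ l x|
          ≤ (2 * (1 + |(l : ℝ)|)) ^ p * |besselJ l x| := by gcongr
        _ = 2 ^ p * ((1 + |(l : ℝ)|) ^ p * |besselJ l x|) := by rw [mul_pow]; ring
        _ ≤ 2 ^ p * C := by gcongr; exact h l x hx
    have h1 := hs (k - 1) (by
      have : |(k : ℝ)| ≤ |((k - 1 : ℤ) : ℝ)| + 1 := by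
        push_cast; simpa using abs_add_le ((k : ℝ) - 1) 1
      linarith [abs_nonneg ((k - 1 : ℤ) : ℝ)])
    have h2 := hs (k + 1) (by
      have : |(k : ℝ)| ≤ |((k + 1 : ℤ) : ℝ)| + 1 := by
        push_cast; simpa using abs_sub ((k : ℝ) + 1) 1
      linarith [abs_nonneg ((k + 1 : ℤ) : ℝ)])
    have hrec : |(k : ℝ)| * |besselJ k x| ≤ |X| / 2 * (|besselJ (k - 1) x| + |besselJ (k + 1) x|) := by
      have := congrArg abs (besselJ_recurrence k x)
      rw [abs_mul, abs_mul, abs_mul, abs_two] at this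
      have h3 : |x| * |besselJ (k - 1) x + besselJ (k + 1) x|
          ≤ |X| * (|besselJ (k - 1) x| + |besselJ (k + 1) x|) := by
        exact mul_le_mul (hx.trans (le_abs_self X)) (abs_add_le _ _) (abs_nonneg _) (abs_nonneg _)
      nlinarith
    calc (1 + |(k : ℝ)|) ^ (p + 1) * |besselJ k x|
        = (1 + |(k : ℝ)|) ^ p * |besselJ k x|
          + (1 + |(k : ℝ)|) ^ p * (|(k : ℝ)| * |besselJ k x|) := by ring
      _ ≤ C + (1 + |(k : ℝ)|) ^ p * (|X| / 2 * (|besselJ (k - 1) x| + |besselJ (k + 1) x|)) := by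
          gcongr
          exact h k x hx
      _ = C + |X| / 2 * ((1 + |(k : ℝ)|) ^ p * |besselJ (k - 1) x|
          + (1 + |(k : ℝ)|) ^ p * |besselJ (k + 1) x|) := by ring
      _ ≤ C + |X| / 2 * (2 ^ p * C + 2 ^ p * C) := by gcongr
      _ = C + |X| * (2 ^ p * C) := by ring

/-- The square leaves two factors to spend on a ring: one for decay in the position, the other for
summing over images. -/
theorem exists_besselJ_le_wt_sq (X : ℝ) : ∃ C : ℝ, 0 ≤ C ∧
    ∀ (k : ℤ) (x : ℝ), |x| ≤ X → |besselJ k x| ≤ C * wt k ^ 2 := by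
  obtain ⟨C, hC, h⟩ := exists_besselJ_bound X 4
  refine ⟨C, hC, fun k x hx => ?_⟩
  unfold wt
  rw [inv_pow, ← pow_mul, ← div_eq_mul_inv, le_div_iff₀ (by positivity), mul_comm]
  exact h k x hx

theorem exists_besselJ_le_wt (X : ℝ) : ∃ C : ℝ, 0 ≤ C ∧
    ∀ (k : ℤ) (x : ℝ), |x| ≤ X → |besselJ k x| ≤ C * wt k := by
  obtain ⟨C, hC, h⟩ := exists_besselJ_le_wt_sq X
  refine ⟨C, hC, fun k x hx => (h k x hx).trans ?_⟩
  gcongr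
  have := wt_pos k
  nlinarith [wt_le_one k]

theorem summable_besselJ (x : ℝ) : Summable fun k : ℤ => besselJ k x := by
  obtain ⟨C, -, h⟩ := exists_besselJ_le_wt |x|
  exact Summable.of_norm_bounded (summable_wt.mul_left C) fun k => h k x le_rfl

/-- The generating function of the Bessel functions, on the circle. -/
def besselGen (x : ℝ) : C(AddCircle (2 * Real.pi), ℂ) where
  toFun θ := Complex.exp (Complex.I * (x * Real.Angle.sin θ : ℝ))
  continuous_toFun := by
    have : Continuous fun θ : Real.Angle => Complex.exp (Complex.I * (x * Real.Angle.sin θ : ℝ)) := by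
      have := Real.Angle.continuous_sin
      fun_prop
    exact this

theorem besselGen_coe (x θ : ℝ) :
    besselGen x (θ : AddCircle (2 * Real.pi)) = Complex.exp (Complex.I * (x * Real.sin θ)) := by
  change Complex.exp (Complex.I * (x * Real.Angle.sin (θ : Real.Angle) : ℝ)) = _
  rw [Real.Angle.sin_coe]
  push_cast
  rfl

instance fact_two_pi_pos : Fact (0 < 2 * Real.pi) := ⟨Real.two_pi_pos⟩

/-- The real part of the coefficient is Bessel's integral; the imaginary part integrates an odd
function over a symmetric interval. -/
theorem fourierCoeff_besselGen (x : ℝ) (k : ℤ) :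
    fourierCoeff (besselGen x) k = (besselJ k x : ℂ) := by
  rw [fourierCoeff_eq_intervalIntegral _ _ (-Real.pi),
    show -Real.pi + 2 * Real.pi = Real.pi by ring]
  have h : ∀ θ : ℝ, fourier (-k) (θ : AddCircle (2 * Real.pi)) • besselGen x (θ : AddCircle (2 * Real.pi))
      = (Real.cos (k * θ - x * Real.sin θ) : ℂ)
        - Complex.I * (Real.sin (k * θ - x * Real.sin θ) : ℝ) := fun θ => by
    rw [besselGen_coe, fourier_coe_apply, smul_eq_mul, ← Complex.exp_add]
    have : (2 * Real.pi * Complex.I * (-k : ℤ) * θ / (2 * Real.pi : ℝ)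
        + Complex.I * (x * Real.sin θ) : ℂ) = ((-(k * θ - x * Real.sin θ) : ℝ) : ℂ) * Complex.I := by
      have : (Real.pi : ℂ) ≠ 0 := by exact_mod_cast Real.pi_ne_zero
      push_cast
      field_simp
      ring
    rw [this, Complex.exp_mul_I, ← Complex.ofReal_cos, ← Complex.ofReal_sin, Real.cos_neg,
      Real.sin_neg]
    push_cast
    ring
  simp only [h]
  rw [intervalIntegral.integral_sub (Continuous.intervalIntegrable (by fun_prop) _ _)
    (Continuous.intervalIntegrable (by fun_prop) _ _), intervalIntegral.integral_const_mul,
    intervalIntegral.integral_ofReal, intervalIntegral.integral_ofReal]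
  have hodd : ∫ θ in (-Real.pi)..Real.pi, Real.sin (k * θ - x * Real.sin θ) = 0 := by
    have h1 := intervalIntegral.integral_comp_neg (a := -Real.pi) (b := Real.pi)
      (fun θ : ℝ => Real.sin (k * θ - x * Real.sin θ))
    rw [neg_neg] at h1
    have h2 : ∀ θ : ℝ, Real.sin (k * -θ - x * Real.sin (-θ))
        = -Real.sin (k * θ - x * Real.sin θ) := fun θ => by
      rw [Real.sin_neg, ← Real.sin_neg (k * θ - x * Real.sin θ)]
      congr 1
      ring
    simp only [h2, intervalIntegral.integral_neg] at h1
    linarith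
  rw [hodd, ← two_pi_mul_besselJ]
  have : (Real.pi : ℂ) ≠ 0 := by exact_mod_cast Real.pi_ne_zero
  simp only [Complex.real_smul]
  push_cast
  field_simp
  ring

/-- The Jacobi–Anger expansion. -/
theorem hasSum_besselJ_mul_exp (x θ : ℝ) :
    HasSum (fun k : ℤ => (besselJ k x : ℂ) * Complex.exp (Complex.I * (k * θ)))
      (Complex.exp (Complex.I * (x * Real.sin θ))) := by
  have hs : Summable (fourierCoeff (besselGen x)) := by
    have : fourierCoeff (besselGen x) = fun k => (besselJ k x : ℂ) :=
      funext (fourierCoeff_besselGen x)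
    rw [this]
    exact_mod_cast (Complex.hasSum_ofReal.mpr (summable_besselJ x).hasSum).summable
  have h := has_pointwise_sum_fourier_series_of_summable hs (θ : AddCircle (2 * Real.pi))
  rw [besselGen_coe] at h
  refine h.congr_fun fun k => ?_
  rw [fourierCoeff_besselGen, fourier_coe_apply, smul_eq_mul]
  congr 2
  have : (Real.pi : ℂ) ≠ 0 := by exact_mod_cast Real.pi_ne_zero
  push_cast
  field_simp

/-- Parseval's identity for a generating function of modulus one. -/
theorem hasSum_besselJ_sq (x : ℝ) : HasSum (fun k : ℤ => besselJ k x ^ 2) 1 := by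
  have hs := summable_besselJ x
  have h := hasSum_sq_fourierCoeff
    (ContinuousMap.toLp (E := ℂ) 2 AddCircle.haarAddCircle ℂ (besselGen x))
  simp_rw [fourierCoeff_toLp, fourierCoeff_besselGen] at h
  have h1 : ∫ θ : AddCircle (2 * Real.pi),
      ‖(ContinuousMap.toLp (E := ℂ) 2 AddCircle.haarAddCircle ℂ (besselGen x)) θ‖ ^ 2
        ∂AddCircle.haarAddCircle = 1 := by
    rw [MeasureTheory.integral_congr_ae (g := fun _ => (1 : ℝ))]
    · simp
    · filter_upwards [ContinuousMap.coeFn_toLp (p := 2) (𝕜 := ℂ) AddCircle.haarAddCircle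
        (besselGen x)] with θ hθ
      rw [hθ]
      change ‖Complex.exp (Complex.I * (x * Real.Angle.sin θ : ℝ))‖ ^ 2 = 1
      rw [mul_comm, Complex.norm_exp_ofReal_mul_I, one_pow]
  rw [h1] at h
  refine h.congr_fun fun k => ?_
  rw [Complex.norm_real, Real.norm_eq_abs, sq_abs]

/-! ### The kernel in infinite volume -/

/-- The amplitudes `J_k(4t)`. -/
def amp (t : ℝ) (k : ℤ) : ℝ := besselJ k (4 * t)

theorem exists_amp_le_wt_sq (T : ℝ) : ∃ C : ℝ, 0 ≤ C ∧
    ∀ (k : ℤ) (t : ℝ), |t| ≤ T → |amp t k| ≤ C * wt k ^ 2 := by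
  obtain ⟨C, hC, h⟩ := exists_besselJ_le_wt_sq (4 * T)
  refine ⟨C, hC, fun k t ht => h k _ ?_⟩
  rw [abs_mul]
  norm_num
  exact ht

theorem exists_amp_le_wt (T : ℝ) : ∃ C : ℝ, 0 ≤ C ∧
    ∀ (k : ℤ) (t : ℝ), |t| ≤ T → |amp t k| ≤ C * wt k := by
  obtain ⟨C, hC, h⟩ := exists_besselJ_le_wt (4 * T)
  refine ⟨C, hC, fun k t ht => h k _ ?_⟩
  rw [abs_mul]
  norm_num
  exact ht

theorem abs_amp_le_one (t : ℝ) (k : ℤ) : |amp t k| ≤ 1 := abs_besselJ_le_one _ _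

theorem amp_neg (t : ℝ) (k : ℤ) : amp t (-k) = (-1) ^ k * amp t k := besselJ_neg _ _

theorem amp_recurrence (t : ℝ) (k : ℤ) :
    k * amp t k = 2 * t * (amp t (k - 1) + amp t (k + 1)) := by
  have := besselJ_recurrence k (4 * t)
  unfold amp
  linarith

theorem hasDerivAt_amp (t : ℝ) (k : ℤ) :
    HasDerivAt (fun t => amp t k) (2 * (amp t (k - 1) - amp t (k + 1))) t := by
  have h := (hasDerivAt_besselJ k (4 * t)).comp t ((hasDerivAt_id t).const_mul 4)
  refine h.congr_deriv ?_
  simp only [amp]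
  ring

theorem amp_zero (k : ℤ) : amp 0 k = if k = 0 then 1 else 0 := by
  unfold amp
  rw [mul_zero, besselJ_zero_right]

theorem summable_amp (t : ℝ) : Summable (amp t) := summable_besselJ _

theorem summable_amp_mul (t : ℝ) (a b : ℤ) :
    Summable fun k : ℤ => amp t (a + k) * amp t (b + k) := by
  have h : Summable fun k : ℤ => amp t (a + k) :=
    (summable_amp t).comp_injective (add_right_injective a)
  refine Summable.of_norm_bounded h.norm fun k => ?_
  rw [norm_mul]
  exact mul_le_of_le_one_right (norm_nonneg _) (abs_amp_le_one _ _)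

theorem summable_amp_mul_nat (t : ℝ) (a b : ℤ) :
    Summable fun k : ℕ => amp t (a + k) * amp t (b + k) :=
  (summable_amp_mul t a b).comp_injective Nat.cast_injective

/-- The half-line sums `∑_{k ≥ 0} J_{a+k} J_{b+k}`. -/
def halfSum (t : ℝ) (a b : ℤ) : ℝ := ∑' k : ℕ, amp t (a + k) * amp t (b + k)

theorem halfSum_comm (t : ℝ) (a b : ℤ) : halfSum t a b = halfSum t b a := by
  simp only [halfSum, mul_comm]

/-- The Wronskian-type bilinear form in the Christoffel–Darboux identity. -/
def ampWronskian (t : ℝ) (a b : ℤ) : ℝ := amp t (a - 1) * amp t b - amp t a * amp t (b - 1)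

/-- Cross-multiply the three-term recurrences at a and b and subtract: the result is a discrete
difference, ready to be summed. -/
theorem sub_mul_amp_mul_amp (t : ℝ) (a b : ℤ) :
    ((a - b : ℤ) : ℝ) * (amp t a * amp t b)
      = 2 * t * (ampWronskian t a b - ampWronskian t (a + 1) (b + 1)) := by
  have h1 := amp_recurrence t a
  have h2 := amp_recurrence t b
  simp only [ampWronskian, add_sub_cancel_right]
  push_cast
  linear_combination amp t b * h1 - amp t a * h2

theorem summable_ampWronskian (t : ℝ) (a b : ℤ) :
    Summable fun k : ℤ => ampWronskian t (a + k) (b + k) := by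
  refine ((summable_amp_mul t (a - 1) b).sub (summable_amp_mul t a (b - 1))).congr fun k => ?_
  simp only [ampWronskian]
  rw [show a - 1 + k = a + k - 1 by ring, show b - 1 + k = b + k - 1 by ring]

/-- Christoffel–Darboux: the sum telescopes, and only the term at the end of the half-line is left.
-/
theorem sub_mul_halfSum (t : ℝ) (a b : ℤ) :
    ((a - b : ℤ) : ℝ) * halfSum t a b
      = 2 * t * (amp t (a - 1) * amp t b - amp t a * amp t (b - 1)) := by
  have hs : Summable fun k : ℕ => ampWronskian t (a + k) (b + k) :=
    (summable_ampWronskian t a b).comp_injective Nat.cast_injective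
  have hs' : Summable fun k : ℕ => ampWronskian t (a + (k + 1 : ℕ)) (b + (k + 1 : ℕ)) :=
    (summable_nat_add_iff 1).mpr hs
  have h0 := hs.tsum_eq_zero_add
  have h1 : ((a - b : ℤ) : ℝ) * halfSum t a b
      = ∑' k : ℕ, 2 * t * (ampWronskian t (a + k) (b + k)
        - ampWronskian t (a + (k + 1 : ℕ)) (b + (k + 1 : ℕ))) := by
    rw [halfSum, ← tsum_mul_left]
    refine tsum_congr fun k => ?_
    have := sub_mul_amp_mul_amp t (a + k) (b + k)
    rw [add_sub_add_right_eq_sub] at this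
    rw [this]
    push_cast
    simp only [add_assoc]
  rw [h1, tsum_mul_left, hs.tsum_sub hs', h0]
  simp only [Nat.cast_zero, add_zero, add_sub_cancel_right, ampWronskian]

/-- Over all of ℤ the telescoping sum has no boundary, so it vanishes by translation invariance. -/
theorem tsum_amp_mul_of_ne (t : ℝ) {a b : ℤ} (hab : a ≠ b) :
    ∑' k : ℤ, amp t (a + k) * amp t (b + k) = 0 := by
  have hs := summable_ampWronskian t a b
  have hs' : Summable fun k : ℤ => ampWronskian t (a + (k + 1)) (b + (k + 1)) :=
    (Equiv.addRight (1 : ℤ)).summable_iff.mpr hs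
  have h0 : ∑' k : ℤ, ampWronskian t (a + (k + 1)) (b + (k + 1))
      = ∑' k : ℤ, ampWronskian t (a + k) (b + k) :=
    (Equiv.addRight (1 : ℤ)).tsum_eq fun k => ampWronskian t (a + k) (b + k)
  have h1 : ((a - b : ℤ) : ℝ) * ∑' k : ℤ, amp t (a + k) * amp t (b + k) = 0 := by
    rw [← tsum_mul_left]
    have : ∀ k : ℤ, ((a - b : ℤ) : ℝ) * (amp t (a + k) * amp t (b + k))
        = 2 * t * (ampWronskian t (a + k) (b + k)
          - ampWronskian t (a + (k + 1)) (b + (k + 1))) := fun k => by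
      have := sub_mul_amp_mul_amp t (a + k) (b + k)
      rw [add_sub_add_right_eq_sub] at this
      rw [this]
      simp only [add_assoc]
    simp only [this]
    rw [tsum_mul_left, hs.tsum_sub hs', h0, sub_self, mul_zero]
  rcases mul_eq_zero.mp h1 with h | h
  · exact absurd (by exact_mod_cast h) (sub_ne_zero.mpr hab)
  · exact h

theorem tsum_amp_mul (t : ℝ) (a b : ℤ) :
    ∑' k : ℤ, amp t (a + k) * amp t (b + k) = if a = b then 1 else 0 := by
  split_ifs with h
  · subst h
    rw [← (hasSum_besselJ_sq (4 * t)).tsum_eq,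
      ← (Equiv.addLeft a).tsum_eq fun k : ℤ => besselJ k (4 * t) ^ 2]
    simp only [amp, Equiv.coe_addLeft, sq]
  · exact tsum_amp_mul_of_ne t h

/-- The squares are even in the order and add up to 1 over ℤ; doubling the half-line counts order 0
twice. -/
theorem halfSum_zero_zero (t : ℝ) : 2 * halfSum t 0 0 = 1 + amp t 0 ^ 2 := by
  have hs := summable_amp_mul t 0 0
  have h1 := tsum_amp_mul t 0 0
  rw [tsum_of_add_one_of_neg_add_one (f := fun k : ℤ => amp t (0 + k) * amp t (0 + k))
    (hs.comp_injective (i := fun n : ℕ => (n : ℤ) + 1) fun a b h => by simpa using h)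
    (hs.comp_injective (i := fun n : ℕ => -((n : ℤ) + 1)) fun a b h => by simpa using h)] at h1
  have h2 := (summable_amp_mul_nat t 0 0).tsum_eq_zero_add
  have h3 : ∀ n : ℕ, amp t (0 + (-((n : ℤ) + 1))) * amp t (0 + (-((n : ℤ) + 1)))
      = amp t (0 + ((n : ℤ) + 1)) * amp t (0 + ((n : ℤ) + 1)) := fun n => by
    rw [zero_add, zero_add, amp_neg, mul_mul_mul_comm, ← mul_zpow]
    norm_num
  simp only [h3, if_true] at h1
  simp only [halfSum]
  push_cast at h2
  rw [h2]
  simp only [zero_add] at h1 ⊢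
  linarith

theorem halfSum_nat (t : ℝ) (c : ℕ) :
    halfSum t c c = halfSum t 0 0 - ∑ j ∈ Finset.range c, amp t j ^ 2 := by
  have h := (summable_amp_mul_nat t 0 0).sum_add_tsum_nat_add c
  simp only [halfSum, zero_add] at h ⊢
  rw [← h]
  simp only [sq, add_sub_cancel_left]
  refine tsum_congr fun k => ?_
  push_cast
  rw [add_comm]

/-- The one-particle amplitudes `J_y - i J_{y-1}`. -/
def wave (t : ℝ) (y : ℤ) : ℂ := amp t y - Complex.I * amp t (y - 1)

theorem norm_wave_le (t : ℝ) (y : ℤ) : ‖wave t y‖ ≤ |amp t y| + |amp t (y - 1)| := by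
  refine (norm_sub_le _ _).trans ?_
  simp

theorem summable_wave_mul (t : ℝ) (a b : ℤ) :
    Summable fun k : ℤ => wave t (a + k) * (starRingEnd ℂ) (wave t (b + k)) := by
  have h : ∀ a : ℤ, Summable fun k : ℤ => |amp t (a + k)| := fun a =>
    (summable_amp t).abs.comp_injective (add_right_injective a)
  refine Summable.of_norm_bounded (((h a).add (h (a - 1))).mul_right 2) fun k => ?_
  rw [norm_mul, RCLike.norm_conj]
  have h1 := norm_wave_le t (a + k)
  have h2 := norm_wave_le t (b + k)
  rw [show a - 1 + k = a + k - 1 by ring]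
  refine mul_le_mul h1 (h2.trans ?_) (norm_nonneg _) (by positivity)
  linarith [abs_amp_le_one t (b + k), abs_amp_le_one t (b + k - 1)]

theorem wave_mul_conj (t : ℝ) (a b : ℤ) :
    wave t a * (starRingEnd ℂ) (wave t b)
      = ((amp t a * amp t b + amp t (a - 1) * amp t (b - 1) : ℝ) : ℂ)
        + Complex.I * ((amp t a * amp t (b - 1) - amp t (a - 1) * amp t b : ℝ) : ℂ) := by
  simp only [wave, map_sub, map_mul, Complex.conj_ofReal, Complex.conj_I]
  push_cast
  linear_combination (-(amp t (a - 1) * amp t (b - 1)) : ℂ) * Complex.I_sq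

/-- The free index map lets one computation serve both the sum over ℤ and the sum over a half-line.
-/
theorem tsum_wave_mul {ι : Type*} (t : ℝ) (a b : ℤ) (f : ι → ℤ) (hf : Function.Injective f) :
    ∑' k, wave t (a + f k) * (starRingEnd ℂ) (wave t (b + f k))
      = ((∑' k, amp t (a + f k) * amp t (b + f k)
          + ∑' k, amp t (a - 1 + f k) * amp t (b - 1 + f k) : ℝ) : ℂ)
        + Complex.I * ((∑' k, amp t (a + f k) * amp t (b - 1 + f k)
          - ∑' k, amp t (a - 1 + f k) * amp t (b + f k) : ℝ) : ℂ) := by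
  have h : ∀ a b : ℤ, Summable fun k => amp t (a + f k) * amp t (b + f k) := fun a b =>
    (summable_amp_mul t a b).comp_injective hf
  rw [← (h _ _).tsum_add (h _ _), ← (h _ _).tsum_sub (h _ _), Complex.ofReal_tsum,
    Complex.ofReal_tsum, ← tsum_mul_left, ← Summable.tsum_add]
  · refine tsum_congr fun k => ?_
    rw [wave_mul_conj]
    rw [show a - 1 + f k = a + f k - 1 by ring, show b - 1 + f k = b + f k - 1 by ring]
  · exact (Complex.hasSum_ofReal.mpr ((h _ _).add (h _ _)).hasSum).summable
  · exact ((Complex.hasSum_ofReal.mpr ((h _ _).sub (h _ _)).hasSum).summable).mul_left _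

/-- The sum of `wave · conj wave` over the bonds `k ≥ 0`. -/
def rightOverlap (t : ℝ) (m n : ℤ) : ℂ :=
  ∑' k : ℕ, wave t (2 * m - 1 - k) * (starRingEnd ℂ) (wave t (2 * n - 1 - k))

/-- The sum of `wave · conj wave` over the bonds `k < 0`. -/
def leftOverlap (t : ℝ) (m n : ℤ) : ℂ :=
  ∑' k : ℕ, wave t (2 * m + k) * (starRingEnd ℂ) (wave t (2 * n + k))

/-- The limit of the finite-size overlaps. -/
def limitKernel (t : ℝ) (m n : ℤ) : ℂ := (rightOverlap t m n - leftOverlap t m n) / 2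

/-- The two half-lines fill ℤ, where the amplitudes are orthonormal. The mixed terms pair orders 2m
and 2n - 1, or 2m - 1 and 2n, which differ in parity and so are orthogonal. -/
theorem rightOverlap_add_leftOverlap (t : ℝ) (m n : ℤ) :
    rightOverlap t m n + leftOverlap t m n = 2 * kronecker m n := by
  have hs := summable_wave_mul t (2 * m) (2 * n)
  have h := tsum_of_nat_of_neg_add_one
    (f := fun k : ℤ => wave t (2 * m + k) * (starRingEnd ℂ) (wave t (2 * n + k)))
    (hs.comp_injective Nat.cast_injective)
    (hs.comp_injective (i := fun n : ℕ => -((n : ℤ) + 1)) fun a b h => by simpa using h)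
  have h2 := tsum_wave_mul t (2 * m) (2 * n) (fun k : ℤ => k) Function.injective_id
  simp only [tsum_amp_mul] at h2
  have e1 : ∀ k : ℕ, 2 * m - 1 - (k : ℤ) = 2 * m + -((k : ℤ) + 1) := fun k => by ring
  have e2 : ∀ k : ℕ, 2 * n - 1 - (k : ℤ) = 2 * n + -((k : ℤ) + 1) := fun k => by ring
  simp only [rightOverlap, leftOverlap, e1, e2]
  rw [add_comm, ← h, h2, kronecker]
  have c1 : (2 * m = 2 * n) ↔ m = n := by omega
  have c2 : (2 * m - 1 = 2 * n - 1) ↔ m = n := by omega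
  have c3 : ¬ (2 * m = 2 * n - 1) := by omega
  have c4 : ¬ (2 * m - 1 = 2 * n) := by omega
  simp only [c1, c2, c3, c4, if_false, sub_self, Complex.ofReal_zero, mul_zero, add_zero]
  split_ifs <;> push_cast <;> norm_num

theorem limitKernel_eq_sub (t : ℝ) (m n : ℤ) :
    limitKernel t m n = kronecker m n - leftOverlap t m n := by
  have := rightOverlap_add_leftOverlap t m n
  unfold limitKernel
  linear_combination this / 2

theorem leftOverlap_eq_halfSum (t : ℝ) (m n : ℤ) :
    leftOverlap t m n = ((halfSum t (2 * m) (2 * n) + halfSum t (2 * m - 1) (2 * n - 1) : ℝ) : ℂ)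
      + Complex.I * ((halfSum t (2 * m) (2 * n - 1) - halfSum t (2 * m - 1) (2 * n) : ℝ) : ℂ) :=
  tsum_wave_mul t (2 * m) (2 * n) (fun k : ℕ => (k : ℤ)) Nat.cast_injective

theorem halfSum_eq_div (t : ℝ) {a b : ℤ} (h : a ≠ b) :
    (halfSum t a b : ℂ) = 2 * t / ((a : ℂ) - b)
      * (amp t (a - 1) * amp t b - amp t a * amp t (b - 1)) := by
  have h1 : ((a : ℂ) - b) ≠ 0 := by exact_mod_cast sub_ne_zero.mpr h
  have h2 := congrArg (fun x : ℝ => (x : ℂ)) (sub_mul_halfSum t a b)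
  push_cast at h2
  field_simp
  linear_combination h2

/-- All four half-line sums have unequal orders, so each has a Christoffel–Darboux closed form. No
sign of the indices is assumed, as the column 1 - n of A requires. -/
theorem leftOverlap_eq_neg_kernelK_of_ne (t : ℝ) {m n : ℤ} (h : m ≠ n) :
    leftOverlap t m n = -kernelK m n t := by
  rw [leftOverlap_eq_halfSum]
  push_cast
  rw [halfSum_eq_div t (show 2 * m ≠ 2 * n by omega),
    halfSum_eq_div t (show 2 * m - 1 ≠ 2 * n - 1 by omega),
    halfSum_eq_div t (show 2 * m ≠ 2 * n - 1 by omega),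
    halfSum_eq_div t (show 2 * m - 1 ≠ 2 * n by omega)]
  have e : ∀ k : ℤ, k - 1 - 1 = k - 2 := fun k => by ring
  simp only [kernelK, h, if_false, e]
  change _ = -(t / (m - n) * (amp t (2 * m) * amp t (2 * n - 1) - amp t (2 * n) * amp t (2 * m - 1))
      + t / (m - n) * (amp t (2 * m - 1) * amp t (2 * n - 2) - amp t (2 * n - 1) * amp t (2 * m - 2))
      + Complex.I * t / (m - n - 1 / 2)
        * (amp t (2 * m - 2) * amp t (2 * n) - amp t (2 * n - 1) * amp t (2 * m - 1))
      - Complex.I * t / (m - n + 1 / 2)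
        * (amp t (2 * m - 1) * amp t (2 * n - 1) - amp t (2 * n - 2) * amp t (2 * m)))
  have h1 : ((m : ℂ) - n) ≠ 0 := by exact_mod_cast sub_ne_zero.mpr h
  have d1 : (2 * t / (((2 * m : ℤ) : ℂ) - ((2 * n : ℤ) : ℂ)) : ℂ) = t / (m - n) := by
    push_cast
    rw [← mul_sub, mul_div_mul_left _ _ two_ne_zero]
  have d2 : (2 * t / (((2 * m - 1 : ℤ) : ℂ) - ((2 * n - 1 : ℤ) : ℂ)) : ℂ) = t / (m - n) := by
    push_cast
    rw [sub_sub_sub_cancel_right, ← mul_sub, mul_div_mul_left _ _ two_ne_zero]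
  have d3 : (2 * t / (((2 * m : ℤ) : ℂ) - ((2 * n - 1 : ℤ) : ℂ)) : ℂ) = t / (m - n + 1 / 2) := by
    push_cast
    rw [show (2 * m - (2 * n - 1) : ℂ) = 2 * (m - n + 1 / 2) by ring,
      mul_div_mul_left _ _ two_ne_zero]
  have d4 : (2 * t / (((2 * m - 1 : ℤ) : ℂ) - ((2 * n : ℤ) : ℂ)) : ℂ) = t / (m - n - 1 / 2) := by
    push_cast
    rw [show (2 * m - 1 - 2 * n : ℂ) = 2 * (m - n - 1 / 2) by ring,
      mul_div_mul_left _ _ two_ne_zero]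
  rw [d1, d2, d3, d4]
  ring

/-- On the diagonal the mixed sums cancel by symmetry, and the other two are the half-line norm from
order 0 minus finitely many squares. That subtraction is what needs n ≥ 1. -/
theorem leftOverlap_self (t : ℝ) {n : ℤ} (hn : 1 ≤ n) :
    leftOverlap t n n = -kernelK n n t := by
  rw [leftOverlap_eq_halfSum, halfSum_comm t (2 * n - 1) (2 * n), sub_self]
  obtain ⟨c, hc⟩ : ∃ c : ℕ, (c : ℤ) = 2 * n - 1 := ⟨(2 * n - 1).toNat, by omega⟩
  have h1 := halfSum_nat t c
  have h2 := halfSum_nat t (c + 1)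
  rw [Finset.sum_range_succ] at h2
  push_cast at h2
  rw [hc] at h1
  rw [hc, show 2 * n - 1 + 1 = 2 * n by ring] at h2
  have h0 := halfSum_zero_zero t
  simp only [kernelK, if_true]
  rw [show (2 * n - 1).toNat = c by omega]
  change _ = -(-1 - (amp t 0 : ℂ) ^ 2 + (amp t (2 * n - 1) : ℂ) ^ 2
    + 2 * ∑ j ∈ Finset.range c, (amp t j : ℂ) ^ 2)
  have h3 : halfSum t (2 * n) (2 * n) + halfSum t (2 * n - 1) (2 * n - 1)
      = -(-1 - amp t 0 ^ 2 + amp t (2 * n - 1) ^ 2 + 2 * ∑ j ∈ Finset.range c, amp t j ^ 2) := by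
    linarith
  rw [h3]
  push_cast
  ring

theorem limitKernel_eq_of_ne (t : ℝ) {m n : ℤ} (h : m ≠ n) :
    limitKernel t m n = kernelK m n t := by
  rw [limitKernel_eq_sub, leftOverlap_eq_neg_kernelK_of_ne t h]
  simp [kronecker, h]

theorem limitKernel_eq (t : ℝ) {m n : ℤ} (hn : 1 ≤ n) :
    limitKernel t m n = kronecker m n + kernelK m n t := by
  rw [limitKernel_eq_sub]
  by_cases h : m = n
  · subst h
    rw [leftOverlap_self t hn, sub_neg_eq_add]
  · rw [leftOverlap_eq_neg_kernelK_of_ne t h, sub_neg_eq_add]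

theorem conj_limitKernel (t : ℝ) (m n : ℤ) :
    (starRingEnd ℂ) (limitKernel t m n) = limitKernel t n m := by
  have h : ∀ x y : ℂ, (starRingEnd ℂ) (x * (starRingEnd ℂ) y) = y * (starRingEnd ℂ) x :=
    fun x y => by rw [map_mul, Complex.conj_conj, mul_comm]
  rw [limitKernel, map_div₀, map_sub, rightOverlap, leftOverlap, Complex.conj_tsum,
    Complex.conj_tsum, limitKernel, rightOverlap, leftOverlap, map_ofNat]
  simp only [h]

/-- Reflection exchanges the two Bessel terms of the wave, up to a phase depending only on the
parity of y. In a product of a wave and a conjugate wave at positions of equal parity the phase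
disappears. -/
theorem wave_one_sub (t : ℝ) (y : ℤ) : wave t (1 - y) = -Complex.I * (-1) ^ y * wave t y := by
  have h1 : amp t (1 - y) = -((-1) ^ y * amp t (y - 1)) := by
    rw [show 1 - y = -(y - 1) by ring, amp_neg, zpow_sub_one₀ (by norm_num)]
    norm_num
  have h2 : amp t (1 - y - 1) = (-1) ^ y * amp t y := by
    rw [show 1 - y - 1 = -y by ring, amp_neg]
  simp only [wave, h1, h2]
  push_cast
  linear_combination (-((-1) ^ y * amp t (y - 1)) : ℂ) * Complex.I_sq

theorem wave_one_sub_mul_conj (t : ℝ) (a b k : ℤ) :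
    wave t (1 - (2 * a + k)) * (starRingEnd ℂ) (wave t (1 - (2 * b + k)))
      = wave t (2 * a + k) * (starRingEnd ℂ) (wave t (2 * b + k)) := by
  have h : ∀ a : ℤ, ((-1 : ℂ)) ^ (2 * a + k) = (-1) ^ k := fun a => by
    rw [zpow_add₀ (by norm_num), zpow_mul]
    norm_num
  have h2 : ((-1 : ℂ)) ^ k * (-1) ^ k = 1 := by
    rw [← mul_zpow]
    norm_num
  rw [wave_one_sub, wave_one_sub, h, h]
  simp only [map_mul, map_neg, map_zpow₀, map_one, Complex.conj_I]
  linear_combination (-(wave t (2 * a + k) * (starRingEnd ℂ) (wave t (2 * b + k)))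
    * ((-1 : ℂ) ^ k * (-1) ^ k)) * Complex.I_sq
    + (wave t (2 * a + k) * (starRingEnd ℂ) (wave t (2 * b + k))) * h2

/-- The reflection exchanges the two half-lines, and the kernel is their difference. -/
theorem limitKernel_one_sub (t : ℝ) (m n : ℤ) :
    limitKernel t (1 - m) (1 - n) = -limitKernel t m n := by
  have h1 : rightOverlap t (1 - m) (1 - n) = leftOverlap t m n := by
    refine tsum_congr fun k => ?_
    rw [← wave_one_sub_mul_conj t m n k, show 2 * (1 - m) - 1 - (k : ℤ) = 1 - (2 * m + k) by ring,
      show 2 * (1 - n) - 1 - (k : ℤ) = 1 - (2 * n + k) by ring]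
  have h2 : leftOverlap t (1 - m) (1 - n) = rightOverlap t m n := by
    refine tsum_congr fun k => ?_
    have := wave_one_sub_mul_conj t m n (-1 - k)
    rw [show 2 * m - 1 - (k : ℤ) = 2 * m + (-1 - k) by ring,
      show 2 * n - 1 - (k : ℤ) = 2 * n + (-1 - k) by ring, ← this,
      show 2 * (1 - m) + (k : ℤ) = 1 - (2 * m + (-1 - k)) by ring,
      show 2 * (1 - n) + (k : ℤ) = 1 - (2 * n + (-1 - k)) by ring]
  rw [limitKernel, h1, h2, limitKernel]
  ring

/-! ### Amplitudes on a twisted ring -/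

/-- The amplitudes on a ring of `N` bonds with twist `ζ`, by the method of images. -/
def ringAmp (N : ℕ) (ζ t : ℝ) (y : ℤ) : ℝ := ∑' l : ℤ, ζ ^ l * amp t (y + l * N)

theorem abs_zpow_eq_one {ζ : ℝ} (hζ : ζ ^ 2 = 1) (l : ℤ) : |ζ ^ l| = 1 := by
  rw [sq] at hζ
  rcases mul_self_eq_one_iff.mp hζ with rfl | rfl <;> simp [abs_zpow]

theorem injective_add_mul {N : ℕ} (hN : 0 < N) (y : ℤ) :
    Function.Injective fun l : ℤ => y + l * N := fun a b h => by
  simpa [hN.ne'] using h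

theorem summable_ringAmp {N : ℕ} (hN : 0 < N) {ζ : ℝ} (hζ : ζ ^ 2 = 1) (t : ℝ) (y : ℤ) :
    Summable fun l : ℤ => ζ ^ l * amp t (y + l * N) := by
  refine Summable.of_norm_bounded
    ((summable_amp t).abs.comp_injective (injective_add_mul hN y)) fun l => ?_
  rw [norm_mul, Real.norm_eq_abs, abs_zpow_eq_one hζ, one_mul]
  rfl

theorem ringAmp_sub_period (N : ℕ) {ζ : ℝ} (hζ : ζ ^ 2 = 1) (t : ℝ) (y : ℤ) :
    ringAmp N ζ t (y - N) = ζ * ringAmp N ζ t y := by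
  have h0 : ζ ≠ 0 := by rintro rfl; norm_num at hζ
  unfold ringAmp
  rw [← tsum_mul_left, ← (Equiv.addRight (1 : ℤ)).tsum_eq]
  refine tsum_congr fun l => ?_
  rw [Equiv.coe_addRight, zpow_add_one₀ h0]
  rw [show y - N + (l + 1) * (N : ℤ) = y + l * N by ring]
  ring

theorem ringAmp_zero {N : ℕ} {ζ : ℝ} {y : ℤ} (hy : |y| < N) :
    ringAmp N ζ 0 y = if y = 0 then 1 else 0 := by
  unfold ringAmp
  rw [tsum_eq_single 0]
  · simp [amp_zero]
  · intro l hl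
    rw [amp_zero, if_neg, mul_zero]
    intro h
    have h1 : |y| = |l| * N := by
      rw [show y = -(l * N) by linarith, abs_neg, abs_mul, Nat.abs_cast]
    have h2 : 1 ≤ |l| := Int.one_le_abs hl
    nlinarith

theorem hasDerivAt_ringAmp {N : ℕ} (hN : 0 < N) {ζ : ℝ} (hζ : ζ ^ 2 = 1) (t : ℝ) (y : ℤ) :
    HasDerivAt (fun t => ringAmp N ζ t y)
      (2 * (ringAmp N ζ t (y - 1) - ringAmp N ζ t (y + 1))) t := by
  obtain ⟨C, hC, hb⟩ := exists_amp_le_wt (|t| + 1)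
  have hw : ∀ a : ℤ, Summable fun l : ℤ => C * wt (a + l * N) := fun a =>
    (summable_wt.comp_injective (injective_add_mul hN a)).mul_left C
  have h := hasDerivAt_tsum_of_isPreconnected (t := Metric.ball t 1)
    (g := fun (l : ℤ) t => ζ ^ l * amp t (y + l * N))
    (g' := fun (l : ℤ) t => ζ ^ l * (2 * (amp t (y + l * N - 1) - amp t (y + l * N + 1))))
    (((hw (y - 1)).add (hw (y + 1))).mul_left 2) Metric.isOpen_ball
    (convex_ball t 1).isPreconnected
    (fun l s _ => (hasDerivAt_amp s _).const_mul _) (fun l s hs => ?_)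
    (Metric.mem_ball_self one_pos) (summable_ringAmp hN hζ t y) (Metric.mem_ball_self one_pos)
  · refine h.congr_deriv ?_
    unfold ringAmp
    rw [← (summable_ringAmp hN hζ t (y - 1)).tsum_sub (summable_ringAmp hN hζ t (y + 1)),
      ← tsum_mul_left]
    refine tsum_congr fun l => ?_
    rw [show y - 1 + l * (N : ℤ) = y + l * N - 1 by ring,
      show y + 1 + l * (N : ℤ) = y + l * N + 1 by ring]
    ring
  · rw [norm_mul, Real.norm_eq_abs, abs_zpow_eq_one hζ, one_mul, norm_mul, Real.norm_eq_abs,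
      abs_two]
    have hs' : |s| ≤ |t| + 1 := by
      have h1 : |s - t| < 1 := by simpa [Real.dist_eq] using hs
      have h2 := abs_add_le (s - t) t
      rw [sub_add_cancel] at h2
      linarith
    gcongr
    refine (norm_sub_le _ _).trans ?_
    rw [show y - 1 + l * (N : ℤ) = y + l * N - 1 by ring,
      show y + 1 + l * (N : ℤ) = y + l * N + 1 by ring]
    exact add_le_add (hb _ _ hs') (hb _ _ hs')

/-- Inside half a period no image is much nearer the origin than y itself, so one of the two weights
is bounded by that of y and the other is summed over images, uniformly in N. The slack c absorbs
bounded shifts of the position. -/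
theorem exists_ringAmp_le_wt (T : ℝ) : ∃ C : ℝ, 0 ≤ C ∧
    ∀ (N : ℕ) (ζ t : ℝ) (y : ℤ) (c : ℕ), 0 < N → ζ ^ 2 = 1 → |t| ≤ T → 2 * |y| ≤ N + 2 * c →
      |ringAmp N ζ t y| ≤ C * (1 + 2 * c) ^ 2 * wt y := by
  obtain ⟨C, hC, hb⟩ := exists_amp_le_wt_sq T
  have hW : 0 ≤ ∑' k, wt k := tsum_nonneg fun k => (wt_pos k).le
  refine ⟨C * ∑' k, wt k, by positivity, fun N ζ t y c hN hζ ht hy => ?_⟩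
  have hs := summable_wt.comp_injective (injective_add_mul hN y)
  have hle : ∑' l : ℤ, wt (y + l * N) ≤ ∑' k, wt k :=
    tsum_comp_le_tsum_of_inj summable_wt (fun k => (wt_pos k).le) (injective_add_mul hN y)
  have hterm : ∀ l : ℤ, ‖ζ ^ l * amp t (y + l * N)‖
      ≤ C * (1 + 2 * c) ^ 2 * wt y * wt (y + l * N) := fun l => by
    rw [norm_mul, Real.norm_eq_abs, abs_zpow_eq_one hζ, one_mul, Real.norm_eq_abs]
    refine (hb _ _ ht).trans ?_
    -- A translate by a nonzero multiple of N lies at distance at least N - |y| from the origin, and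
    -- N ≥ 2|y| - 2c.
    have hz : |y| ≤ |y + l * N| + 2 * c := by
      by_cases hl : l = 0
      · subst hl; simp
      · have h1 : (N : ℤ) ≤ |l * N| := by
          rw [abs_mul, Nat.abs_cast]
          nlinarith [Int.one_le_abs hl]
        have h2 : |l * (N : ℤ)| ≤ |y + l * N| + |y| := by
          simpa using abs_sub (y + l * (N : ℤ)) y
        omega
    have h3 : wt (y + l * N) ≤ (1 + 2 * c) ^ 2 * wt y := by
      refine wt_le_mul_wt ?_
      have hz' : |(y : ℝ)| ≤ |((y + l * N : ℤ) : ℝ)| + 2 * c := by exact_mod_cast hz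
      have : (0 : ℝ) ≤ (c : ℝ) * |((y + l * N : ℤ) : ℝ)| := by positivity
      linarith
    calc C * wt (y + l * N) ^ 2 = C * (wt (y + l * N) * wt (y + l * N)) := by rw [sq]
      _ ≤ C * ((1 + 2 * c) ^ 2 * wt y * wt (y + l * N)) := by
          have := (wt_pos (y + l * N)).le
          gcongr
      _ = _ := by ring
  calc |ringAmp N ζ t y| ≤ ∑' l : ℤ, C * (1 + 2 * c) ^ 2 * wt y * wt (y + l * N) :=
        tsum_of_norm_bounded (hs.mul_left _).hasSum hterm
    _ = C * (1 + 2 * c) ^ 2 * wt y * ∑' l : ℤ, wt (y + l * N) := tsum_mul_left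
    _ ≤ C * (1 + 2 * c) ^ 2 * wt y * ∑' k, wt k := by
        have := (wt_pos y).le
        gcongr
    _ = _ := by ring

/-- All images but l = 0 escape to infinity. The twist may vary with N, since only its modulus
enters. -/
theorem tendsto_ringAmp (ζ : ℕ → ℝ) (hζ : ∀ N, ζ N ^ 2 = 1) (t : ℝ) (y : ℤ) :
    Tendsto (fun N => ringAmp N (ζ N) t y) atTop (𝓝 (amp t y)) := by
  obtain ⟨C, hC, hb⟩ := exists_amp_le_wt |t|
  have h : Tendsto (fun N => ringAmp N (ζ N) t y) atTop
      (𝓝 (∑' l : ℤ, if l = 0 then amp t y else 0)) := by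
    refine tendsto_tsum_of_dominated_convergence
      (bound := fun l => C * ((1 + |(y : ℝ)|) ^ 2 * wt l)) ((summable_wt.mul_left _).mul_left _)
      (fun l => ?_) ?_
    · by_cases hl : l = 0
      · subst hl
        simp
      · rw [if_neg hl]
        have h1 : Tendsto (fun N : ℕ => y + l * (N : ℤ)) atTop cofinite := by
          rw [← Nat.cofinite_eq_atTop]
          refine Function.Injective.tendsto_cofinite fun a b hab => ?_
          simpa [hl] using hab
        have h2 := (summable_amp t).tendsto_cofinite_zero.comp h1
        rw [tendsto_zero_iff_norm_tendsto_zero] at h2 ⊢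
        refine h2.congr fun N => ?_
        rw [norm_mul, Real.norm_eq_abs (ζ N ^ l), abs_zpow_eq_one (hζ N), one_mul]
        rfl
    · filter_upwards [eventually_ge_atTop 1] with N hN l
      rw [norm_mul, Real.norm_eq_abs, abs_zpow_eq_one (hζ N), one_mul, Real.norm_eq_abs]
      refine (hb _ _ le_rfl).trans ?_
      gcongr
      rw [add_comm]
      refine (wt_add_le _ _).trans ?_
      gcongr
      have h3 : |(l : ℝ)| ≤ |((l * N : ℤ) : ℝ)| := by
        push_cast
        rw [abs_mul, Nat.abs_cast]
        have : (1 : ℝ) ≤ N := by exact_mod_cast hN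
        nlinarith [abs_nonneg (l : ℝ)]
      have := wt_le_mul_wt (a := l * N) (b := l) (c := 1) (by linarith)
      linarith
  simpa using h

/-- The one-particle amplitudes on the ring. -/
def ringWave (N : ℕ) (ζ t : ℝ) (y : ℤ) : ℂ :=
  ringAmp N ζ t y - Complex.I * ringAmp N ζ t (y - 1)

theorem norm_ringWave_le (N : ℕ) (ζ t : ℝ) (y : ℤ) :
    ‖ringWave N ζ t y‖ ≤ |ringAmp N ζ t y| + |ringAmp N ζ t (y - 1)| := by
  refine (norm_sub_le _ _).trans ?_
  simp

theorem ringWave_sub_period (N : ℕ) {ζ : ℝ} (hζ : ζ ^ 2 = 1) (t : ℝ) (y : ℤ) :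
    ringWave N ζ t (y - N) = ζ * ringWave N ζ t y := by
  unfold ringWave
  rw [sub_right_comm, ringAmp_sub_period N hζ, ringAmp_sub_period N hζ]
  push_cast
  ring

theorem hasDerivAt_ringWave {N : ℕ} (hN : 0 < N) {ζ : ℝ} (hζ : ζ ^ 2 = 1) (t : ℝ) (y : ℤ) :
    HasDerivAt (fun t => ringWave N ζ t y)
      (2 * (ringWave N ζ t (y - 1) - ringWave N ζ t (y + 1))) t := by
  have h := (hasDerivAt_ringAmp hN hζ t y).ofReal_comp.sub
    ((hasDerivAt_ringAmp hN hζ t (y - 1)).ofReal_comp.const_mul Complex.I)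
  refine h.congr_deriv ?_
  unfold ringWave
  rw [show y + 1 - 1 = y - 1 + 1 by ring]
  push_cast
  ring

theorem ringWave_zero {N : ℕ} {ζ : ℝ} {y : ℤ} (h1 : -N + 1 < y) (h2 : y < N) :
    ringWave N ζ 0 y = if y = 0 then 1 else if y = 1 then -Complex.I else 0 := by
  unfold ringWave
  rw [ringAmp_zero (abs_lt.mpr ⟨by linarith, h2⟩),
    ringAmp_zero (abs_lt.mpr ⟨by linarith, by linarith⟩)]
  by_cases h : y = 0
  · simp [h]
  · by_cases h' : y = 1
    · simp [h']
    · have : ¬ (y - 1 = 0) := by omega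
      simp [h, h', this]

theorem exists_ringWave_le_wt (T : ℝ) : ∃ C : ℝ, 0 ≤ C ∧
    ∀ (N : ℕ) (ζ t : ℝ) (y : ℤ) (c : ℕ), 0 < N → ζ ^ 2 = 1 → |t| ≤ T → 2 * |y| ≤ N + 2 * c →
      ‖ringWave N ζ t y‖ ≤ C * (3 + 2 * c) ^ 2 * wt y := by
  obtain ⟨C, hC, hb⟩ := exists_ringAmp_le_wt T
  refine ⟨5 * C, by positivity, fun N ζ t y c hN hζ ht hy => ?_⟩
  refine (norm_ringWave_le _ _ _ _).trans ?_
  have h1 := hb N ζ t y (c + 1) hN hζ ht (by push_cast; linarith)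
  have h2 := hb N ζ t (y - 1) (c + 1) hN hζ ht (by
    have := abs_sub y 1
    rw [abs_one] at this
    push_cast
    linarith)
  have h3 : wt (y - 1) ≤ 4 * wt y := by
    have := wt_add_le y (-1)
    norm_num at this
    exact this
  have h4 : C * (1 + 2 * ((c + 1 : ℕ) : ℝ)) ^ 2 * wt (y - 1)
      ≤ C * (1 + 2 * ((c + 1 : ℕ) : ℝ)) ^ 2 * (4 * wt y) := by gcongr
  have h5 : (1 + 2 * ((c + 1 : ℕ) : ℝ)) = 3 + 2 * c := by push_cast; ring
  rw [h5] at h1 h2 h4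
  linarith

theorem tendsto_ringWave (ζ : ℕ → ℝ) (hζ : ∀ N, ζ N ^ 2 = 1) (t : ℝ) (y : ℤ) :
    Tendsto (fun N => ringWave N (ζ N) t y) atTop (𝓝 (wave t y)) := by
  have h1 := (Complex.continuous_ofReal.tendsto _).comp (tendsto_ringAmp ζ hζ t y)
  have h2 := (Complex.continuous_ofReal.tendsto _).comp (tendsto_ringAmp ζ hζ t (y - 1))
  exact h1.sub (h2.const_mul Complex.I)

/-! ### Overlaps of one-particle states with opposite twists -/

/-- The overlaps on a ring of `N` bonds between states of twists `-ζ` and `ζ`. -/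
def overlapN (N : ℕ) (ζ t : ℝ) (m n : ℤ) : ℂ :=
  (∑ k ∈ Finset.range N, ringWave N (-ζ) t (2 * m - 1 - k)
    * (starRingEnd ℂ) (ringWave N ζ t (2 * n - 1 - k))) / 2

theorem overlapN_sub_left {M : ℕ} {ζ : ℝ} (hζ : ζ ^ 2 = 1) (t : ℝ) (m n : ℤ) :
    overlapN (2 * M) ζ t (m - M) n = -ζ * overlapN (2 * M) ζ t m n := by
  unfold overlapN
  rw [← mul_div_assoc, Finset.mul_sum]
  congr 1
  refine Finset.sum_congr rfl fun k _ => ?_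
  have := ringWave_sub_period (2 * M) (ζ := -ζ) (by rwa [neg_sq]) t (2 * m - 1 - k)
  rw [show 2 * (m - M) - 1 - (k : ℤ) = 2 * m - 1 - k - (2 * M : ℕ) by push_cast; ring, this]
  push_cast
  ring

theorem overlapN_sub_right {M : ℕ} {ζ : ℝ} (hζ : ζ ^ 2 = 1) (t : ℝ) (m n : ℤ) :
    overlapN (2 * M) ζ t m (n - M) = ζ * overlapN (2 * M) ζ t m n := by
  unfold overlapN
  rw [← mul_div_assoc, Finset.mul_sum]
  congr 1
  refine Finset.sum_congr rfl fun k _ => ?_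
  have := ringWave_sub_period (2 * M) hζ t (2 * n - 1 - k)
  rw [show 2 * (n - M) - 1 - (k : ℤ) = 2 * n - 1 - k - (2 * M : ℕ) by push_cast; ring, this,
    map_mul, Complex.conj_ofReal]
  ring

theorem ringWave_mul_conj_sub_period (N : ℕ) {ζ : ℝ} (hζ : ζ ^ 2 = 1) (t : ℝ) (a b : ℤ) :
    ringWave N (-ζ) t (a - N) * (starRingEnd ℂ) (ringWave N ζ t (b - N))
      = -(ringWave N (-ζ) t a * (starRingEnd ℂ) (ringWave N ζ t b)) := by
  rw [ringWave_sub_period N (by rwa [neg_sq]), ringWave_sub_period N hζ, map_mul,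
    Complex.conj_ofReal]
  have : (ζ : ℂ) ^ 2 = 1 := by exact_mod_cast hζ
  push_cast
  linear_combination (-(ringWave N (-ζ) t a * (starRingEnd ℂ) (ringWave N ζ t b))) * this

/-- The far half of the ring is translated by one period to the other side of bond 0. Opposite
twists multiply to -1, which is the origin of the difference of half-lines in the limit. -/
theorem overlapN_eq_half (M : ℕ) {ζ : ℝ} (hζ : ζ ^ 2 = 1) (t : ℝ) (m n : ℤ) :
    overlapN (2 * M) ζ t m n
      = (∑ k ∈ Finset.range M, ringWave (2 * M) (-ζ) t (2 * m - 1 - k)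
          * (starRingEnd ℂ) (ringWave (2 * M) ζ t (2 * n - 1 - k))
        - ∑ k ∈ Finset.range M, ringWave (2 * M) (-ζ) t (2 * m + k)
          * (starRingEnd ℂ) (ringWave (2 * M) ζ t (2 * n + k))) / 2 := by
  unfold overlapN
  congr 1
  nth_rewrite 1 [two_mul]
  rw [Finset.sum_range_add, sub_eq_add_neg (∑ k ∈ Finset.range M, _), ← Finset.sum_neg_distrib,
    ← Finset.sum_range_reflect (fun k : ℕ => ringWave (2 * M) (-ζ) t (2 * m - 1 - (M + k : ℕ))
          * (starRingEnd ℂ) (ringWave (2 * M) ζ t (2 * n - 1 - (M + k : ℕ))))]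
  congr 1
  refine Finset.sum_congr rfl fun k hk => ?_
  rw [← ringWave_mul_conj_sub_period (2 * M) hζ]
  have hk' := Finset.mem_range.mp hk
  have e : ((M + (M - 1 - k) : ℕ) : ℤ) = 2 * M - 1 - k := by omega
  rw [e, show 2 * m - 1 - (2 * M - 1 - k : ℤ) = 2 * m + k - (2 * M : ℕ) by push_cast; ring,
    show 2 * n - 1 - (2 * M - 1 - k : ℤ) = 2 * n + k - (2 * M : ℕ) by push_cast; ring]

/-- Dominated convergence: only M of the 2M bonds are summed, so the positions remain within half a
period up to a fixed slack. -/
theorem tendsto_sum_ringWave (ζ : ℕ → ℝ) (hζ : ∀ N, ζ N ^ 2 = 1) (t : ℝ) (a b ε : ℤ)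
    (hε : ε = 1 ∨ ε = -1) :
    Tendsto (fun M : ℕ => ∑ k ∈ Finset.range M, ringWave (2 * M) (-ζ (2 * M)) t (a + ε * k)
        * (starRingEnd ℂ) (ringWave (2 * M) (ζ (2 * M)) t (b + ε * k))) atTop
      (𝓝 (∑' k : ℕ, wave t (a + ε * k) * (starRingEnd ℂ) (wave t (b + ε * k)))) := by
  obtain ⟨C, hC, hb⟩ := exists_ringWave_le_wt |t|
  have hε' : |ε| = 1 := by rcases hε with h | h <;> simp [h]
  have hε0 : ε ≠ 0 := by rcases hε with h | h <;> simp [h]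
  have h2M : Tendsto (fun M : ℕ => 2 * M) atTop atTop := tendsto_id.const_mul_atTop' two_pos
  have key : Tendsto (fun M : ℕ => ∑' k : ℕ, if k < M then
      ringWave (2 * M) (-ζ (2 * M)) t (a + ε * k)
        * (starRingEnd ℂ) (ringWave (2 * M) (ζ (2 * M)) t (b + ε * k)) else 0) atTop
      (𝓝 (∑' k : ℕ, wave t (a + ε * k) * (starRingEnd ℂ) (wave t (b + ε * k)))) := by
    refine tendsto_tsum_of_dominated_convergence
      (bound := fun k : ℕ => C * (3 + 2 * (a.natAbs : ℝ)) ^ 2 * wt (a + ε * k)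
        * (C * (3 + 2 * (b.natAbs : ℝ)) ^ 2)) ?_ (fun k => ?_) ?_
    · refine Summable.mul_right _ (Summable.mul_left _ ?_)
      refine summable_wt.comp_injective (i := fun k : ℕ => a + ε * (k : ℤ)) fun x y h => ?_
      simpa [hε0] using h
    · have h1 := (tendsto_ringWave (fun N => -ζ N) (fun N => by rw [neg_sq, hζ]) t
        (a + ε * k)).comp h2M
      have h2 := (Complex.continuous_conj.tendsto _).comp ((tendsto_ringWave ζ hζ t
        (b + ε * k)).comp h2M)
      refine (h1.mul h2).congr' ?_
      filter_upwards [eventually_gt_atTop k] with M hM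
      simp [hM]
    · filter_upwards [eventually_ge_atTop 1] with M hM k
      have hpos : ∀ y, 0 ≤ wt y := fun y => (wt_pos y).le
      split_ifs with hk
      · rw [norm_mul, RCLike.norm_conj]
        have habs : ∀ y : ℤ, 2 * |y + ε * k| ≤ (2 * M : ℕ) + 2 * (y.natAbs : ℤ) := fun y => by
          have := abs_add_le y (ε * k)
          rw [abs_mul, hε', one_mul, Nat.abs_cast] at this
          push_cast
          omega
        have h1 := hb (2 * M) (-ζ (2 * M)) t (a + ε * k) a.natAbs (by omega)
          (by rw [neg_sq, hζ]) le_rfl (habs a)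
        have h2 := hb (2 * M) (ζ (2 * M)) t (b + ε * k) b.natAbs (by omega)
          (hζ _) le_rfl (habs b)
        refine mul_le_mul h1 (h2.trans ?_) (norm_nonneg _) (by have := hpos (a + ε * k); positivity)
        exact mul_le_of_le_one_right (by positivity) (wt_le_one _)
      · rw [norm_zero]
        have := hpos (a + ε * k)
        positivity
  refine key.congr fun M => ?_
  rw [tsum_eq_sum (s := Finset.range M)]
  · exact Finset.sum_congr rfl fun k hk => if_pos (Finset.mem_range.mp hk)
  · intro k hk
    exact if_neg (by simpa using hk)

theorem tendsto_overlapN (ζ : ℕ → ℝ) (hζ : ∀ N, ζ N ^ 2 = 1) (t : ℝ) (m n : ℤ) :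
    Tendsto (fun M : ℕ => overlapN (2 * M) (ζ (2 * M)) t m n) atTop
      (𝓝 (limitKernel t m n)) := by
  have h1 := tendsto_sum_ringWave ζ hζ t (2 * m - 1) (2 * n - 1) (-1) (Or.inr rfl)
  have h2 := tendsto_sum_ringWave ζ hζ t (2 * m) (2 * n) 1 (Or.inl rfl)
  have h := (h1.sub h2).div_const 2
  simp only [neg_one_mul, one_mul, ← sub_eq_add_neg] at h
  refine h.congr fun M => ?_
  rw [overlapN_eq_half M (hζ _)]

/-- A continuity equation: the derivative of each summand is a difference of currents, so summation
leaves only a current at the cut. It is a sum of two products of a function of m and a function of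
n, each concentrated near 0. -/
theorem hasDerivAt_overlapN {N : ℕ} (hN : 0 < N) {ζ : ℝ} (hζ : ζ ^ 2 = 1) (t : ℝ) (m n : ℤ) :
    HasDerivAt (fun t => overlapN N ζ t m n)
      (-2 * (ringWave N (-ζ) t (2 * m - 1) * (starRingEnd ℂ) (ringWave N ζ t (2 * n))
        + ringWave N (-ζ) t (2 * m) * (starRingEnd ℂ) (ringWave N ζ t (2 * n - 1)))) t := by
  have hζ' : (-ζ) ^ 2 = 1 := by rwa [neg_sq]
  have h := (HasDerivAt.fun_sum (u := Finset.range N) fun k (_ : k ∈ Finset.range N) =>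
    (hasDerivAt_ringWave hN hζ' t (2 * m - 1 - k)).mul
      (hasDerivAt_ringWave hN hζ t (2 * n - 1 - k)).star).div_const 2
  refine h.congr_deriv ?_
  let c : ℕ → ℂ := fun k => ringWave N (-ζ) t (2 * m - 1 - k)
      * (starRingEnd ℂ) (ringWave N ζ t (2 * n - k))
    + ringWave N (-ζ) t (2 * m - k) * (starRingEnd ℂ) (ringWave N ζ t (2 * n - 1 - k))
  -- Antiperiodicity makes the two boundary currents add up; with equal twists they would cancel.
  have hc : c N = -c 0 := by
    have h1 := ringWave_mul_conj_sub_period N hζ t (2 * m - 1) (2 * n)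
    have h2 := ringWave_mul_conj_sub_period N hζ t (2 * m) (2 * n - 1)
    simp only [c, h1, h2, Nat.cast_zero, sub_zero]
    ring
  have hsum : ∑ k ∈ Finset.range N, (c (k + 1) - c k) = -2 * c 0 := by
    rw [Finset.sum_range_sub, hc]
    ring
  have hc0 : c 0 = ringWave N (-ζ) t (2 * m - 1) * (starRingEnd ℂ) (ringWave N ζ t (2 * n))
        + ringWave N (-ζ) t (2 * m) * (starRingEnd ℂ) (ringWave N ζ t (2 * n - 1)) := by
    simp [c]
  rw [← hc0, ← hsum, Finset.sum_div]
  refine Finset.sum_congr rfl fun k _ => ?_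
  simp only [c]
  push_cast
  rw [show 2 * m - 1 - (k + 1 : ℤ) = 2 * m - 1 - k - 1 by ring,
    show 2 * n - 1 - (k + 1 : ℤ) = 2 * n - 1 - k - 1 by ring,
    show 2 * m - (k + 1 : ℤ) = 2 * m - 1 - k by ring,
    show 2 * n - (k + 1 : ℤ) = 2 * n - 1 - k by ring,
    show 2 * m - (k : ℤ) = 2 * m - 1 - k + 1 by ring,
    show 2 * n - (k : ℤ) = 2 * n - 1 - k + 1 by ring]
  simp only [star_mul', star_sub, RCLike.star_def, map_ofNat]
  ring

theorem overlapN_zero_of_mem {M : ℕ} {ζ : ℝ} {m n : ℤ} (hm : 1 ≤ m) (hmM : m ≤ M)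
    (hn : 1 ≤ n) (hnM : n ≤ M) : overlapN (2 * M) ζ 0 m n = kronecker m n := by
  obtain ⟨i, rfl⟩ : ∃ i : ℕ, m = i + 1 := ⟨(m - 1).toNat, by omega⟩
  unfold overlapN kronecker
  have h : ∀ k ∈ Finset.range (2 * M), ringWave (2 * M) (-ζ) 0 (2 * (i + 1) - 1 - k)
      * (starRingEnd ℂ) (ringWave (2 * M) ζ 0 (2 * n - 1 - k))
      = (if k = 2 * i + 1 then (if (i : ℤ) + 1 = n then 1 else 0) else 0)
        + (if k = 2 * i then (if (i : ℤ) + 1 = n then 1 else 0) else 0) := fun k hk => by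
    have hk' := Finset.mem_range.mp hk
    rw [ringWave_zero (by push_cast; omega) (by push_cast; omega),
      ringWave_zero (by push_cast; omega) (by push_cast; omega)]
    by_cases h1 : k = 2 * i + 1
    · rw [if_pos (by omega), if_pos h1, if_neg (show k ≠ 2 * i by omega)]
      by_cases h2 : (i : ℤ) + 1 = n
      · rw [if_pos (by omega), if_pos h2]
        simp
      · rw [if_neg (by omega), if_neg (by omega), if_neg h2]
        simp
    · by_cases h3 : k = 2 * i
      · rw [if_neg (by omega), if_pos (by omega), if_neg h1, if_pos h3]
        by_cases h2 : (i : ℤ) + 1 = n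
        · rw [if_neg (by omega), if_pos (by omega), if_pos h2]
          simp
        · rw [if_neg (by omega), if_neg (by omega), if_neg h2]
          simp
      · rw [if_neg (by omega), if_neg (by omega), if_neg h1, if_neg h3]
        simp
  rw [Finset.sum_congr rfl h, Finset.sum_add_distrib, Finset.sum_ite_eq', Finset.sum_ite_eq',
    if_pos (Finset.mem_range.mpr (by omega)), if_pos (Finset.mem_range.mpr (by omega))]
  split_ifs <;> norm_num

/-- The sign of the half-line on which the `m`-th initial orbital sits. -/
def halfSign (m : ℤ) : ℂ := if 1 ≤ m then 1 else -1

/-- Nonpositive indices are translated by M into 1, …, M. This costs -ζ in the row and ζ in the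
column, hence -1 on the diagonal, which `halfSign` compensates. -/
theorem overlapN_zero_of_window {M : ℕ} {ζ : ℝ} (hζ : ζ ^ 2 = 1) {m n : ℤ}
    (hm : -M < 2 * m) (hmM : 2 * m ≤ M) (hn : -M < 2 * n) (hnM : 2 * n ≤ M) :
    halfSign m * overlapN (2 * M) ζ 0 m n = kronecker m n := by
  have hz : (ζ : ℂ) ^ 2 = 1 := by exact_mod_cast hζ
  have hl : ∀ n, overlapN (2 * M) ζ 0 m n = -ζ * overlapN (2 * M) ζ 0 (m + M) n := fun n => by
    rw [← overlapN_sub_left hζ, add_sub_cancel_right]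
  have hr : ∀ m, overlapN (2 * M) ζ 0 m n = ζ * overlapN (2 * M) ζ 0 m (n + M) := fun m => by
    rw [← overlapN_sub_right hζ, add_sub_cancel_right]
  unfold halfSign
  by_cases h1 : 1 ≤ m <;> by_cases h2 : 1 ≤ n
  · rw [if_pos h1, one_mul, overlapN_zero_of_mem h1 (by omega) h2 (by omega)]
  · rw [if_pos h1, one_mul, hr, overlapN_zero_of_mem h1 (by omega) (by omega) (by omega)]
    simp [kronecker, show m ≠ n + M by omega, show m ≠ n by omega]
  · rw [if_neg h1, hl, overlapN_zero_of_mem (by omega) (by omega) h2 (by omega)]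
    simp [kronecker, show m + M ≠ n by omega, show m ≠ n by omega]
  · rw [if_neg h1, hl, hr, overlapN_zero_of_mem (by omega) (by omega) (by omega) (by omega)]
    simp only [kronecker, add_left_inj]
    split_ifs
    · linear_combination hz
    · simp

/-- Mean value inequality from time 0, where the signed overlaps form the identity; the derivative
is bounded by a product of weights. This uniform estimate is what controls determinants of growing
size. -/
theorem exists_overlapN_bound (t : ℝ) : ∃ C : ℝ, 0 ≤ C ∧ ∀ (M : ℕ) (ζ : ℝ) (m n : ℤ),
    0 < M → ζ ^ 2 = 1 → -M < 2 * m → 2 * m ≤ M → -M < 2 * n → 2 * n ≤ M →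
      ‖halfSign m * overlapN (2 * M) ζ t m n - kronecker m n‖ ≤ C * wt m * wt n := by
  obtain ⟨C, hC, hb⟩ := exists_ringWave_le_wt |t|
  have hwt : ∀ m : ℤ, wt (2 * m) ≤ wt m := fun m => by
    have := wt_le_mul_wt (a := 2 * m) (b := m) (c := 1) (by
      push_cast
      rw [abs_mul, abs_two]
      linarith [abs_nonneg (m : ℝ)])
    linarith
  -- The factor 100 is (3 + 2·1)² from the wave bound with slack 1, times 4 for the shift from 2m to
  -- 2m - 1.
  have hwave : ∀ (M : ℕ) (ζ s : ℝ) (m : ℤ), 0 < M → ζ ^ 2 = 1 → |s| ≤ |t| → -M < 2 * m →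
      2 * m ≤ M → ‖ringWave (2 * M) ζ s (2 * m)‖ ≤ 100 * C * wt m ∧
        ‖ringWave (2 * M) ζ s (2 * m - 1)‖ ≤ 100 * C * wt m := by
    intro M ζ s m hM hζ hs h1 h2
    have b1 := hb (2 * M) ζ s (2 * m) 1 (by omega) hζ hs (by
      have := abs_le.mpr ⟨h1.le, h2⟩
      push_cast
      linarith)
    have b2 := hb (2 * M) ζ s (2 * m - 1) 1 (by omega) hζ hs (by
      have := abs_le.mpr ⟨h1.le, h2⟩
      have h3 := abs_sub (2 * m) 1
      rw [abs_one] at h3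
      push_cast
      linarith)
    have w1 := hwt m
    have w2 : wt (2 * m - 1) ≤ 4 * wt (2 * m) := by
      have := wt_add_le (2 * m) (-1)
      norm_num at this
      exact this
    have w0 := wt_pos m
    norm_num at b1 b2
    constructor
    · nlinarith [mul_le_mul_of_nonneg_left w1 hC, mul_nonneg hC w0.le]
    · nlinarith [mul_le_mul_of_nonneg_left (w2.trans (by linarith : 4 * wt (2 * m) ≤ 4 * wt m)) hC]
  refine ⟨4 * (100 * C) ^ 2 * |t|, by positivity, fun M ζ m n hM hζ h1 h2 h3 h4 => ?_⟩
  have hsgn : ‖halfSign m‖ = 1 := by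
    unfold halfSign
    split_ifs <;> simp
  rw [← overlapN_zero_of_window hζ h1 h2 h3 h4, ← mul_sub, norm_mul, hsgn, one_mul]
  have hζ' : (-ζ) ^ 2 = 1 := by rwa [neg_sq]
  have hmv := (convex_uIcc 0 t).norm_image_sub_le_of_norm_hasDerivWithin_le
    (f := fun s => overlapN (2 * M) ζ s m n) (C := 4 * (100 * C) ^ 2 * wt m * wt n)
    (fun s _ => (hasDerivAt_overlapN (by omega) hζ s m n).hasDerivWithinAt)
    (fun s hs => ?_) Set.left_mem_uIcc Set.right_mem_uIcc
  · rw [sub_zero, Real.norm_eq_abs] at hmv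
    linarith
  · have hs' : |s| ≤ |t| := by
      have := Set.abs_sub_left_of_mem_uIcc hs
      simpa using this
    obtain ⟨a1, a2⟩ := hwave M (-ζ) s m hM hζ' hs' h1 h2
    obtain ⟨b1, b2⟩ := hwave M ζ s n hM hζ hs' h3 h4
    rw [norm_mul]
    have p1 := mul_le_mul a2 b1 (norm_nonneg _) ((norm_nonneg _).trans a2)
    have p2 := mul_le_mul a1 b2 (norm_nonneg _) ((norm_nonneg _).trans a1)
    have h5 := norm_add_le
      (ringWave (2 * M) (-ζ) s (2 * m - 1) * (starRingEnd ℂ) (ringWave (2 * M) ζ s (2 * n)))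
      (ringWave (2 * M) (-ζ) s (2 * m) * (starRingEnd ℂ) (ringWave (2 * M) ζ s (2 * n - 1)))
    rw [norm_mul, norm_mul, RCLike.norm_conj, RCLike.norm_conj] at h5
    rw [norm_neg, Complex.norm_ofNat]
    linarith

/-! ### Momentum sums -/

/-- The quasi-momenta with `e^{ipN} = e^{iθ}`, for even `N`. -/
def momentum (N : ℕ) (θ : ℝ) (j : ℕ) : ℝ := -Real.pi + (2 * Real.pi * j + θ) / N

theorem momentum_injective {N : ℕ} (hN : 0 < N) (θ : ℝ) : Function.Injective (momentum N θ) := by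
  intro a b h
  have hN' : (N : ℝ) ≠ 0 := by exact_mod_cast hN.ne'
  unfold momentum at h
  have h1 : (2 * Real.pi * a + θ) / N = (2 * Real.pi * b + θ) / N := by linarith
  rw [div_left_inj' hN'] at h1
  have h2 : 2 * Real.pi * (a : ℝ) = 2 * Real.pi * b := by linarith
  exact_mod_cast mul_left_cancel₀ Real.two_pi_pos.ne' h2

theorem exp_momentum_mul {M : ℕ} (hM : 0 < M) (θ : ℝ) (j : ℕ) :
    Complex.exp (Complex.I * momentum (2 * M) θ j * (2 * M : ℕ)) = Complex.exp (Complex.I * θ) := by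
  rw [Complex.exp_eq_exp_iff_exists_int]
  refine ⟨j - M, ?_⟩
  have hM' : (M : ℂ) ≠ 0 := by exact_mod_cast hM.ne'
  unfold momentum
  push_cast
  field_simp
  ring

theorem quasiMomenta_eq_image {M : ℕ} (hM : 0 < M) {θ : ℝ} (h0 : 0 ≤ θ) (h1 : θ < 2 * Real.pi) :
    quasiMomenta (2 * M) (Complex.exp (Complex.I * θ))
      = momentum (2 * M) θ '' (Finset.range (2 * M) : Set ℕ) := by
  have hM' : (0 : ℝ) < M := by exact_mod_cast hM
  have hpi := Real.pi_pos
  ext p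
  simp only [quasiMomenta, Set.mem_ofPred_eq, Set.mem_image, Finset.coe_range, Set.mem_Iio,
    Set.mem_Ico]
  constructor
  · rintro ⟨⟨hp1, hp2⟩, he⟩
    obtain ⟨n, hn⟩ := Complex.exp_eq_exp_iff_exists_int.mp he
    have hn' : p * (2 * M) = θ + n * (2 * Real.pi) := by
      have : Complex.I * ((p * (2 * M) : ℝ) : ℂ) = Complex.I * ((θ + n * (2 * Real.pi) : ℝ) : ℂ) := by
        push_cast at hn ⊢
        linear_combination hn
      exact_mod_cast mul_left_cancel₀ Complex.I_ne_zero this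
    have hlow : -(M : ℤ) ≤ n := by
      by_contra! h
      have h' : (n : ℝ) ≤ -M - 1 := by exact_mod_cast (by omega : n ≤ -(M : ℤ) - 1)
      nlinarith
    have hup : n < M := by
      by_contra! h
      have h' : (M : ℝ) ≤ n := by exact_mod_cast h
      nlinarith
    refine ⟨(n + M).toNat, by omega, ?_⟩
    have hc : (((n + M).toNat : ℕ) : ℝ) = n + M := by
      have : (((n + M).toNat : ℕ) : ℤ) = n + M := by omega
      exact_mod_cast this
    unfold momentum
    rw [hc]
    push_cast
    field_simp
    linarith
  · rintro ⟨j, hj, rfl⟩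
    have hj' : (j : ℝ) + 1 ≤ 2 * M := by exact_mod_cast hj
    have hd : (0 : ℝ) < (2 * M : ℕ) := by push_cast; linarith
    refine ⟨⟨?_, ?_⟩, exp_momentum_mul hM θ j⟩
    · unfold momentum
      have : 0 ≤ (2 * Real.pi * j + θ) / (2 * M : ℕ) := by positivity
      linarith
    · unfold momentum
      have : (2 * Real.pi * j + θ) / (2 * M : ℕ) < 2 * Real.pi := by
        rw [div_lt_iff₀ hd]
        push_cast
        nlinarith
      linarith

theorem finsum_quasiMomenta {M : ℕ} (hM : 0 < M) {θ : ℝ} (h0 : 0 ≤ θ) (h1 : θ < 2 * Real.pi)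
    (f : ℝ → ℂ) :
    ∑ᶠ (p : ℝ) (_ : p ∈ quasiMomenta (2 * M) (Complex.exp (Complex.I * θ))), f p
      = ∑ j ∈ Finset.range (2 * M), f (momentum (2 * M) θ j) := by
  rw [quasiMomenta_eq_image hM h0 h1,
    finsum_mem_image (momentum_injective (by omega) θ).injOn, finsum_mem_coe_finset]

theorem sum_exp_momentum {M : ℕ} (hM : 0 < M) (θ : ℝ) (d : ℤ) (hd : ¬ ((2 * M : ℕ) : ℤ) ∣ d) :
    ∑ j ∈ Finset.range (2 * M), Complex.exp (Complex.I * (d * momentum (2 * M) θ j)) = 0 := by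
  have hM' : (M : ℂ) ≠ 0 := by exact_mod_cast hM.ne'
  have hpi : (Real.pi : ℂ) ≠ 0 := by exact_mod_cast Real.pi_ne_zero
  set w : ℂ := Complex.exp (2 * Real.pi * Complex.I * d / (2 * M : ℕ)) with hw
  have h1 : ∀ j : ℕ, Complex.exp (Complex.I * (d * momentum (2 * M) θ j))
      = Complex.exp (Complex.I * (d * (-Real.pi + θ / (2 * M : ℕ)))) * w ^ j := fun j => by
    rw [hw, ← Complex.exp_nat_mul, ← Complex.exp_add]
    congr 1
    unfold momentum
    push_cast
    field_simp
    ring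
  simp only [h1]
  rw [← Finset.mul_sum]
  have hwN : w ^ (2 * M) = 1 := by
    rw [hw, ← Complex.exp_nat_mul, Complex.exp_eq_one_iff]
    refine ⟨d, ?_⟩
    push_cast
    field_simp
  have hw1 : w ≠ 1 := by
    intro h
    obtain ⟨n, hn⟩ := Complex.exp_eq_one_iff.mp h
    apply hd
    refine ⟨n, ?_⟩
    have h2 : (d : ℂ) = 2 * M * n := by
      push_cast at hn
      field_simp at hn
      linear_combination hn
    push_cast
    exact_mod_cast h2
  have h2 : (w - 1) * ∑ j ∈ Finset.range (2 * M), w ^ j = 0 := by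
    rw [mul_geom_sum, hwN, sub_self]
  rw [(mul_eq_zero.mp h2).resolve_left (sub_ne_zero.mpr hw1), mul_zero]

/-- Evolved plane waves. -/
def planeWave (t p : ℝ) (y : ℤ) : ℂ := Complex.exp (Complex.I * (y * p + t * dispersion p))

theorem hasSum_planeWave (t p : ℝ) (y : ℤ) :
    HasSum (fun k : ℤ => (amp t k : ℂ) * Complex.I ^ k * Complex.exp (Complex.I * ((y - k : ℤ) * p)))
      (planeWave t p y) := by
  have h := (hasSum_besselJ_mul_exp (4 * t) (Real.pi / 2 - p)).mul_left
    (Complex.exp (Complex.I * (y * p)))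
  rw [Real.sin_pi_div_two_sub, ← Complex.exp_add] at h
  have e : Complex.I * (y * p) + Complex.I * ((4 * t : ℝ) * Real.cos p)
      = Complex.I * (y * p + t * dispersion p) := by
    unfold dispersion
    push_cast
    ring
  rw [e] at h
  refine h.congr_fun fun k => ?_
  have e2 : Complex.I ^ k = Complex.exp (k * (Real.pi / 2 * Complex.I)) := by
    rw [Complex.exp_int_mul, Complex.exp_pi_div_two_mul_I]
  rw [e2, mul_assoc, ← Complex.exp_add, mul_left_comm (Complex.exp _), ← Complex.exp_add]
  unfold amp
  congr 2
  push_cast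
  ring

/-- After the Jacobi–Anger expansion the momentum sum keeps only displacements that are multiples of
2M, that is, the images. The image l carries z^l and I^(2Ml), hence the twist (-1)^M z. -/
theorem sum_planeWave {M : ℕ} (hM : 0 < M) {θ z : ℝ} (hz : Complex.exp (Complex.I * θ) = z)
    (hz2 : z ^ 2 = 1) (t : ℝ) (y : ℤ) :
    (∑ j ∈ Finset.range (2 * M), planeWave t (momentum (2 * M) θ j) y)
      = (2 * M : ℕ) * (Complex.I ^ y * ringAmp (2 * M) ((-1) ^ M * z) t y) := by
  have hzinv : z⁻¹ = z :=
    (eq_inv_of_mul_eq_one_left (by rw [← sq, hz2])).symm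
  have h1 := hasSum_sum fun j (_ : j ∈ Finset.range (2 * M)) =>
    hasSum_planeWave t (momentum (2 * M) θ j) y
  simp only [← Finset.mul_sum] at h1
  have hinj := injective_add_mul (N := 2 * M) (by omega) y
  rw [← hinj.hasSum_iff] at h1
  · refine h1.unique ?_
    have hζ : ((-1) ^ M * z) ^ 2 = 1 := by rw [mul_pow, hz2, ← pow_mul, mul_comm M, pow_mul]; norm_num
    have h2 := (Complex.hasSum_ofReal.mpr (summable_ringAmp (N := 2 * M) (by omega) hζ t y).hasSum)
    have h3 := (h2.mul_left (Complex.I ^ y)).mul_left ((2 * M : ℕ) : ℂ)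
    refine h3.congr_fun fun l => ?_
    simp only [Function.comp]
    have e1 : ∀ j ∈ Finset.range (2 * M),
        Complex.exp (Complex.I * (((y - (y + l * (2 * M : ℕ)) : ℤ) : ℂ) * momentum (2 * M) θ j))
          = (z : ℂ) ^ l := fun j _ => by
      have := exp_momentum_mul hM θ j
      rw [hz] at this
      rw [show Complex.I * (((y - (y + l * (2 * M : ℕ)) : ℤ) : ℂ) * momentum (2 * M) θ j)
        = ((-l : ℤ) : ℂ) * (Complex.I * momentum (2 * M) θ j * (2 * M : ℕ)) by push_cast; ring,
        Complex.exp_int_mul, this, zpow_neg, ← inv_zpow]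
      congr 1
      exact_mod_cast hzinv
    rw [Finset.sum_congr rfl e1, Finset.sum_const, Finset.card_range, nsmul_eq_mul]
    have e2 : Complex.I ^ (y + l * ((2 * M : ℕ) : ℤ)) = Complex.I ^ y * ((-1) ^ M) ^ l := by
      rw [zpow_add₀ Complex.I_ne_zero, mul_comm l, zpow_mul, zpow_natCast, pow_mul, Complex.I_sq]
    rw [e2]
    push_cast
    rw [mul_zpow]
    ring
  · intro k hk
    rw [sum_exp_momentum hM, mul_zero]
    rintro ⟨l, hl⟩
    exact hk ⟨-l, by simp only; linarith⟩

theorem sum_planeWave_add {M : ℕ} (hM : 0 < M) {θ z : ℝ} (hz : Complex.exp (Complex.I * θ) = z)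
    (hz2 : z ^ 2 = 1) (t : ℝ) (y : ℤ) :
    (∑ j ∈ Finset.range (2 * M), (planeWave t (momentum (2 * M) θ j) y
        + planeWave t (momentum (2 * M) θ j) (y - 1)))
      = (2 * M : ℕ) * (Complex.I ^ y * ringWave (2 * M) ((-1) ^ M * z) t y) := by
  rw [Finset.sum_add_distrib, sum_planeWave hM hz hz2, sum_planeWave hM hz hz2,
    zpow_sub_one₀ Complex.I_ne_zero, Complex.inv_I, ringWave]
  ring

/-- With w = e^{i(p-q)} one has w^N = -1, so 1/(w - 1) is -1/2 times the geometric sum of w^x. Each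
term of that sum factors into a function of p and a function of q. -/
theorem PhiN_summand_eq {N : ℕ} {p q : ℝ} (hp : Complex.exp (Complex.I * p * N) = 1)
    (hq : Complex.exp (Complex.I * q * N) = -1) (m n : ℤ) (t : ℝ) :
    (1 + Complex.exp (-(Complex.I * p))) * (1 + Complex.exp (Complex.I * q))
      * Complex.exp (Complex.I * (2 * (m * p - n * q) + t * (dispersion p - dispersion q)))
      / (Complex.exp (Complex.I * (p - q)) - 1)
    = -(∑ x ∈ Finset.range N, (planeWave t p (2 * m + x) + planeWave t p (2 * m + x - 1))
      * (starRingEnd ℂ) (planeWave t q (2 * n + x) + planeWave t q (2 * n + x - 1))) / 2 := by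
  set w := Complex.exp (Complex.I * (p - q)) with hw
  have hwN : w ^ N = -1 := by
    rw [hw, ← Complex.exp_nat_mul, show (N : ℂ) * (Complex.I * (p - q))
      = Complex.I * p * N - Complex.I * q * N by ring, Complex.exp_sub, hp, hq]
    norm_num
  have hw1 : w - 1 ≠ 0 := by
    intro h
    rw [sub_eq_zero.mp h, one_pow] at hwN
    norm_num at hwN
  have hgeom : (w - 1) * ∑ x ∈ Finset.range N, w ^ x = -2 := by
    rw [mul_geom_sum, hwN]
    norm_num
  have hconj : ∀ y : ℤ, (starRingEnd ℂ) (planeWave t q y)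
      = Complex.exp (-(Complex.I * (y * q + t * dispersion q))) := fun y => by
    unfold planeWave
    rw [← Complex.exp_conj]
    simp
  have hterm : ∀ x ∈ Finset.range N,
      (planeWave t p (2 * m + x) + planeWave t p (2 * m + x - 1))
        * (starRingEnd ℂ) (planeWave t q (2 * n + x) + planeWave t q (2 * n + x - 1))
      = (1 + Complex.exp (-(Complex.I * p))) * (1 + Complex.exp (Complex.I * q))
        * Complex.exp (Complex.I * (2 * (m * p - n * q) + t * (dispersion p - dispersion q)))
        * w ^ x := fun x _ => by
    rw [map_add, hconj, hconj, hw, ← Complex.exp_nat_mul]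
    have e1 : planeWave t p (2 * m + x - 1)
        = Complex.exp (-(Complex.I * p)) * planeWave t p (2 * m + x) := by
      unfold planeWave
      rw [← Complex.exp_add]
      congr 1
      push_cast
      ring
    have e2 : Complex.exp (-(Complex.I * (((2 * n + x - 1 : ℤ) : ℂ) * q + t * dispersion q)))
        = Complex.exp (Complex.I * q)
          * Complex.exp (-(Complex.I * (((2 * n + x : ℤ) : ℂ) * q + t * dispersion q))) := by
      rw [← Complex.exp_add]
      congr 1
      push_cast
      ring
    have e3 : planeWave t p (2 * m + x)
        * Complex.exp (-(Complex.I * (((2 * n + x : ℤ) : ℂ) * q + t * dispersion q)))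
        = Complex.exp (Complex.I * (2 * (m * p - n * q) + t * (dispersion p - dispersion q)))
          * Complex.exp (x * (Complex.I * (p - q))) := by
      unfold planeWave
      rw [← Complex.exp_add, ← Complex.exp_add]
      congr 1
      push_cast
      ring
    rw [e1, e2]
    linear_combination (1 + Complex.exp (-(Complex.I * p))) * (1 + Complex.exp (Complex.I * q)) * e3
  rw [Finset.sum_congr rfl hterm, ← Finset.mul_sum, div_eq_iff hw1]
  linear_combination ((1 + Complex.exp (-(Complex.I * p))) * (1 + Complex.exp (Complex.I * q))
        * Complex.exp (Complex.I * (2 * (m * p - n * q) + t * (dispersion p - dispersion q)))) / 2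
        * hgeom

theorem sum_sum_mul_conj (s : Finset ℕ) (f g : ℕ → ℕ → ℂ) :
    ∑ a ∈ s, ∑ b ∈ s, -(∑ x ∈ s, f a x * (starRingEnd ℂ) (g b x)) / 2
      = -(∑ x ∈ s, (∑ a ∈ s, f a x) * (starRingEnd ℂ) (∑ b ∈ s, g b x)) / 2 := by
  simp only [map_sum, Finset.sum_mul_sum, ← Finset.sum_div, Finset.sum_neg_distrib]
  rw [Finset.sum_comm (f := fun x a => ∑ b ∈ s, f a x * (starRingEnd ℂ) (g b x))]
  simp only [Finset.sum_comm (f := fun b x => f _ x * (starRingEnd ℂ) (g b x))]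

/-- The sets B₊ and B₋ give the opposite twists (-1)^M and -(-1)^M, and the powers of I collapse to
(-1)^(m-n). Reversing the order of the bonds and translating by a period yields a minus sign that
cancels the one of the geometric sum. -/
theorem PhiN_eq_overlapN {M : ℕ} (hM : 0 < M) (m n : ℤ) (t : ℝ) :
    PhiN (2 * M) m n t = (-1) ^ (m - n) * overlapN (2 * M) (-(-1) ^ M) t m n := by
  have hpi := Real.pi_pos
  have hM' : ((2 * M : ℕ) : ℂ) ≠ 0 := by exact_mod_cast (by omega : 2 * M ≠ 0)
  have z1 : Complex.exp (Complex.I * ((0 : ℝ) : ℂ)) = ((1 : ℝ) : ℂ) := by simp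
  have z2 : Complex.exp (Complex.I * (Real.pi : ℝ)) = ((-1 : ℝ) : ℂ) := by
    rw [mul_comm, Complex.exp_pi_mul_I]
    simp
  have f1 := finsum_quasiMomenta hM (θ := 0) le_rfl (by positivity)
  have f2 := finsum_quasiMomenta hM (θ := Real.pi) hpi.le (by linarith)
  rw [z1] at f1
  rw [z2] at f2
  push_cast at f1 f2
  have s1 := sum_planeWave_add hM z1 (by norm_num) t
  have s2 := sum_planeWave_add hM z2 (by norm_num) t
  unfold PhiN
  rw [f1]
  simp only [f2]
  have h1 : ∀ a ∈ Finset.range (2 * M), ∀ b ∈ Finset.range (2 * M), _ := fun a _ b _ =>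
    PhiN_summand_eq ((exp_momentum_mul hM 0 a).trans (z1.trans Complex.ofReal_one))
      ((exp_momentum_mul hM Real.pi b).trans (z2.trans (by simp))) m n t
  rw [Finset.sum_congr rfl fun a ha => Finset.sum_congr rfl fun b hb => h1 a ha b hb]
  have h2 : ∑ a ∈ Finset.range (2 * M), ∑ b ∈ Finset.range (2 * M),
      -(∑ x ∈ Finset.range (2 * M), (planeWave t (momentum (2 * M) 0 a) (2 * m + x)
          + planeWave t (momentum (2 * M) 0 a) (2 * m + x - 1))
        * (starRingEnd ℂ) (planeWave t (momentum (2 * M) Real.pi b) (2 * n + x)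
          + planeWave t (momentum (2 * M) Real.pi b) (2 * n + x - 1))) / 2
      = -(∑ x ∈ Finset.range (2 * M), (∑ a ∈ Finset.range (2 * M),
            (planeWave t (momentum (2 * M) 0 a) (2 * m + x)
              + planeWave t (momentum (2 * M) 0 a) (2 * m + x - 1)))
          * (starRingEnd ℂ) (∑ b ∈ Finset.range (2 * M),
            (planeWave t (momentum (2 * M) Real.pi b) (2 * n + x)
              + planeWave t (momentum (2 * M) Real.pi b) (2 * n + x - 1)))) / 2 :=
    sum_sum_mul_conj _ _ _
  rw [h2]
  simp only [s1, s2]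
  have hI : ∀ x : ℤ, Complex.I ^ (2 * m + x) * (starRingEnd ℂ) (Complex.I ^ (2 * n + x))
      = (-1) ^ (m - n) := fun x => by
    rw [map_zpow₀, Complex.conj_I, ← Complex.inv_I, inv_zpow, ← zpow_neg,
      ← zpow_add₀ Complex.I_ne_zero, show 2 * m + x + -(2 * n + x) = 2 * (m - n) by ring, zpow_mul]
    congr 1
    exact_mod_cast Complex.I_sq
  have hζ : (-(-1 : ℝ) ^ M) ^ 2 = 1 := by rw [neg_sq, ← pow_mul, mul_comm M, pow_mul]; norm_num
  unfold overlapN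
  rw [← Finset.sum_range_reflect]
  simp only [map_mul, Complex.conj_natCast]
  have h3 : ∀ x ∈ Finset.range (2 * M), 
      ((2 * M : ℕ) : ℂ) * (Complex.I ^ (2 * m + ((2 * M - 1 - x : ℕ) : ℤ))
        * ringWave (2 * M) ((-1) ^ M * 1) t (2 * m + ((2 * M - 1 - x : ℕ) : ℤ)))
      * (((2 * M : ℕ) : ℂ) * ((starRingEnd ℂ) (Complex.I ^ (2 * n + ((2 * M - 1 - x : ℕ) : ℤ)))
        * (starRingEnd ℂ)
          (ringWave (2 * M) ((-1) ^ M * -1) t (2 * n + ((2 * M - 1 - x : ℕ) : ℤ)))))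
      = -(((2 * M : ℕ) : ℂ) ^ 2 * (-1) ^ (m - n)) * 
        (ringWave (2 * M) (-(-(-1) ^ M)) t (2 * m - 1 - x)
          * (starRingEnd ℂ) (ringWave (2 * M) (-(-1) ^ M) t (2 * n - 1 - x))) := fun x hx => by
    have hx' := Finset.mem_range.mp hx
    have e : ((2 * M - 1 - x : ℕ) : ℤ) = (2 * M : ℕ) - 1 - x := by omega
    have h4 := ringWave_mul_conj_sub_period (2 * M) hζ t (2 * m + ((2 * M - 1 - x : ℕ) : ℤ))
      (2 * n + ((2 * M - 1 - x : ℕ) : ℤ))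
    have h5 := hI ((2 * M - 1 - x : ℕ) : ℤ)
    rw [show 2 * m + ((2 * M - 1 - x : ℕ) : ℤ) - (2 * M : ℕ) = 2 * m - 1 - x by omega,
      show 2 * n + ((2 * M - 1 - x : ℕ) : ℤ) - (2 * M : ℕ) = 2 * n - 1 - x by omega] at h4
    rw [h4, neg_neg, mul_one, mul_neg_one]
    linear_combination ((2 * M : ℕ) : ℂ) ^ 2
      * (ringWave (2 * M) ((-1) ^ M) t (2 * m + ((2 * M - 1 - x : ℕ) : ℤ)) * (starRingEnd ℂ)
        (ringWave (2 * M) (-(-1) ^ M) t (2 * n + ((2 * M - 1 - x : ℕ) : ℤ)))) * h5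
  rw [Finset.sum_congr rfl h3, ← Finset.mul_sum]
  field_simp

theorem tendsto_PhiN (t : ℝ) (m n : ℤ) :
    Tendsto (fun L : ℕ => PhiN (2 * (L + 1)) m n t) atTop
      (𝓝 ((-1 : ℂ) ^ (m - n) * limitKernel t m n)) := by
  have h := (tendsto_overlapN (fun N => -(-1) ^ (N / 2))
    (fun N => by rw [neg_sq, ← pow_mul, mul_comm, pow_mul]; norm_num) t m n).const_mul
    ((-1 : ℂ) ^ (m - n))
  refine (h.comp (tendsto_add_atTop_nat 1)).congr fun L => ?_
  rw [PhiN_eq_overlapN (Nat.succ_pos L)]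
  simp

/-! ### Convergence of determinants of growing size -/

/-- The Leibniz sum over permutations is enlarged to all self-maps of the index set, and that sum
factors into column sums. -/
theorem norm_det_le_prod_sum {n : Type*} [Fintype n] [DecidableEq n] (A : Matrix n n ℂ) :
    ‖A.det‖ ≤ ∏ i, ∑ j, ‖A j i‖ := by
  rw [Matrix.det_apply]
  refine (norm_sum_le _ _).trans ?_
  have h1 : ∀ σ : Equiv.Perm n, ‖Equiv.Perm.sign σ • ∏ i, A (σ i) i‖ = ∏ i, ‖A (σ i) i‖ := fun σ => by
    rw [Units.smul_def, zsmul_eq_mul, norm_mul, norm_prod]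
    rcases Int.units_eq_one_or (Equiv.Perm.sign σ) with h | h <;> simp [h]
  simp only [h1]
  rw [Finset.prod_univ_sum, Fintype.piFinset_univ]
  have h2 : ∑ σ : Equiv.Perm n, ∏ i, ‖A (σ i) i‖
      = ∑ f ∈ Finset.univ.map ⟨fun σ : Equiv.Perm n => (σ : n → n), DFunLike.coe_injective⟩,
        ∏ i, ‖A (f i) i‖ := by
    rw [Finset.sum_map]
    rfl
  rw [h2]
  exact Finset.sum_le_sum_of_subset_of_nonneg (Finset.subset_univ _)
    fun f _ _ => Finset.prod_nonneg fun i _ => norm_nonneg _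

theorem det_ite_one {n : Type*} [Fintype n] [DecidableEq n] (A : Matrix n n ℂ) (S : Finset n) :
    (Matrix.of fun i j => if i ∈ S then A i j else if i = j then 1 else 0).det
      = (Matrix.of fun i j : S => A i j).det := by
  rw [Matrix.twoBlockTriangular_det _ (fun i => i ∈ S)]
  · have h1 : Matrix.toSquareBlockProp
        (Matrix.of fun i j => if i ∈ S then A i j else if i = j then 1 else 0) (fun i => i ∈ S)
        = Matrix.of fun i j : S => A i j := by
      ext i j
      simp [Matrix.toSquareBlockProp]
    have h2 : Matrix.toSquareBlockProp
        (Matrix.of fun i j => if i ∈ S then A i j else if i = j then 1 else 0) (fun i => ¬ i ∈ S)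
        = 1 := by
      ext i j
      have := i.2
      simp [Matrix.toSquareBlockProp, Matrix.one_apply, Subtype.ext_iff, this]
    rw [h1, h2, Matrix.det_one, mul_one]
    congr!
  · intro i hi j hj
    have : i ≠ j := by
      rintro rfl
      exact hi hj
    simp [hi, this]

/-- Multilinearity in the rows: choosing A in the rows of S and the identity elsewhere leaves the
principal minor on S. -/
theorem det_one_add_eq_sum {n : Type*} [Fintype n] [DecidableEq n] (A : Matrix n n ℂ) :
    (1 + A).det = ∑ S : Finset n, (Matrix.of fun i j : S => A i j).det := by
  have h := (Matrix.detRowAlternating (n := n) (R := ℂ)).map_add_univ (fun i j => A i j)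
    (fun i j => if i = j then 1 else 0)
  rw [← Finset.sum_congr rfl fun S _ => det_ite_one A S]
  unfold Matrix.det
  convert h using 2 with S
  · congr 1
    ext i j
    simp [Matrix.one_apply, add_comm]
  · congr 1
    ext i j
    simp only [Finset.piecewise, Matrix.of_apply]
    by_cases hi : i ∈ S
    · rw [if_pos hi, if_pos hi]
    · rw [if_neg hi, if_neg hi]

theorem det_one_add_eq_sum_powerset {ι : Type*} [DecidableEq ι] (W : Finset ι) (κ : ι → ι → ℂ) :
    (Matrix.of fun i j : W => (if i = j then 1 else 0) + κ i j).det
      = ∑ S ∈ W.powerset, (Matrix.of fun i j : S => κ i j).det := by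
  have h := det_one_add_eq_sum (Matrix.of fun i j : W => κ i j)
  have e : (1 + Matrix.of fun i j : W => κ i j)
      = Matrix.of fun i j : W => (if i = j then 1 else 0) + κ i j := by
    ext i j
    simp [Matrix.one_apply]
  rw [← e, h]
  refine Finset.sum_bij (fun S _ => S.map (Function.Embedding.subtype _)) ?_ ?_ ?_ ?_
  · intro S _
    rw [Finset.mem_powerset]
    exact Finset.map_subtype_subset S
  · intro S _ T _ h
    exact Finset.map_injective _ h
  · intro S hS
    refine ⟨Finset.subtype (· ∈ W) S, Finset.mem_univ _, ?_⟩
    exact Finset.subtype_map_of_mem fun x hx => Finset.mem_powerset.mp hS hx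
  · intro S _
    let e : S ≃ (S.map (Function.Embedding.subtype (· ∈ W)) : Finset ι) :=
      Equiv.ofBijective (fun x => ⟨x.1.1, Finset.mem_map_of_mem _ x.2⟩) ⟨fun x y h => by
        have h' := congrArg Subtype.val h
        exact Subtype.ext (Subtype.ext h'), fun y => by
        obtain ⟨x, hx, hxy⟩ := Finset.mem_map.mp y.2
        exact ⟨⟨x, hx⟩, Subtype.ext hxy⟩⟩
    rw [← Matrix.det_submatrix_equiv_self e]
    rfl

/-- Each principal minor is a fixed finite polynomial in the entries and converges; the sum over all
finite index sets is controlled by dominated convergence. The limit does not depend on the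
exhausting sets W. -/
theorem tendsto_det_one_add {ι : Type*} [DecidableEq ι] {b : ι → ℝ} (hb : ∀ i, 0 ≤ b i)
    (hs : Summable b) {W : ℕ → Finset ι} (hW : ∀ i, ∀ᶠ N in atTop, i ∈ W N)
    {κ : ℕ → ι → ι → ℂ} {κlim : ι → ι → ℂ} {C : ℝ} (hC : 0 ≤ C)
    (hbound : ∀ N, ∀ i ∈ W N, ∀ j ∈ W N, ‖κ N i j‖ ≤ C * b i * b j)
    (hlim : ∀ i j, Tendsto (fun N => κ N i j) atTop (𝓝 (κlim i j))) :
    Tendsto (fun N => (Matrix.of fun i j : W N => (if i = j then 1 else 0) + κ N i j).det) atTop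
      (𝓝 (∑' S : Finset ι, (Matrix.of fun i j : S => κlim i j).det)) := by
  simp only [det_one_add_eq_sum_powerset]
  have key : Tendsto (fun N => ∑' S : Finset ι,
      if S ⊆ W N then (Matrix.of fun i j : S => κ N i j).det else 0) atTop
      (𝓝 (∑' S : Finset ι, (Matrix.of fun i j : S => κlim i j).det)) := by
    refine tendsto_tsum_of_dominated_convergence
      -- Column i of a minor has absolute sum at most C·(Σ b)·b i. The products over finite sets are
      -- summable because b is: their total is an infinite product of factors 1 + C·(Σ b)·b i.
      (bound := fun S : Finset ι => ∏ i ∈ S, C * (∑' j, b j) * b i) ?_ (fun S => ?_) ?_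
    · have hB : 0 ≤ ∑' j, b j := tsum_nonneg hb
      exact summable_finsetProd_of_summable_nonneg
        (fun i => mul_nonneg (mul_nonneg hC hB) (hb i)) (hs.mul_left _)
    · have h1 : Tendsto (fun N => (Matrix.of fun i j : S => κ N i j).det) atTop
          (𝓝 (Matrix.of fun i j : S => κlim i j).det) := by
        simp only [Matrix.det_apply]
        refine tendsto_finsetSum _ fun σ _ => Tendsto.const_smul ?_ _
        exact tendsto_finsetProd _ fun i _ => hlim _ _
      refine h1.congr' ?_
      have h2 : ∀ᶠ N in atTop, ∀ i ∈ S, i ∈ W N := (Filter.eventually_all_finset S).mpr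
        fun i _ => hW i
      filter_upwards [h2] with N hN
      rw [if_pos (show S ⊆ W N from hN)]
    · refine Eventually.of_forall fun N S => ?_
      split_ifs with h
      · refine (norm_det_le_prod_sum _).trans ?_
        rw [← Finset.prod_coe_sort S]
        refine Finset.prod_le_prod (fun i _ => Finset.sum_nonneg fun j _ => norm_nonneg _)
          fun i _ => ?_
        calc ∑ j : S, ‖κ N j i‖ ≤ ∑ j : S, C * b j * b i :=
              Finset.sum_le_sum fun j _ => hbound N j (h j.2) i (h i.2)
          _ = C * (∑ j : S, b j) * b i := by rw [← Finset.sum_mul, ← Finset.mul_sum]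
          _ ≤ C * (∑' j, b j) * b i := by
              have h3 : ∑ j : S, b j ≤ ∑' j, b j := by
                rw [Finset.sum_coe_sort S]
                exact hs.sum_le_tsum S fun i _ => hb i
              have := hb i
              gcongr
      · rw [norm_zero]
        have hB : 0 ≤ ∑' j, b j := tsum_nonneg hb
        exact Finset.prod_nonneg fun i _ => mul_nonneg (mul_nonneg hC hB) (hb i)
  refine key.congr fun N => ?_
  rw [tsum_eq_sum (s := (W N).powerset)]
  · exact Finset.sum_congr rfl fun S hS => if_pos (Finset.mem_powerset.mp hS)
  · intro S hS
    exact if_neg (by simpa using hS)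

/-! ### A product basis in which the Hamiltonian moves domain walls -/

theorem tensorOp_mul {N : ℕ} (A B : Fin N → Matrix (Fin 2) (Fin 2) ℂ) :
    tensorOp A * tensorOp B = tensorOp fun k => A k * B k := by
  ext s s'
  simp only [tensorOp, Matrix.mul_apply, Matrix.of_apply, ← Finset.prod_mul_distrib]
  rw [Finset.prod_univ_sum, Fintype.piFinset_univ]

theorem tensorOp_one {N : ℕ} : tensorOp (fun _ : Fin N => 1) = 1 := by
  ext s s'
  simp only [tensorOp, Matrix.of_apply, Matrix.one_apply, Finset.prod_ite_zero, Finset.prod_const_one,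
    Finset.mem_univ, true_imp_iff, funext_iff]

theorem conjTranspose_tensorOp {N : ℕ} (A : Fin N → Matrix (Fin 2) (Fin 2) ℂ) :
    (tensorOp A).conjTranspose = tensorOp fun k => (A k).conjTranspose := by
  ext s s'
  simp [tensorOp, Matrix.conjTranspose_apply, star_prod]

theorem siteOp_mul_tensorOp {N : ℕ} {A B : Matrix (Fin 2) (Fin 2) ℂ}
    {u : Fin N → Matrix (Fin 2) (Fin 2) ℂ} {n : Fin N} (h : A * u n = u n * B) :
    siteOp A n * tensorOp u = tensorOp u * siteOp B n := by
  unfold siteOp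
  rw [tensorOp_mul, tensorOp_mul]
  congr 1
  funext k
  by_cases hk : k = n
  · subst hk
    simpa using h
  · simp [Function.update_of_ne hk]

theorem siteOp_commute {N : ℕ} (A B : Matrix (Fin 2) (Fin 2) ℂ) {m n : Fin N} (h : m ≠ n) :
    siteOp A m * siteOp B n = siteOp B n * siteOp A m := by
  unfold siteOp
  rw [tensorOp_mul, tensorOp_mul]
  congr 1
  funext k
  by_cases hk : k = m
  · subst hk
    simp [Function.update_of_ne h]
  · simp [Function.update_of_ne hk]

theorem conjTranspose_siteOp {N : ℕ} (A : Matrix (Fin 2) (Fin 2) ℂ) (n : Fin N) :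
    (siteOp A n).conjTranspose = siteOp A.conjTranspose n := by
  unfold siteOp
  rw [conjTranspose_tensorOp]
  congr 1
  funext k
  by_cases hk : k = n
  · subst hk
    simp
  · simp [Function.update_of_ne hk]

theorem mulVec_apply_eq_sum {m n : Type*} [Fintype n] (A : Matrix m n ℂ) (ψ : n → ℂ) (i : m) :
    A.mulVec ψ i = ∑ j, A i j * ψ j := rfl

theorem siteOp_mulVec {N : ℕ} (A : Matrix (Fin 2) (Fin 2) ℂ) (n : Fin N) (ψ : Config N → ℂ)
    (s : Config N) :
    (siteOp A n).mulVec ψ s = ∑ a, A (s n) a * ψ (Function.update s n a) := by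
  rw [mulVec_apply_eq_sum]
  symm
  refine Fintype.sum_of_injective (fun a => Function.update s n a)
    (Function.update_injective s n) _ _ (fun s' hs' => ?_) (fun a => ?_)
  · obtain ⟨k, hk, hne⟩ : ∃ k, k ≠ n ∧ s k ≠ s' k := by
      by_contra! h
      refine hs' ⟨s' n, ?_⟩
      funext k
      by_cases hk : k = n
      · subst hk; simp
      · simp [Function.update_of_ne hk, h k hk]
    have : siteOp A n s s' = 0 := by
      unfold siteOp tensorOp
      rw [Matrix.of_apply]
      refine Finset.prod_eq_zero (Finset.mem_univ k) ?_
      rw [Function.update_of_ne hk, Matrix.one_apply_ne hne]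
    rw [this, zero_mul]
  · congr 1
    unfold siteOp tensorOp
    rw [Matrix.of_apply, Finset.prod_eq_single n]
    · simp
    · intro k _ hk
      simp [Function.update_of_ne hk]
    · simp

/-- The Pauli matrix `σ^z`. -/
def sigmaZ : Matrix (Fin 2) (Fin 2) ℂ := !![1, 0; 0, -1]

/-- The local change of basis: eigenvectors of `σ^x` on even sites, of `σ^y` on odd sites. -/
def localBasis (n : ℕ) : Matrix (Fin 2) (Fin 2) ℂ :=
  ((1 / Real.sqrt 2 : ℝ) : ℂ) • if Even n then !![1, 1; 1, -1] else !![1, 1; Complex.I, -Complex.I]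

/-- `σ^x` in the local basis. -/
def localX (n : ℕ) : Matrix (Fin 2) (Fin 2) ℂ := if Even n then sigmaZ else sigmaY

/-- `σ^y` in the local basis. -/
def localY (n : ℕ) : Matrix (Fin 2) (Fin 2) ℂ := if Even n then -sigmaY else sigmaZ

theorem sigmaX_mul_localBasis (n : ℕ) : sigmaX * localBasis n = localBasis n * localX n := by
  unfold localBasis localX
  rw [Matrix.mul_smul, Matrix.smul_mul]
  congr 1
  split_ifs <;> ext i j <;> fin_cases i <;> fin_cases j <;>
    simp [sigmaX, sigmaY, sigmaZ, Matrix.mul_apply]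

theorem sigmaY_mul_localBasis (n : ℕ) : sigmaY * localBasis n = localBasis n * localY n := by
  unfold localBasis localY
  rw [Matrix.mul_smul, Matrix.smul_mul]
  congr 1
  split_ifs <;> ext i j <;> fin_cases i <;> fin_cases j <;>
    simp [sigmaY, sigmaZ, Matrix.mul_apply]

theorem conjTranspose_localBasis_mul (n : ℕ) : (localBasis n).conjTranspose * localBasis n = 1 := by
  unfold localBasis
  rw [Matrix.conjTranspose_smul, Matrix.smul_mul, Matrix.mul_smul, smul_smul]
  have h : star ((1 / Real.sqrt 2 : ℝ) : ℂ) * ((1 / Real.sqrt 2 : ℝ) : ℂ) = 1 / 2 := by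
    rw [RCLike.star_def, Complex.conj_ofReal, ← Complex.ofReal_mul, div_mul_div_comm, one_mul,
      Real.mul_self_sqrt (by norm_num)]
    norm_num
  rw [h]
  split_ifs <;> ext i j <;> fin_cases i <;> fin_cases j <;>
    simp [Matrix.mul_apply, Matrix.conjTranspose_apply] <;> norm_num

/-- The product basis. -/
def globalBasis (N : ℕ) : Matrix (Config N) (Config N) ℂ := tensorOp fun n => localBasis n

theorem conjTranspose_globalBasis_mul (N : ℕ) :
    (globalBasis N).conjTranspose * globalBasis N = 1 := by
  unfold globalBasis
  rw [conjTranspose_tensorOp, tensorOp_mul]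
  simp only [conjTranspose_localBasis_mul]
  exact tensorOp_one

theorem siteOp_sigmaX_mul_globalBasis {N : ℕ} (n : Fin N) :
    siteOp sigmaX n * globalBasis N = globalBasis N * siteOp (localX n) n :=
  siteOp_mul_tensorOp (sigmaX_mul_localBasis n)

theorem siteOp_sigmaY_mul_globalBasis {N : ℕ} (n : Fin N) :
    siteOp sigmaY n * globalBasis N = globalBasis N * siteOp (localY n) n :=
  siteOp_mul_tensorOp (sigmaY_mul_localBasis n)

/-- The Hamiltonian in the product basis. -/
def wallHamiltonian (N : ℕ) : Matrix (Config N) (Config N) ℂ :=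
  ∑ n : Fin N, (siteOp (localX n) n * siteOp (localX (finRotate N n)) (finRotate N n)
    + siteOp (localY n) n * siteOp (localY (finRotate N n)) (finRotate N n))

theorem hamiltonian_mul_globalBasis (N : ℕ) :
    hamiltonian N * globalBasis N = globalBasis N * wallHamiltonian N := by
  unfold hamiltonian wallHamiltonian
  rw [Finset.sum_mul, Finset.mul_sum]
  refine Finset.sum_congr rfl fun n _ => ?_
  rw [add_mul, mul_add, mul_assoc, siteOp_sigmaX_mul_globalBasis, ← mul_assoc,
    siteOp_sigmaX_mul_globalBasis, mul_assoc, mul_assoc (siteOp sigmaY n),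
    siteOp_sigmaY_mul_globalBasis, ← mul_assoc (siteOp sigmaY n), siteOp_sigmaY_mul_globalBasis,
    mul_assoc (globalBasis N)]

theorem conjTranspose_sigmaX : sigmaX.conjTranspose = sigmaX := by
  ext i j
  fin_cases i <;> fin_cases j <;> simp [sigmaX, Matrix.conjTranspose_apply]

theorem conjTranspose_sigmaY : sigmaY.conjTranspose = sigmaY := by
  ext i j
  fin_cases i <;> fin_cases j <;> simp [sigmaY, Matrix.conjTranspose_apply]

theorem add_one_ne_self {N : ℕ} [NeZero N] (hN : 2 ≤ N) (n : Fin N) : n + 1 ≠ n := by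
  obtain ⟨K, rfl⟩ := Nat.exists_eq_add_of_le' hN
  simp

theorem conjTranspose_hamiltonian {N : ℕ} [NeZero N] (hN : 2 ≤ N) :
    (hamiltonian N).conjTranspose = hamiltonian N := by
  unfold hamiltonian
  rw [Matrix.conjTranspose_sum]
  refine Finset.sum_congr rfl fun n _ => ?_
  have h := add_one_ne_self hN n
  rw [finRotate_apply, Matrix.conjTranspose_add, Matrix.conjTranspose_mul,
    Matrix.conjTranspose_mul]
  simp only [conjTranspose_siteOp, conjTranspose_sigmaX, conjTranspose_sigmaY]
  rw [siteOp_commute _ _ h, siteOp_commute _ _ h]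

/-- Flip the spin at site `n`. -/
def flipAt {N : ℕ} (s : Config N) (n : Fin N) : Config N := Function.update s n (1 - s n)

/-- The type of the bond between the sites `k` and `k + 1`; a wall is a bond of type `-1`. -/
def bondType {N : ℕ} [NeZero N] (s : Config N) (k : Fin N) : ℂ :=
  (-1) ^ ((k : ℕ) + (s k : ℕ) + (s (k + 1) : ℕ))

theorem siteOp_sigmaZ_mulVec {N : ℕ} (n : Fin N) (ψ : Config N → ℂ) (s : Config N) :
    (siteOp sigmaZ n).mulVec ψ s = (-1) ^ (s n : ℕ) * ψ s := by
  have h : ∀ a, a = s n → Function.update s n a = s := fun a ha => by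
    rw [ha, Function.update_eq_self]
  rw [siteOp_mulVec]
  generalize hb : s n = b at *
  fin_cases b <;> simp [sigmaZ, h]

theorem siteOp_sigmaY_mulVec {N : ℕ} (n : Fin N) (ψ : Config N → ℂ) (s : Config N) :
    (siteOp sigmaY n).mulVec ψ s = -Complex.I * (-1) ^ (s n : ℕ) * ψ (flipAt s n) := by
  rw [siteOp_mulVec]
  unfold flipAt
  generalize hb : s n = b at *
  fin_cases b <;> simp [sigmaY]

theorem siteOp_neg {N : ℕ} (A : Matrix (Fin 2) (Fin 2) ℂ) (n : Fin N) :
    siteOp (-A) n = -siteOp A n := by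
  ext s s'
  unfold siteOp tensorOp
  rw [Matrix.neg_apply, Matrix.of_apply, Matrix.of_apply,
    ← Finset.mul_prod_erase _ _ (Finset.mem_univ n), ← Finset.mul_prod_erase _ _ (Finset.mem_univ n),
    ← neg_mul]
  congr 1
  · simp
  · refine Finset.prod_congr rfl fun k hk => ?_
    rw [Function.update_of_ne (Finset.ne_of_mem_erase hk),
      Function.update_of_ne (Finset.ne_of_mem_erase hk)]

/-- The alternation of the two local bases closes around the ring only when N is even. -/
theorem even_add_one_val {N : ℕ} [NeZero N] (hN : Even N) (n : Fin N) :
    Even ((n + 1 : Fin N) : ℕ) ↔ ¬ Even (n : ℕ) := by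
  obtain ⟨K, rfl⟩ := Nat.exists_eq_succ_of_ne_zero (NeZero.ne N)
  have h := Fin.val_add_one n
  change ((n + 1 : Fin (K + 1)) : ℕ) = _ at h
  rw [h]
  split_ifs with hl
  · subst hl
    rw [Fin.val_last]
    simpa [Nat.even_add_one] using hN
  · rw [Nat.even_add_one]

theorem sigmaZ_sigmaY_mulVec {N : ℕ} {m n : Fin N} (ψ : Config N → ℂ) (s : Config N) :
    (siteOp sigmaZ m * siteOp sigmaY n).mulVec ψ s
      = -Complex.I * (-1) ^ ((s m : ℕ) + (s n : ℕ)) * ψ (flipAt s n) := by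
  rw [← Matrix.mulVec_mulVec, siteOp_sigmaZ_mulVec, siteOp_sigmaY_mulVec, pow_add]
  ring

/-- On each bond both terms pair a σ^z with a σ^y, and together they flip either end with amplitude
± the bond type. Collecting by site, a spin flips only if its two bonds have different types, which
moves a wall across that site. -/
theorem wallHamiltonian_mulVec {N : ℕ} [NeZero N] (hN : Even N) (h2 : 2 ≤ N) (ψ : Config N → ℂ)
    (s : Config N) :
    -Complex.I * (wallHamiltonian N).mulVec ψ s
      = ∑ n : Fin N, (bondType s n - bondType s (n - 1)) * ψ (flipAt s n) := by
  have hterm : ∀ n : Fin N,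
      -Complex.I * (siteOp (localX n) n * siteOp (localX (finRotate N n)) (finRotate N n)
        + siteOp (localY n) n * siteOp (localY (finRotate N n)) (finRotate N n)).mulVec ψ s
      = bondType s n * ψ (flipAt s n) - bondType s n * ψ (flipAt s (n + 1)) := fun n => by
    have hne := add_one_ne_self h2 n
    rw [finRotate_apply]
    by_cases he : Even (n : ℕ)
    · have ho : ¬ Even ((n + 1 : Fin N) : ℕ) := by rw [even_add_one_val hN]; simpa using he
      simp only [localX, localY, he, ho, if_true, if_false]
      rw [siteOp_neg, Matrix.neg_mul, siteOp_commute sigmaY sigmaZ hne.symm, ← sub_eq_add_neg,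
        Matrix.sub_mulVec, Pi.sub_apply, sigmaZ_sigmaY_mulVec, sigmaZ_sigmaY_mulVec]
      unfold bondType
      rw [add_assoc, pow_add _ (n : ℕ), he.neg_one_pow, add_comm (s (n + 1) : ℕ)]
      linear_combination ((-1) ^ ((s n : ℕ) + (s (n + 1) : ℕ)) *
        (ψ (flipAt s (n + 1)) - ψ (flipAt s n))) * Complex.I_sq
    · have ho : Even ((n + 1 : Fin N) : ℕ) := by rw [even_add_one_val hN]; exact he
      simp only [localX, localY, he, ho, if_true, if_false]
      rw [siteOp_neg, Matrix.mul_neg, siteOp_commute sigmaY sigmaZ hne.symm, ← sub_eq_add_neg,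
        Matrix.sub_mulVec, Pi.sub_apply, sigmaZ_sigmaY_mulVec, sigmaZ_sigmaY_mulVec]
      unfold bondType
      rw [add_assoc, pow_add _ (n : ℕ), (Nat.not_even_iff_odd.mp he).neg_one_pow,
        add_comm (s (n + 1) : ℕ)]
      linear_combination ((-1) ^ ((s n : ℕ) + (s (n + 1) : ℕ)) *
        (ψ (flipAt s n) - ψ (flipAt s (n + 1)))) * Complex.I_sq
  unfold wallHamiltonian
  rw [Matrix.sum_mulVec, Finset.sum_apply, Finset.mul_sum, Finset.sum_congr rfl fun n _ => hterm n,
    Finset.sum_sub_distrib]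
  simp only [sub_mul, Finset.sum_sub_distrib]
  congr 1
  rw [← Equiv.sum_comp (Equiv.addRight (1 : Fin N)) fun n => bondType s (n - 1) * ψ (flipAt s n)]
  simp

/-- Uniqueness for the Schrödinger equation: e^{iHt} applied to the solution has zero derivative. -/
theorem exp_mulVec_eq_of_hasDerivAt {n : Type*} [Fintype n] [DecidableEq n] (H : Matrix n n ℂ)
    (y : ℝ → n → ℂ) (hy : ∀ t i, HasDerivAt (fun t => y t i) (-Complex.I * H.mulVec (y t) i) t)
    (t : ℝ) : (NormedSpace.exp (-(Complex.I * t) • H)).mulVec (y 0) = y t := by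
  -- The norm is auxiliary; it serves to differentiate the exponential.
  let _ : NormedRing (Matrix n n ℂ) := Matrix.linftyOpNormedRing
  let _ : NormedAlgebra ℝ (Matrix n n ℂ) := Matrix.linftyOpNormedAlgebra
  have hexp : ∀ s : ℝ, (Complex.I * s) • H = s • (Complex.I • H) := fun s => by
    rw [mul_comm, mul_smul]
    rfl
  have hE : ∀ s : ℝ, HasDerivAt (fun s : ℝ => NormedSpace.exp ((Complex.I * s) • H))
      (NormedSpace.exp ((Complex.I * s) • H) * (Complex.I • H)) s := fun s => by
    simp only [hexp]
    exact hasDerivAt_exp_smul_const (𝕂 := ℝ) (Complex.I • H) s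
  have hEij : ∀ (s : ℝ) (i j : n), HasDerivAt (fun s : ℝ => NormedSpace.exp ((Complex.I * s) • H) i j)
      ((NormedSpace.exp ((Complex.I * s) • H) * (Complex.I • H)) i j) s := fun s i j => by
    let e : Matrix n n ℂ →ₗ[ℝ] ℂ := Matrix.entryLinearMap ℝ ℂ i j
    exact e.toContinuousLinearMap.hasFDerivAt.comp_hasDerivAt s (hE s)
  have hz : ∀ (s : ℝ) (i : n), HasDerivAt
      (fun s : ℝ => (NormedSpace.exp ((Complex.I * s) • H)).mulVec (y s) i) 0 s := fun s i => by
    have h := HasDerivAt.fun_sum (u := Finset.univ) fun j (_ : j ∈ Finset.univ) =>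
      (hEij s i j).mul (hy s j)
    refine h.congr_deriv ?_
    rw [Finset.sum_add_distrib]
    have h1 : ∑ j, (NormedSpace.exp ((Complex.I * s) • H) * (Complex.I • H)) i j * y s j
        = Complex.I * (NormedSpace.exp ((Complex.I * s) • H)).mulVec (H.mulVec (y s)) i := by
      rw [Matrix.mulVec_mulVec, Matrix.mul_smul]
      simp only [Matrix.smul_apply, smul_eq_mul, Matrix.mulVec, dotProduct, Finset.mul_sum, mul_assoc]
    have h2 : ∑ j, NormedSpace.exp ((Complex.I * s) • H) i j * (-Complex.I * H.mulVec (y s) j)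
        = -(Complex.I * (NormedSpace.exp ((Complex.I * s) • H)).mulVec (H.mulVec (y s)) i) := by
      rw [Matrix.mulVec, dotProduct, Finset.mul_sum, ← Finset.sum_neg_distrib]
      exact Finset.sum_congr rfl fun j _ => by ring
    rw [h1, h2, add_neg_cancel]
  have hconst : (NormedSpace.exp ((Complex.I * t) • H)).mulVec (y t) = y 0 := by
    funext i
    have := is_const_of_deriv_eq_zero (fun s => (hz s i).differentiableAt) (fun s => (hz s i).deriv)
      t 0
    simpa using this
  rw [← hconst, Matrix.mulVec_mulVec, neg_smul, Matrix.exp_neg, Matrix.nonsing_inv_mul,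
    Matrix.one_mulVec]
  exact (Matrix.isUnit_iff_isUnit_det _).mp (Matrix.isUnit_exp _)

/-- The amplitudes of `Ω` in the product basis. -/
def wallOmega (N : ℕ) : Config N → ℂ :=
  tensorState fun n => if Even (n : ℕ) then ![1, 0] else ![(1 - Complex.I) / 2, (1 + Complex.I) / 2]

theorem globalBasis_mulVec_wallOmega (N : ℕ) : (globalBasis N).mulVec (wallOmega N) = omega N := by
  funext s
  unfold globalBasis wallOmega omega tensorOp tensorState Matrix.mulVec dotProduct
  simp only [Matrix.of_apply, ← Finset.prod_mul_distrib, Pi.smul_apply, smul_eq_mul]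
  rw [← Fintype.piFinset_univ, ← Finset.prod_univ_sum (fun _ => Finset.univ)
    (fun (k : Fin N) a => localBasis k (s k) a * (if Even (k : ℕ) then ![1, 0] else
      ![(1 - Complex.I) / 2, (1 + Complex.I) / 2]) a)]
  have h : ∀ k : Fin N, ∑ a, localBasis k (s k) a * (if Even (k : ℕ) then ![1, 0] else
      ![(1 - Complex.I) / 2, (1 + Complex.I) / 2]) a = ((1 / Real.sqrt 2 : ℝ) : ℂ) := fun k => by
    unfold localBasis
    generalize s k = b
    split_ifs <;> fin_cases b <;> simp [Fin.sum_univ_two]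
    · ring
    · linear_combination (-(Real.sqrt 2 : ℂ)⁻¹) * Complex.I_sq
  have h1 : ∀ k : Fin N, (![1, 1] : Fin 2 → ℂ) (s k) = 1 := fun k => by
    generalize s k = b
    fin_cases b <;> rfl
  rw [Finset.prod_congr rfl fun k _ => h k]
  simp only [h1, Finset.prod_const_one, mul_one, Finset.prod_const, Finset.card_univ,
    Fintype.card_fin]
  rw [← Complex.ofReal_pow, div_pow, one_pow]
  congr 3
  rw [Real.sqrt_eq_rpow, Real.sqrt_eq_rpow, ← Real.rpow_natCast, ← Real.rpow_natCast,
    ← Real.rpow_mul (by norm_num), ← Real.rpow_mul (by norm_num), mul_comm]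

/-- It suffices to exhibit any solution in the wall basis with the right initial value. Site 0 is
even, so the observable there is diagonal. -/
theorem relaxationN_eq_of_hasDerivAt {N : ℕ} [NeZero N] (hN : Even N) (h2 : 2 ≤ N)
    (Ψ : ℝ → Config N → ℂ) (h0 : Ψ 0 = wallOmega N)
    (hΨ : ∀ t s, HasDerivAt (fun t => Ψ t s)
      (∑ n : Fin N, (bondType s n - bondType s (n - 1)) * Ψ t (flipAt s n)) t) (t : ℝ) :
    relaxationN N t = ∑ s : Config N, (-1) ^ (s 0 : ℕ) * (Ψ t s * (starRingEnd ℂ) (Ψ t s)) := by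
  set y : ℝ → Config N → ℂ := fun t => (globalBasis N).mulVec (Ψ t) with hydef
  have hy : ∀ t i, HasDerivAt (fun t => y t i)
      (-Complex.I * (hamiltonian N).mulVec (y t) i) t := fun t i => by
    have h := HasDerivAt.fun_sum (u := Finset.univ) fun s (_ : s ∈ Finset.univ) =>
      (hΨ t s).const_mul (globalBasis N i s)
    refine h.congr_deriv ?_
    rw [hydef, Matrix.mulVec_mulVec, hamiltonian_mul_globalBasis, ← Matrix.mulVec_mulVec,
      Matrix.mulVec, dotProduct, Finset.mul_sum]
    refine Finset.sum_congr rfl fun s _ => ?_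
    rw [← wallHamiltonian_mulVec hN h2]
    ring
  have hy0 : y 0 = omega N := by rw [hydef]; simp only [h0, globalBasis_mulVec_wallOmega]
  have hev := exp_mulVec_eq_of_hasDerivAt (hamiltonian N) y hy t
  rw [hy0] at hev
  have hstar : Matrix.vecMul (star (omega N)) (NormedSpace.exp ((Complex.I * t) • hamiltonian N))
      = star (y t) := by
    rw [← hev, Matrix.star_mulVec, ← Matrix.exp_conjTranspose, Matrix.conjTranspose_smul,
      conjTranspose_hamiltonian h2]
    congr 3
    simp
  unfold relaxationN
  rw [← Matrix.mulVec_mulVec, ← Matrix.mulVec_mulVec, hev, Matrix.dotProduct_mulVec, hstar, hydef]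
  simp only []
  rw [Matrix.mulVec_mulVec, siteOp_sigmaX_mul_globalBasis, ← Matrix.mulVec_mulVec,
    Matrix.star_mulVec, Matrix.dotProduct_mulVec, Matrix.vecMul_vecMul,
    conjTranspose_globalBasis_mul, Matrix.vecMul_one]
  unfold dotProduct
  refine Finset.sum_congr rfl fun s _ => ?_
  have : localX ((0 : Fin N) : ℕ) = sigmaZ := by simp [localX]
  rw [this, siteOp_sigmaZ_mulVec, Pi.star_apply, RCLike.star_def]
  ring

/-! ### Domain walls -/

theorem val_add_one_cases {N : ℕ} [NeZero N] (n : Fin N) :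
    ((n : ℕ) + 1 < N ∧ ((n + 1 : Fin N) : ℕ) = n + 1)
      ∨ ((n : ℕ) + 1 = N ∧ ((n + 1 : Fin N) : ℕ) = 0) := by
  have hn := n.2
  rw [Fin.val_add, Fin.val_one', Nat.add_mod_mod]
  rcases lt_or_eq_of_le (Nat.succ_le_of_lt hn) with h | h
  · exact Or.inl ⟨h, Nat.mod_eq_of_lt h⟩
  · exact Or.inr ⟨h, by rw [show (n : ℕ) + 1 = N from h, Nat.mod_self]⟩

theorem val_sub_one_cases {N : ℕ} [NeZero N] (n : Fin N) :
    (0 < (n : ℕ) ∧ ((n - 1 : Fin N) : ℕ) = n - 1)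
      ∨ ((n : ℕ) = 0 ∧ ((n - 1 : Fin N) : ℕ) = N - 1) := by
  have hn := n.2
  have h1 := (n - 1 : Fin N).2
  have h2 := val_add_one_cases (n - 1)
  rw [sub_add_cancel] at h2
  omega

/-- The bonds that carry a domain wall. -/
def walls {N : ℕ} [NeZero N] (s : Config N) : Finset (Fin N) :=
  Finset.univ.filter fun k => Odd ((k : ℕ) + (s k : ℕ) + (s (k + 1) : ℕ))

theorem mem_walls {N : ℕ} [NeZero N] {s : Config N} {k : Fin N} :
    k ∈ walls s ↔ Odd ((k : ℕ) + (s k : ℕ) + (s (k + 1) : ℕ)) := by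
  simp [walls]

theorem bondType_eq {N : ℕ} [NeZero N] (s : Config N) (k : Fin N) :
    bondType s k = if k ∈ walls s then -1 else 1 := by
  unfold bondType
  split_ifs with h
  · exact (mem_walls.mp h).neg_one_pow
  · exact (Nat.not_odd_iff_even.mp fun h' => h (mem_walls.mpr h')).neg_one_pow

theorem val_one_sub (b : Fin 2) : ((1 - b : Fin 2) : ℕ) = 1 - (b : ℕ) := by
  fin_cases b <;> rfl

theorem mem_walls_flipAt_of_ne {N : ℕ} [NeZero N] {s : Config N} {n k : Fin N} (h1 : k ≠ n)
    (h2 : k ≠ n - 1) : k ∈ walls (flipAt s n) ↔ k ∈ walls s := by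
  have h3 : k + 1 ≠ n := fun h => h2 (eq_sub_of_add_eq h)
  rw [mem_walls, mem_walls, flipAt, Function.update_of_ne h1, Function.update_of_ne h3]

theorem mem_walls_flipAt_self {N : ℕ} [NeZero N] (hN : 2 ≤ N) {s : Config N} {n : Fin N} :
    n ∈ walls (flipAt s n) ↔ n ∉ walls s := by
  have h3 : n + 1 ≠ n := add_one_ne_self hN n
  have := (s n).2
  rw [mem_walls, mem_walls, flipAt, Function.update_self, Function.update_of_ne h3, val_one_sub,
    Nat.odd_iff, Nat.odd_iff]
  omega

theorem sub_one_ne_self {N : ℕ} [NeZero N] (hN : 2 ≤ N) (n : Fin N) : n - 1 ≠ n := fun h => by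
  have := add_one_ne_self hN (n - 1)
  rw [sub_add_cancel] at this
  exact this h.symm

theorem mem_walls_flipAt_sub_one {N : ℕ} [NeZero N] (hN : 2 ≤ N) {s : Config N} {n : Fin N} :
    n - 1 ∈ walls (flipAt s n) ↔ n - 1 ∉ walls s := by
  have h3 : n - 1 ≠ n := sub_one_ne_self hN n
  have := (s n).2
  rw [mem_walls, mem_walls, flipAt, sub_add_cancel, Function.update_self,
    Function.update_of_ne h3, val_one_sub, Nat.odd_iff, Nat.odd_iff]
  omega

theorem walls_flipAt_add_one {N : ℕ} [NeZero N] (hN : 2 ≤ N) {s : Config N} {k : Fin N}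
    (hk : k ∈ walls s) (hk' : k + 1 ∉ walls s) :
    walls (flipAt s (k + 1)) = insert (k + 1) ((walls s).erase k) := by
  ext l
  rw [Finset.mem_insert, Finset.mem_erase]
  by_cases h1 : l = k + 1
  · subst h1
    simp [mem_walls_flipAt_self hN, hk']
  · by_cases h2 : l = k
    · subst h2
      have := mem_walls_flipAt_sub_one hN (s := s) (n := l + 1)
      rw [add_sub_cancel_right] at this
      simp [this, hk, h1]
    · rw [mem_walls_flipAt_of_ne h1 (by rwa [add_sub_cancel_right])]
      simp [h1, h2]

theorem walls_flipAt {N : ℕ} [NeZero N] (hN : 2 ≤ N) {s : Config N} {k : Fin N}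
    (hk : k ∈ walls s) (hk' : k - 1 ∉ walls s) :
    walls (flipAt s k) = insert (k - 1) ((walls s).erase k) := by
  ext l
  rw [Finset.mem_insert, Finset.mem_erase]
  by_cases h1 : l = k - 1
  · subst h1
    simp [mem_walls_flipAt_sub_one hN, hk']
  · by_cases h2 : l = k
    · subst h2
      simp [mem_walls_flipAt_self hN, hk, h1]
    · rw [mem_walls_flipAt_of_ne h2 h1]
      simp [h1, h2]

theorem injective_walls {N : ℕ} [NeZero N] :
    Function.Injective fun s : Config N => (s 0, walls s) := by
  intro s s' h
  obtain ⟨h0, hw⟩ := Prod.mk.inj h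
  have key : ∀ k : ℕ, ∀ hk : k < N, s ⟨k, hk⟩ = s' ⟨k, hk⟩ := by
    intro k
    induction k with
    | zero => intro hk; exact h0
    | succ k ih =>
      intro hk
      have ih' := ih (by omega)
      have h1 : (⟨k, by omega⟩ : Fin N) + 1 = ⟨k + 1, hk⟩ := by
        ext
        rcases val_add_one_cases (⟨k, by omega⟩ : Fin N) with h | h
        · exact h.2
        · have := h.1
          simp only at this
          omega
      have h2 : (⟨k, by omega⟩ : Fin N) ∈ walls s ↔ (⟨k, by omega⟩ : Fin N) ∈ walls s' := by rw [hw]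
      rw [mem_walls, mem_walls, h1, ih', Nat.odd_iff, Nat.odd_iff] at h2
      have a1 := (s ⟨k + 1, hk⟩).2
      have a2 := (s' ⟨k + 1, hk⟩).2
      ext
      omega
  funext k
  exact key k k.2

/-- The spins are rebuilt from the first one by adding bond parities along the chain; only the
closing of the ring is a constraint. -/
theorem exists_config_of_walls {L : ℕ} (a : Fin 2) (T : Finset (Fin (2 * (L + 1))))
    (hT : T.card = L + 1) : ∃ s : Config (2 * (L + 1)), s 0 = a ∧ walls s = T := by
  classical
  let b : ℕ → ℕ := fun j => if ∃ h : j < 2 * (L + 1), (⟨j, h⟩ : Fin (2 * (L + 1))) ∈ T then 1 else 0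
  let c : ℕ → ℕ := fun k => a + ∑ j ∈ Finset.range k, (j + b j)
  have hc : ∀ k, c (k + 1) = c k + (k + b k) := fun k => by
    simp only [c, Finset.sum_range_succ, add_assoc]
  have hb : ∑ j ∈ Finset.range (2 * (L + 1)), b j = L + 1 := by
    have hbj : ∀ j : Fin (2 * (L + 1)), b j = if j ∈ T then 1 else 0 := fun j => by
      have : (∃ h : (j : ℕ) < 2 * (L + 1), (⟨j, h⟩ : Fin (2 * (L + 1))) ∈ T) ↔ j ∈ T :=
        ⟨fun ⟨_, h⟩ => h, fun h => ⟨j.2, h⟩⟩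
      simp only [b, this]
    rw [← Fin.sum_univ_eq_sum_range, Finset.sum_congr rfl fun j _ => hbj j]
    simpa using hT
  have hcN : c (2 * (L + 1)) = a + ((L + 1) * (2 * L + 1) + (L + 1)) := by
    have h1 := Finset.sum_range_id_mul_two (2 * (L + 1))
    have h2 : (2 * (L + 1) - 1) = 2 * L + 1 := by omega
    rw [h2] at h1
    simp only [c, Finset.sum_add_distrib, hb]
    have h3 : (∑ i ∈ Finset.range (2 * (L + 1)), i) = (L + 1) * (2 * L + 1) := by
      have : (∑ i ∈ Finset.range (2 * (L + 1)), i) * 2 = ((L + 1) * (2 * L + 1)) * 2 := by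
        rw [h1]; ring
      omega
    rw [h3]
  -- Going once around adds (L+1)(2L+1) + (L+1) = 2(L+1)², which is even, so the first spin is
  -- recovered.
  have hpar : c (2 * (L + 1)) % 2 = a := by
    rw [hcN, show (a : ℕ) + ((L + 1) * (2 * L + 1) + (L + 1)) = a + 2 * ((L + 1) * (L + 1)) by ring]
    have := a.2
    omega
  refine ⟨fun k => ⟨c k % 2, Nat.mod_lt _ two_pos⟩, ?_, ?_⟩
  · ext
    have := a.2
    simp only [c, Fin.val_zero, Finset.range_zero, Finset.sum_empty, add_zero]
    omega
  · ext k
    have hk := hc k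
    have hbk : b k % 2 = 1 ↔ k ∈ T := by
      have : (∃ h : (k : ℕ) < 2 * (L + 1), (⟨k, h⟩ : Fin (2 * (L + 1))) ∈ T) ↔ k ∈ T :=
        ⟨fun ⟨_, h⟩ => h, fun h => ⟨k.2, h⟩⟩
      simp only [b, this]
      split_ifs with h <;> simp [h]
    rw [mem_walls, ← hbk, Nat.odd_iff]
    rcases val_add_one_cases k with h | h
    · simp only [h.2]
      omega
    · have h0 : c 0 = a := by simp [c]
      rw [h.1] at hk
      simp only [h.2, h0]
      have := a.2
      omega

theorem sum_config_eq_sum_walls {L : ℕ} (F : Fin 2 → Finset (Fin (2 * (L + 1))) → ℂ)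
    (hF : ∀ a T, T.card ≠ L + 1 → F a T = 0) :
    ∑ s : Config (2 * (L + 1)), F (s 0) (walls s) = ∑ T, (F 0 T + F 1 T) := by
  rw [Fintype.sum_of_injective (fun s : Config (2 * (L + 1)) => (s 0, walls s)) injective_walls _
    (fun p : Fin 2 × Finset (Fin (2 * (L + 1))) => F p.1 p.2) ?_ (fun s => rfl),
    Fintype.sum_prod_type, Fin.sum_univ_two, Finset.sum_add_distrib]
  rintro ⟨a, T⟩ h
  apply hF
  intro hT
  obtain ⟨s, h1, h2⟩ := exists_config_of_walls a T hT
  exact h ⟨s, Prod.ext h1 h2⟩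

/-! ### Slater determinants -/

/-- The determinant of the orbitals `φ` at the positions `x`. -/
def slaterDet {M : ℕ} {α : Type*} (φ : Fin M → α → ℂ) (x : Fin M → α) : ℂ :=
  (Matrix.of fun i j => φ i (x j)).det

/-- The determinant of the orbitals `φ` at the elements of `T`, in increasing order. -/
def slaterAmp {M N : ℕ} (φ : Fin M → Fin N → ℂ) (T : Finset (Fin N)) : ℂ :=
  if h : T.card = M then slaterDet φ (T.orderEmbOfFin h) else 0

theorem slaterAmp_of_card_ne {M N : ℕ} (φ : Fin M → Fin N → ℂ) {T : Finset (Fin N)}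
    (h : T.card ≠ M) : slaterAmp φ T = 0 := dif_neg h

theorem slaterAmp_eq {M N : ℕ} (φ : Fin M → Fin N → ℂ) {T : Finset (Fin N)} {x : Fin M → Fin N}
    (hx : StrictMono x) (hT : Finset.univ.image x = T) : slaterAmp φ T = slaterDet φ x := by
  have hc : T.card = M := by
    rw [← hT, Finset.card_image_of_injective _ hx.injective, Finset.card_univ, Fintype.card_fin]
  have := Finset.orderEmbOfFin_unique hc (f := x)
    (fun i => hT ▸ Finset.mem_image_of_mem x (Finset.mem_univ i)) hx
  rw [slaterAmp, dif_pos hc, this]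

theorem exists_strictMono_image_eq {M N : ℕ} {T : Finset (Fin N)} (hT : T.card = M) :
    ∃ x : Fin M → Fin N, StrictMono x ∧ Finset.univ.image x = T := by
  refine ⟨T.orderEmbOfFin hT, (T.orderEmbOfFin hT).strictMono, ?_⟩
  ext k
  rw [← Finset.mem_coe, Finset.coe_image, Finset.coe_univ, Set.image_univ,
    Finset.range_orderEmbOfFin, Finset.mem_coe]

theorem slaterDet_comp_perm {M : ℕ} {α : Type*} (φ : Fin M → α → ℂ) (x : Fin M → α)
    (σ : Equiv.Perm (Fin M)) : slaterDet φ (x ∘ σ) = Equiv.Perm.sign σ * slaterDet φ x :=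
  Matrix.det_permute' σ (Matrix.of fun i j => φ i (x j))

theorem slaterDet_eq_zero_of_eq {M : ℕ} {α : Type*} (φ : Fin M → α → ℂ) {x : Fin M → α}
    {i j : Fin M} (hij : i ≠ j) (h : x i = x j) : slaterDet φ x = 0 :=
  Matrix.det_zero_of_column_eq hij fun k => by simp [h]

theorem slaterDet_update_smul {M : ℕ} {α : Type*} (φ : Fin M → α → ℂ) (x : Fin M → α) (j : Fin M)
    {a b : α} {c : ℂ} (h : ∀ i, φ i a = c * φ i b) :
    slaterDet φ (Function.update x j a) = c * slaterDet φ (Function.update x j b) := by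
  have e : ∀ a : α, (Matrix.of fun i k => φ i (Function.update x j a k))
      = (Matrix.of fun i k => φ i (x k)).updateCol j (fun i => φ i a) := fun a => by
    ext i k
    by_cases hk : k = j
    · subst hk
      simp
    · simp [Function.update_of_ne hk, Matrix.updateCol_ne hk]
  unfold slaterDet
  rw [e, e, ← Matrix.det_updateCol_smul]
  congr 2
  funext i
  exact h i

/-- The Cauchy–Binet formula. -/
theorem sum_slaterAmp_mul {M N : ℕ} (φ χ : Fin M → Fin N → ℂ) :
    ∑ T, slaterAmp φ T * slaterAmp χ T = (Matrix.of fun i j => ∑ k, φ i k * χ j k).det := by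
  have h1 : (Matrix.of fun i j => ∑ k, φ i k * χ j k).det
      = ∑ f : Fin M → Fin N, (∏ i, φ i (f i)) * slaterDet χ f := by
    have h := (Matrix.detRowAlternating (n := Fin M) (R := ℂ)).toMultilinearMap.map_sum
      (fun (i : Fin M) (k : Fin N) => φ i k • fun j => χ j k)
    have e : (Matrix.of fun i j => ∑ k, φ i k * χ j k)
        = fun i => ∑ k, φ i k • fun j => χ j k := by
      ext i j
      simp
    rw [e]
    refine h.trans (Finset.sum_congr rfl fun f _ => ?_)
    rw [MultilinearMap.map_smul_univ, smul_eq_mul, slaterDet, ← Matrix.det_transpose]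
    rfl
  rw [h1, ← Finset.sum_fiberwise Finset.univ (fun f : Fin M → Fin N => Finset.univ.image f)]
  refine Finset.sum_congr rfl fun T _ => ?_
  by_cases hT : T.card = M
  · obtain ⟨x, hx, hxT⟩ := exists_strictMono_image_eq hT
    rw [slaterAmp_eq φ hx hxT, slaterAmp_eq χ hx hxT]
    have h2 : ∑ f with Finset.univ.image f = T, (∏ i, φ i (f i)) * slaterDet χ f
        = ∑ σ : Equiv.Perm (Fin M), (∏ i, φ i (x (σ i))) * slaterDet χ (x ∘ σ) := by
      symm
      refine Finset.sum_bij (fun σ _ => x ∘ σ) ?_ ?_ ?_ ?_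
      · intro σ _
        rw [Finset.mem_filter]
        refine ⟨Finset.mem_univ _, ?_⟩
        rw [← hxT, ← Finset.image_image, Finset.image_univ_equiv]
      · intro σ _ τ _ h
        ext i
        exact congrArg Fin.val (hx.injective (congrFun h i))
      · intro f hf
        have hf' : Finset.univ.image f = T := (Finset.mem_filter.mp hf).2
        have hfx : ∀ i, ∃ j, x j = f i := fun i => by
          have : f i ∈ Finset.univ.image x := by
            rw [hxT, ← hf']
            exact Finset.mem_image_of_mem f (Finset.mem_univ i)
          obtain ⟨j, _, hj⟩ := Finset.mem_image.mp this
          exact ⟨j, hj⟩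
        choose g hg using hfx
        have hfinj : Function.Injective f := by
          have : (Finset.univ.image f).card = (Finset.univ : Finset (Fin M)).card := by
            rw [hf', hT, Finset.card_univ, Fintype.card_fin]
          exact fun a b h => Finset.card_image_iff.mp this (Finset.mem_coe.mpr (Finset.mem_univ a))
            (Finset.mem_coe.mpr (Finset.mem_univ b)) h
        have hginj : Function.Injective g := fun a b h => hfinj (by rw [← hg a, ← hg b, h])
        refine ⟨Equiv.ofBijective g (Finite.injective_iff_bijective.mp hginj), Finset.mem_univ _, ?_⟩
        funext i
        exact hg i
      · intro σ _
        rfl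
    rw [h2]
    simp only [slaterDet_comp_perm]
    rw [slaterDet, ← Matrix.det_transpose, Matrix.det_apply, Finset.sum_mul]
    refine Finset.sum_congr rfl fun σ _ => ?_
    rw [Units.smul_def, zsmul_eq_mul]
    simp only [Matrix.transpose_apply, Matrix.of_apply]
    ring
  · rw [slaterAmp_of_card_ne φ hT, zero_mul]
    symm
    refine Finset.sum_eq_zero fun f hf => ?_
    have hf' : Finset.univ.image f = T := (Finset.mem_filter.mp hf).2
    have hni : ¬ Function.Injective f := fun h => hT (by
      rw [← hf', Finset.card_image_of_injective _ h, Finset.card_univ, Fintype.card_fin])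
    obtain ⟨i, j, hij, hne⟩ : ∃ i j, f i = f j ∧ i ≠ j := by
      unfold Function.Injective at hni
      push Not at hni
      exact hni
    rw [slaterDet_eq_zero_of_eq χ hne hij, mul_zero]

theorem hasDerivAt_det {n : Type*} [Fintype n] [DecidableEq n] {A : ℝ → Matrix n n ℂ}
    {A' : Matrix n n ℂ} {t : ℝ} (h : ∀ i j, HasDerivAt (fun t => A t i j) (A' i j) t) :
    HasDerivAt (fun t => (A t).det) (∑ j, ((A t).updateCol j fun i => A' i j).det) t := by
  simp only [Matrix.det_apply]
  rw [Finset.sum_comm]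
  refine HasDerivAt.fun_sum fun σ _ => ?_
  simp only [← Finset.smul_sum]
  refine HasDerivAt.const_smul _ ?_
  have hp := HasDerivAt.fun_finsetProd (u := Finset.univ) fun i (_ : i ∈ Finset.univ) => h (σ i) i
  refine hp.congr_deriv (Finset.sum_congr rfl fun j _ => ?_)
  rw [← Finset.mul_prod_erase Finset.univ
    (fun i => (A t).updateCol j (fun i => A' i j) (σ i) i) (Finset.mem_univ j)]
  rw [Matrix.updateCol_self, smul_eq_mul, mul_comm]
  congr 1
  refine Finset.prod_congr rfl fun i hi => ?_
  rw [Matrix.updateCol_ne (Finset.ne_of_mem_erase hi)]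

/-! ### Free motion of the walls -/

theorem image_update_eq {M N : ℕ} {T : Finset (Fin N)} {x : Fin M → Fin N}
    (hx : Function.Injective x) (hT : Finset.univ.image x = T) (j : Fin M) (v : Fin N) :
    Finset.univ.image (Function.update x j v) = insert v (T.erase (x j)) := by
  ext k
  simp only [Finset.mem_image, Finset.mem_univ, true_and, Finset.mem_insert, Finset.mem_erase, ← hT]
  constructor
  · rintro ⟨i, rfl⟩
    by_cases hi : i = j
    · subst hi
      simp
    · right
      rw [Function.update_of_ne hi]
      exact ⟨fun h => hi (hx h), i, rfl⟩
  · rintro (rfl | ⟨hk, i, rfl⟩)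
    · exact ⟨j, by simp⟩
    · refine ⟨i, Function.update_of_ne (fun h => hk (by rw [h])) _ _⟩

/-- Moving one wall may spoil the increasing order; restoring it costs the sign of the sorting
permutation. -/
theorem slaterAmp_insert_erase {M N : ℕ} (φ : Fin M → Fin N → ℂ) {T : Finset (Fin N)}
    {x : Fin M → Fin N} (hx : Function.Injective x) (hT : Finset.univ.image x = T) (j : Fin M)
    (v : Fin N) (σ : Equiv.Perm (Fin M)) (hσ : StrictMono (Function.update x j v ∘ σ)) :
    slaterAmp φ (insert v (T.erase (x j)))
      = Equiv.Perm.sign σ * slaterDet φ (Function.update x j v) := by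
  rw [← slaterDet_comp_perm]
  refine slaterAmp_eq φ hσ ?_
  rw [← Finset.image_image, Finset.image_univ_equiv, image_update_eq hx hT]

theorem strictMono_cons {L N : ℕ} {x : Fin L → Fin N} (hx : StrictMono x) {v : Fin N}
    (hv : ∀ i, v < x i) : StrictMono (Fin.cons v x : Fin (L + 1) → Fin N) := by
  intro a b hab
  induction b using Fin.cases with
  | zero => exact absurd hab (Fin.not_lt_zero a)
  | succ b =>
    induction a using Fin.cases with
    | zero => simpa using hv b
    | succ a => simpa using hx (Fin.succ_lt_succ_iff.mp hab)

theorem strictMono_snoc {L N : ℕ} {x : Fin L → Fin N} (hx : StrictMono x) {v : Fin N}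
    (hv : ∀ i, x i < v) : StrictMono (Fin.snoc x v : Fin (L + 1) → Fin N) := by
  intro a b hab
  induction a using Fin.lastCases with
  | last => exact absurd hab (not_lt.mpr (Fin.le_last b))
  | cast a =>
    induction b using Fin.lastCases with
    | last => simpa using hv a
    | cast b => simpa using hx (Fin.castSucc_lt_castSucc_iff.mp hab)

theorem update_last_comp_rotate {L N : ℕ} (x : Fin (L + 1) → Fin N) (v : Fin N) :
    Function.update x (Fin.last L) v ∘ (finRotate (L + 1)).symm
      = Fin.cons v fun i => x i.castSucc := by
  have h : Function.update x (Fin.last L) v = Fin.snoc (fun i => x i.castSucc) v := by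
    funext i
    induction i using Fin.lastCases with
    | last => simp
    | cast i => rw [Function.update_of_ne (Fin.castSucc_lt_last i).ne, Fin.snoc_castSucc]
  rw [h, Fin.snoc_eq_cons_rotate]
  funext i
  simp

theorem update_zero_comp_rotate {L N : ℕ} (x : Fin (L + 1) → Fin N) (v : Fin N) :
    Function.update x 0 v ∘ finRotate (L + 1) = Fin.snoc (fun i => x i.succ) v := by
  have h : Function.update x 0 v = Fin.cons v fun i => x i.succ := by
    funext i
    induction i using Fin.cases with
    | zero => simp
    | succ i => rw [Function.update_of_ne (Fin.succ_ne_zero i), Fin.cons_succ]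
  rw [h, Fin.snoc_eq_cons_rotate]
  rfl

/-- The orbitals restricted to the bonds of the ring. -/
def onBonds {M : ℕ} (N : ℕ) (φ : Fin M → ℤ → ℂ) : Fin M → Fin N → ℂ := fun i k => φ i (k : ℕ)

/-- The state with orbitals `φ` in the sector `η` of the global spin flip. -/
def wallState {L : ℕ} (η : ℂ) (φ : Fin (L + 1) → ℤ → ℂ) (s : Config (2 * (L + 1))) : ℂ :=
  η ^ (s 0 : ℕ) * slaterAmp (onBonds (2 * (L + 1)) φ) (walls s)

theorem slaterDet_update_cast {M N : ℕ} (φ : Fin M → ℤ → ℂ) (x : Fin M → Fin N) (j : Fin M)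
    (v : Fin N) {a : ℤ} (ha : a = (v : ℕ)) :
    slaterDet φ (Function.update (fun k => ((x k : ℕ) : ℤ)) j a)
      = slaterDet (onBonds N φ) (Function.update x j v) := by
  unfold slaterDet onBonds
  congr 1
  ext i k
  by_cases hk : k = j
  · subst hk
    simp [ha]
  · simp [Function.update_of_ne hk]

theorem slaterDet_update_eq_zero {M N : ℕ} (φ : Fin M → Fin N → ℂ) {T : Finset (Fin N)}
    {x : Fin M → Fin N} (hT : Finset.univ.image x = T) (j : Fin M) {v : Fin N} (hv : v ∈ T)
    (hne : v ≠ x j) : slaterDet φ (Function.update x j v) = 0 := by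
  rw [← hT] at hv
  obtain ⟨i, _, hi⟩ := Finset.mem_image.mp hv
  have hij : i ≠ j := fun h => hne (by rw [← hi, h])
  refine slaterDet_eq_zero_of_eq φ hij ?_
  rw [Function.update_of_ne hij, Function.update_self, hi]

theorem flipAt_zero_of_ne {N : ℕ} [NeZero N] (s : Config N) {n : Fin N} (h : n ≠ 0) :
    flipAt s n 0 = s 0 := Function.update_of_ne h.symm _ _

theorem pow_flip {η : ℂ} (hη : η ^ 2 = 1) (b : Fin 2) :
    η ^ (b : ℕ) * η = η ^ ((1 - b : Fin 2) : ℕ) := by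
  fin_cases b
  · simp
  · simpa [← sq] using hη

/-- A hop onto an occupied bond repeats a column and gives zero, so exclusion is automatic. A hop
inside the chain keeps the order; the hop across the cut is where the relation between ζ and η is
used. -/
theorem slaterDet_hop_right {L : ℕ} {η ζ : ℂ} (hη : η ^ 2 = 1) (hζ : ζ = η * (-1) ^ L)
    {φ : Fin (L + 1) → ℤ → ℂ} (hper : ∀ i k, φ i (k + (2 * (L + 1) : ℕ)) = ζ * φ i k)
    {s : Config (2 * (L + 1))} {x : Fin (L + 1) → Fin (2 * (L + 1))} (hx : StrictMono x)
    (hT : Finset.univ.image x = walls s) (j : Fin (L + 1)) :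
    η ^ (s 0 : ℕ) * slaterDet φ (Function.update (fun k => ((x k : ℕ) : ℤ)) j ((x j : ℕ) + 1))
      = if x j + 1 ∈ walls s then 0 else wallState η φ (flipAt s (x j + 1)) := by
  have h2 : 2 ≤ 2 * (L + 1) := by omega
  have hjT : x j ∈ walls s := hT ▸ Finset.mem_image_of_mem x (Finset.mem_univ j)
  rcases val_add_one_cases (x j) with ⟨h, hv⟩ | ⟨h, hv⟩
  · rw [slaterDet_update_cast φ x j (x j + 1) (by rw [hv]; push_cast; ring)]
    split_ifs with hm
    · rw [slaterDet_update_eq_zero _ hT j hm (add_one_ne_self h2 _), mul_zero]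
    · have h0 : x j + 1 ≠ 0 := fun h => by
        rw [h] at hv
        simp at hv
      have hsm : StrictMono (Function.update x j (x j + 1) ∘ (1 : Equiv.Perm (Fin (L + 1)))) := by
        intro a b hab
        have hab' := hx hab
        rw [Fin.lt_def] at hab' ⊢
        simp only [Function.comp, Equiv.Perm.coe_one, id]
        by_cases ha : a = j
        · subst ha
          have hb : b ≠ a := hab.ne'
          rw [Function.update_self, Function.update_of_ne hb, hv]
          have : x b ≠ x a + 1 := fun h => hm (h ▸ hT ▸ Finset.mem_image_of_mem x (Finset.mem_univ b))
          have : (x b : ℕ) ≠ x a + 1 := fun h => this (Fin.ext (by rw [h, hv]))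
          omega
        · rw [Function.update_of_ne ha]
          by_cases hb : b = j
          · subst hb
            rw [Function.update_self, hv]
            omega
          · rwa [Function.update_of_ne hb]
      rw [wallState, flipAt_zero_of_ne s h0, walls_flipAt_add_one h2 hjT hm,
        slaterAmp_insert_erase _ hx.injective hT j _ 1 hsm]
      simp
  -- Crossing the cut: the last wall becomes the first. The twist ζ must match the sign (-1)^L of
  -- the cyclic permutation times the factor η from flipping the spin at site 0.
  · have hv0 : x j + 1 = 0 := Fin.ext (by rw [hv]; simp)
    have hper' : ∀ i, φ i ((x j : ℕ) + 1) = ζ * φ i 0 := fun i => by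
      rw [← hper, zero_add]
      congr 1
      exact_mod_cast h
    rw [slaterDet_update_smul φ _ j hper', hv0,
      slaterDet_update_cast φ x j (0 : Fin (2 * (L + 1))) (by simp)]
    split_ifs with hm
    · rw [slaterDet_update_eq_zero _ hT j hm (hv0 ▸ add_one_ne_self h2 _), mul_zero, mul_zero]
    · have hj : j = Fin.last L := by
        by_contra hne
        have h3 := hx (lt_of_le_of_ne (Fin.le_last j) hne)
        rw [Fin.lt_def] at h3
        have := (x (Fin.last L)).2
        omega
      subst hj
      have hsm : StrictMono (Function.update x (Fin.last L) 0 ∘ (finRotate (L + 1)).symm) := by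
        rw [update_last_comp_rotate]
        refine strictMono_cons (fun a b hab => hx (Fin.castSucc_lt_castSucc_iff.mpr hab)) fun i => ?_
        refine lt_of_le_of_ne (Fin.zero_le _) fun h => hm ?_
        rw [h, ← hT]
        exact Finset.mem_image_of_mem x (Finset.mem_univ _)
      have hw := walls_flipAt_add_one h2 hjT (by rwa [hv0])
      rw [hv0] at hw
      rw [wallState, hw, slaterAmp_insert_erase _ hx.injective hT _ _ _ hsm, Equiv.Perm.sign_symm,
        sign_finRotate, flipAt, Function.update_self, ← pow_flip hη, hζ]
      push_cast
      ring

theorem slaterDet_hop_left {L : ℕ} {η ζ : ℂ} (hη : η ^ 2 = 1) (hζ : ζ = η * (-1) ^ L)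
    {φ : Fin (L + 1) → ℤ → ℂ} (hper : ∀ i k, φ i (k + (2 * (L + 1) : ℕ)) = ζ * φ i k)
    {s : Config (2 * (L + 1))} {x : Fin (L + 1) → Fin (2 * (L + 1))} (hx : StrictMono x)
    (hT : Finset.univ.image x = walls s) (j : Fin (L + 1)) :
    η ^ (s 0 : ℕ) * slaterDet φ (Function.update (fun k => ((x k : ℕ) : ℤ)) j ((x j : ℕ) - 1))
      = if x j - 1 ∈ walls s then 0 else wallState η φ (flipAt s (x j)) := by
  have h2 : 2 ≤ 2 * (L + 1) := by omega
  have hζ2 : ζ * ζ = 1 := by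
    rw [hζ, mul_mul_mul_comm, ← sq, hη, ← mul_pow]
    norm_num
  have hjT : x j ∈ walls s := hT ▸ Finset.mem_image_of_mem x (Finset.mem_univ j)
  rcases val_sub_one_cases (x j) with ⟨h, hv⟩ | ⟨h, hv⟩
  · rw [slaterDet_update_cast φ x j (x j - 1) (by omega)]
    split_ifs with hm
    · rw [slaterDet_update_eq_zero _ hT j hm (sub_one_ne_self h2 _), mul_zero]
    · have h0 : x j ≠ 0 := fun h' => by
        rw [h'] at h
        simp at h
      have hsm : StrictMono (Function.update x j (x j - 1) ∘ (1 : Equiv.Perm (Fin (L + 1)))) := by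
        intro a b hab
        have hab' := hx hab
        rw [Fin.lt_def] at hab' ⊢
        simp only [Function.comp, Equiv.Perm.coe_one, id]
        by_cases hb : b = j
        · subst hb
          have ha : a ≠ b := hab.ne
          rw [Function.update_self, Function.update_of_ne ha, hv]
          have : x a ≠ x b - 1 := fun h => hm (h ▸ hT ▸ Finset.mem_image_of_mem x (Finset.mem_univ a))
          have : (x a : ℕ) ≠ x b - 1 := fun h => this (Fin.ext (by rw [h, hv]))
          omega
        · rw [Function.update_of_ne hb]
          by_cases ha : a = j
          · subst ha
            rw [Function.update_self, hv]
            omega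
          · rwa [Function.update_of_ne ha]
      rw [wallState, flipAt_zero_of_ne s h0, walls_flipAt h2 hjT hm,
        slaterAmp_insert_erase _ hx.injective hT j _ 1 hsm]
      simp
  · have hv0 : x j = 0 := Fin.ext (by rw [h]; simp)
    have hper' : ∀ i, φ i ((x j : ℕ) - 1) = ζ * φ i ((x j - 1 : Fin (2 * (L + 1))) : ℕ) := fun i => by
      have := hper i ((x j : ℕ) - 1)
      rw [show ((x j : ℕ) : ℤ) - 1 + (2 * (L + 1) : ℕ) = ((x j - 1 : Fin (2 * (L + 1))) : ℕ) by
        omega] at this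
      rw [this, ← mul_assoc, hζ2, one_mul]
    rw [slaterDet_update_smul φ _ j hper', slaterDet_update_cast φ x j (x j - 1) rfl]
    split_ifs with hm
    · rw [slaterDet_update_eq_zero _ hT j hm (sub_one_ne_self h2 _), mul_zero, mul_zero]
    · have hj : j = 0 := by
        by_contra hne
        have h3 := hx (Fin.pos_of_ne_zero hne)
        rw [Fin.lt_def] at h3
        omega
      subst hj
      have hsm : StrictMono (Function.update x 0 (x 0 - 1) ∘ finRotate (L + 1)) := by
        rw [update_zero_comp_rotate]
        refine strictMono_snoc (fun a b hab => hx (Fin.succ_lt_succ_iff.mpr hab)) fun i => ?_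
        have h4 : x i.succ ≠ x 0 - 1 := fun h => hm (by
          rw [← h, ← hT]
          exact Finset.mem_image_of_mem x (Finset.mem_univ _))
        have h5 : (x i.succ : ℕ) ≠ (x 0 - 1 : Fin (2 * (L + 1))) := fun h => h4 (Fin.ext h)
        have := (x i.succ).2
        rw [Fin.lt_def]
        omega
      have hw := walls_flipAt h2 hjT hm
      rw [wallState, hw, slaterAmp_insert_erase _ hx.injective hT _ _ _ hsm,
        sign_finRotate, hv0, flipAt, Function.update_self, ← pow_flip hη, hζ]
      push_cast
      ring

theorem bondType_sub_mul {N : ℕ} [NeZero N] (s : Config N) (n : Fin N) (ψ : ℂ) :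
    (bondType s n - bondType s (n - 1)) * ψ
      = (if n - 1 ∈ walls s then (if n ∈ walls s then 0 else 2 * ψ) else 0)
        - (if n ∈ walls s then (if n - 1 ∈ walls s then 0 else 2 * ψ) else 0) := by
  rw [bondType_eq, bondType_eq]
  split_ifs <;> ring

theorem sum_bondType_sub_mul {N : ℕ} [NeZero N] (s : Config N) (ψ : Fin N → ℂ) :
    ∑ n, (bondType s n - bondType s (n - 1)) * ψ n
      = ∑ k ∈ walls s, (if k + 1 ∈ walls s then 0 else 2 * ψ (k + 1))
        - ∑ k ∈ walls s, (if k - 1 ∈ walls s then 0 else 2 * ψ k) := by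
  simp only [bondType_sub_mul]
  rw [Finset.sum_sub_distrib, ← Equiv.sum_comp (Equiv.addRight (1 : Fin N))]
  simp only [Equiv.coe_addRight, add_sub_cancel_right, Finset.sum_ite_mem, Finset.univ_inter]
  congr!

/-- Differentiating the determinant column by column moves one wall at a time, which matches the
hopping terms of the Hamiltonian one by one. -/
theorem hasDerivAt_wallState {L : ℕ} {η ζ : ℂ} (hη : η ^ 2 = 1) (hζ : ζ = η * (-1) ^ L)
    {φ : ℝ → Fin (L + 1) → ℤ → ℂ}
    (hper : ∀ t i k, φ t i (k + (2 * (L + 1) : ℕ)) = ζ * φ t i k)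
    (hφ : ∀ t i k, HasDerivAt (fun t => φ t i k) (2 * (φ t i (k + 1) - φ t i (k - 1))) t)
    (t : ℝ) (s : Config (2 * (L + 1))) :
    HasDerivAt (fun t => wallState η (φ t) s)
      (∑ n, (bondType s n - bondType s (n - 1)) * wallState η (φ t) (flipAt s n)) t := by
  have h2 : 2 ≤ 2 * (L + 1) := by omega
  rw [sum_bondType_sub_mul s fun n => wallState η (φ t) (flipAt s n)]
  by_cases hc : (walls s).card = L + 1
  · obtain ⟨x, hx, hT⟩ := exists_strictMono_image_eq hc
    have hsum : ∀ f : Fin (2 * (L + 1)) → ℂ, ∑ k ∈ walls s, f k = ∑ j, f (x j) := fun f => by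
      rw [← hT, Finset.sum_image fun a _ b _ h => hx.injective h]
    rw [hsum, hsum, ← Finset.sum_sub_distrib]
    have hd := (hasDerivAt_det (A := fun t => Matrix.of fun i j => φ t i (x j : ℕ))
      (A' := Matrix.of fun i j => 2 * (φ t i ((x j : ℕ) + 1) - φ t i ((x j : ℕ) - 1)))
      (fun i j => hφ t i _)).const_mul (η ^ (s 0 : ℕ))
    have hfun : (fun t => wallState η (φ t) s)
        = fun t => η ^ (s 0 : ℕ) * (Matrix.of fun i j => φ t i (x j : ℕ)).det := by
      funext t
      rw [wallState, slaterAmp_eq _ hx hT]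
      rfl
    rw [hfun]
    refine hd.congr_deriv ?_
    rw [Finset.mul_sum]
    refine Finset.sum_congr rfl fun j _ => ?_
    have hR := slaterDet_hop_right hη hζ (hper t) hx hT j
    have hL := slaterDet_hop_left hη hζ (hper t) hx hT j
    have e : ∀ a : ℤ, slaterDet (φ t) (Function.update (fun k => ((x k : ℕ) : ℤ)) j a)
        = ((Matrix.of fun i j => φ t i (x j : ℕ)).updateCol j fun i => φ t i a).det := fun a => by
      unfold slaterDet
      congr 1
      ext i k
      by_cases hk : k = j
      · subst hk
        simp
      · simp [Function.update_of_ne hk, Matrix.updateCol_ne hk]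
    have e2 : ((Matrix.of fun i j => φ t i (x j : ℕ)).updateCol j fun i =>
          (Matrix.of fun i j => 2 * (φ t i ((x j : ℕ) + 1) - φ t i ((x j : ℕ) - 1))) i j).det
        = 2 * (slaterDet (φ t) (Function.update (fun k => ((x k : ℕ) : ℤ)) j ((x j : ℕ) + 1))
          - slaterDet (φ t) (Function.update (fun k => ((x k : ℕ) : ℤ)) j ((x j : ℕ) - 1))) := by
      rw [e, e]
      have h3 : (fun i => (Matrix.of fun i j =>
          2 * (φ t i ((x j : ℕ) + 1) - φ t i ((x j : ℕ) - 1))) i j)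
          = (2 : ℂ) • (fun i => φ t i ((x j : ℕ) + 1))
            + (-2 : ℂ) • (fun i => φ t i ((x j : ℕ) - 1)) := by
        funext i
        simp only [Matrix.of_apply, Pi.add_apply, Pi.smul_apply, smul_eq_mul]
        ring
      rw [h3, Matrix.det_updateCol_add, Matrix.det_updateCol_smul, Matrix.det_updateCol_smul]
      ring
    rw [e2, mul_left_comm, mul_sub, hR, hL]
    split_ifs <;> ring
  -- With a wrong number of walls both sides vanish, since hopping conserves that number.
  · have h0 : ∀ t, wallState η (φ t) s = 0 := fun t => by
      rw [wallState, slaterAmp_of_card_ne _ hc, mul_zero]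
    simp only [h0]
    refine (hasDerivAt_const t (0 : ℂ)).congr_deriv ?_
    rw [Finset.sum_eq_zero, Finset.sum_eq_zero, sub_zero]
    · intro k hk
      split_ifs with hm
      · rfl
      · rw [wallState, slaterAmp_of_card_ne, mul_zero, mul_zero]
        rw [walls_flipAt h2 hk hm, Finset.card_insert_of_notMem
          (fun h => hm (Finset.mem_of_mem_erase h)), Finset.card_erase_add_one hk]
        exact hc
    · intro k hk
      split_ifs with hm
      · rfl
      · rw [wallState, slaterAmp_of_card_ne, mul_zero, mul_zero]
        rw [walls_flipAt_add_one h2 hk hm, Finset.card_insert_of_notMem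
          (fun h => hm (Finset.mem_of_mem_erase h)), Finset.card_erase_add_one hk]
        exact hc

/-! ### The initial state as a Slater determinant -/

/-- The orbitals of the initial state: orbital `i` lives on the bonds `2i` and `2i + 1`. -/
def pairOrbital {M N : ℕ} (i : Fin M) (k : Fin N) : ℂ :=
  if (k : ℕ) = 2 * i + 1 then 1 else if (k : ℕ) = 2 * i then Complex.I else 0

/-- The occupation of the sites, continued by zero. -/
def occ {N : ℕ} (s : Config N) (k : ℕ) : ℕ := if h : k < N then (s ⟨k, h⟩ : ℕ) else 0

theorem occ_val {N : ℕ} (s : Config N) (k : Fin N) : occ s k = s k := dif_pos k.2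

theorem occ_le_one {N : ℕ} (s : Config N) (k : ℕ) : occ s k ≤ 1 := by
  unfold occ
  split_ifs with h
  · exact Nat.le_of_lt_succ (s ⟨k, h⟩).2
  · exact zero_le_one

theorem mem_walls_iff_occ {N : ℕ} [NeZero N] {s : Config N} (h0 : s 0 = 0) (k : Fin N) :
    k ∈ walls s ↔ Odd ((k : ℕ) + occ s k + occ s (k + 1)) := by
  rw [mem_walls, occ_val]
  rcases val_add_one_cases k with ⟨_, h⟩ | ⟨hk, h⟩
  · rw [← h, occ_val]
  · have h1 : k + 1 = 0 := Fin.ext (by rw [h]; rfl)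
    rw [h1, h0, hk, occ, dif_neg (lt_irrefl N)]
    rfl

theorem prod_range_two_mul (f : ℕ → ℂ) (n : ℕ) :
    ∏ k ∈ Finset.range (2 * n), f k = ∏ j ∈ Finset.range n, f (2 * j) * f (2 * j + 1) := by
  induction n with
  | zero => simp
  | succ n ih =>
    rw [Nat.mul_succ, Finset.prod_range_succ, Finset.prod_range_succ, ih, Finset.prod_range_succ,
      mul_assoc]

/-- When all even spins are 0, exactly one bond of each pair 2j, 2j + 1 carries a wall, chosen by
the odd spin between them. The Slater matrix is then diagonal. -/
theorem slaterAmp_pairOrbital_of_even_eq_zero {L : ℕ} {s : Config (2 * (L + 1))} (h0 : s 0 = 0)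
    (hs : ∀ j, occ s (2 * j) = 0) :
    slaterAmp (pairOrbital (M := L + 1)) (walls s)
      = ∏ j : Fin (L + 1), if occ s (2 * j + 1) = 0 then 1 else Complex.I := by
  let x : Fin (L + 1) → Fin (2 * (L + 1)) := fun j =>
    ⟨2 * j + 1 - occ s (2 * j + 1), by omega⟩
  have hx : StrictMono x := fun a b hab => by
    have h1 : (a : ℕ) < b := hab
    have h2 := occ_le_one s (2 * b + 1)
    change 2 * (a : ℕ) + 1 - _ < 2 * (b : ℕ) + 1 - _
    omega
  have hT : Finset.univ.image x = walls s := by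
    ext k
    rw [Finset.mem_image, mem_walls_iff_occ h0, Nat.odd_iff]
    rcases Nat.even_or_odd' k with ⟨j, hj | hj⟩
    · have h1 := hs j
      have h2 := occ_le_one s (2 * j + 1)
      rw [hj, h1]
      constructor
      · rintro ⟨i, _, hi⟩
        have h3 : 2 * (i : ℕ) + 1 - occ s (2 * i + 1) = k := congrArg Fin.val hi
        have h4 := occ_le_one s (2 * i + 1)
        have h5 : (i : ℕ) = j := by omega
        rw [h5] at h3
        omega
      · intro h
        refine ⟨⟨j, by omega⟩, Finset.mem_univ _, Fin.ext ?_⟩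
        change 2 * j + 1 - occ s (2 * j + 1) = k
        omega
    · have h1 := hs (j + 1)
      have h2 := occ_le_one s (2 * j + 1)
      rw [hj, show 2 * j + 1 + 1 = 2 * (j + 1) by ring, h1]
      constructor
      · rintro ⟨i, _, hi⟩
        have h3 : 2 * (i : ℕ) + 1 - occ s (2 * i + 1) = k := congrArg Fin.val hi
        have h4 := occ_le_one s (2 * i + 1)
        have h5 : (i : ℕ) = j := by omega
        rw [h5] at h3
        omega
      · intro h
        refine ⟨⟨j, by omega⟩, Finset.mem_univ _, Fin.ext ?_⟩
        change 2 * j + 1 - occ s (2 * j + 1) = k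
        omega
  rw [slaterAmp_eq _ hx hT, slaterDet, ← Matrix.det_diagonal]
  congr 1
  ext i j
  have h2 := occ_le_one s (2 * j + 1)
  have hxj : (x j : ℕ) = 2 * j + 1 - occ s (2 * j + 1) := rfl
  rw [Matrix.of_apply, pairOrbital, hxj]
  by_cases hij : i = j
  · subst hij
    rw [Matrix.diagonal_apply_eq]
    split_ifs <;> first | rfl | omega
  · have h3 : (i : ℕ) ≠ j := fun h => hij (Fin.ext h)
    rw [Matrix.diagonal_apply_ne _ hij, if_neg (by omega), if_neg (by omega)]

/-- A nonzero Leibniz term would place exactly one wall in each pair of bonds, and this propagates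
the value 0 from site 0 to every even site. -/
theorem slaterAmp_pairOrbital_eq_zero {L : ℕ} {s : Config (2 * (L + 1))} (h0 : s 0 = 0)
    (hs : ¬ ∀ j, occ s (2 * j) = 0) : slaterAmp (pairOrbital (M := L + 1)) (walls s) = 0 := by
  by_contra hne
  have hc : (walls s).card = L + 1 := by
    by_contra hc
    exact hne (slaterAmp_of_card_ne _ hc)
  obtain ⟨x, hx, hT⟩ := exists_strictMono_image_eq hc
  rw [slaterAmp_eq _ hx hT, slaterDet, Matrix.det_apply] at hne
  obtain ⟨σ, -, hσ⟩ := Finset.exists_ne_zero_of_sum_ne_zero hne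
  have hσ' : ∏ j, pairOrbital (σ j) (x j) ≠ 0 := fun h => hσ (by
    simp only [Matrix.of_apply]
    rw [h, smul_zero])
  rw [Finset.prod_ne_zero_iff] at hσ'
  have hpos : ∀ j, (x j : ℕ) = 2 * (σ j : ℕ) + 1 ∨ (x j : ℕ) = 2 * (σ j : ℕ) := fun j => by
    have := hσ' j (Finset.mem_univ j)
    unfold pairOrbital at this
    split_ifs at this with h1 h2
    · exact Or.inl h1
    · exact Or.inr h2
    · exact absurd rfl this
  have hmem : ∀ k, k ∈ walls s ↔ ∃ j, x j = k := fun k => by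
    rw [← hT, Finset.mem_image]
    simp
  -- Adding the parities of the two bonds of a pair cancels the odd spin; a single wall then forces
  -- the neighbouring even spins to agree.
  have hstep : ∀ i : Fin (L + 1), occ s (2 * i) = occ s (2 * (i + 1)) := fun i => by
    have he := mem_walls_iff_occ h0 ⟨2 * i, by omega⟩
    have ho := mem_walls_iff_occ h0 ⟨2 * i + 1, by omega⟩
    rw [Nat.odd_iff] at he ho
    have hex : (⟨2 * i, by omega⟩ : Fin (2 * (L + 1))) ∈ walls s
        ∨ (⟨2 * i + 1, by omega⟩ : Fin (2 * (L + 1))) ∈ walls s := by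
      rw [hmem, hmem]
      have := hpos (σ.symm i)
      rw [σ.apply_symm_apply] at this
      rcases this with h | h
      · exact Or.inr ⟨_, Fin.ext h⟩
      · exact Or.inl ⟨_, Fin.ext h⟩
    have hnb : ¬ ((⟨2 * i, by omega⟩ : Fin (2 * (L + 1))) ∈ walls s
        ∧ (⟨2 * i + 1, by omega⟩ : Fin (2 * (L + 1))) ∈ walls s) := by
      rw [hmem, hmem]
      rintro ⟨⟨a, ha⟩, b, hb⟩
      have ha' : (x a : ℕ) = 2 * i := congrArg Fin.val ha
      have hb' : (x b : ℕ) = 2 * i + 1 := congrArg Fin.val hb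
      have hab : σ a = σ b := Fin.ext (by
        have := hpos a
        have := hpos b
        omega)
      rw [σ.injective hab] at ha'
      omega
    rw [he, ho] at hex hnb
    have h1 := occ_le_one s (2 * i)
    have h2 := occ_le_one s (2 * i + 1)
    have h3 := occ_le_one s (2 * (i + 1))
    simp only [show 2 * (i : ℕ) + 1 + 1 = 2 * (i + 1) by ring] at hex hnb
    omega
  refine hs fun j => ?_
  induction j with
  | zero =>
    have := occ_val s 0
    rw [h0] at this
    exact this
  | succ j ih =>
    by_cases hj : j < L + 1
    · have := hstep ⟨j, hj⟩
      exact this.symm.trans ih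
    · rw [occ, dif_neg (by omega)]

theorem wallOmega_apply_of_ne {N : ℕ} [NeZero N] {s : Config N} {k : Fin N} (hk : Even (k : ℕ))
    (hs : s k ≠ 0) : wallOmega N s = 0 := by
  refine Finset.prod_eq_zero (Finset.mem_univ k) ?_
  simp only [if_pos hk, Fin.eq_one_of_ne_zero _ hs]
  rfl

/-- Since (1 + i)/2 = i(1 - i)/2, each odd site contributes a common factor and a 1 or an i that the
pair orbital reproduces. The projector onto first spin 0 is the average of the sectors η = 1 and η =
-1. -/
theorem wallOmega_eq {L : ℕ} (s : Config (2 * (L + 1))) :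
    wallOmega (2 * (L + 1)) s = ((1 - Complex.I) / 2) ^ (L + 1)
      * ((1 + (-1) ^ (s 0 : ℕ)) / 2) * slaterAmp (pairOrbital (M := L + 1)) (walls s) := by
  by_cases h0 : s 0 = 0
  · by_cases hs : ∀ j, occ s (2 * j) = 0
    · rw [slaterAmp_pairOrbital_of_even_eq_zero h0 hs, h0]
      have h1 : wallOmega (2 * (L + 1)) s = ∏ k ∈ Finset.range (2 * (L + 1)),
          if Even k then (if occ s k = 0 then 1 else 0)
          else if occ s k = 0 then (1 - Complex.I) / 2 else (1 + Complex.I) / 2 := by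
        rw [← Fin.prod_univ_eq_prod_range]
        unfold wallOmega tensorState
        refine Finset.prod_congr rfl fun k _ => ?_
        rw [occ_val]
        generalize s k = b
        split_ifs with h h' h' <;> fin_cases b <;> simp [h] at h' ⊢
      rw [h1, prod_range_two_mul, ← Fin.prod_univ_eq_prod_range (fun j =>
        (if Even (2 * j) then (if occ s (2 * j) = 0 then (1 : ℂ) else 0)
          else if occ s (2 * j) = 0 then (1 - Complex.I) / 2 else (1 + Complex.I) / 2) *
        (if Even (2 * j + 1) then (if occ s (2 * j + 1) = 0 then (1 : ℂ) else 0)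
          else if occ s (2 * j + 1) = 0 then (1 - Complex.I) / 2 else (1 + Complex.I) / 2))]
      have h2 : ((1 - Complex.I) / 2) ^ (L + 1) = ∏ _j : Fin (L + 1), (1 - Complex.I) / 2 := by
        rw [Finset.prod_const, Finset.card_univ, Fintype.card_fin]
      rw [h2, show ((1 + (-1) ^ ((0 : Fin 2) : ℕ)) / 2 : ℂ) = 1 by norm_num, mul_one,
        ← Finset.prod_mul_distrib]
      refine Finset.prod_congr rfl fun j _ => ?_
      rw [if_pos (even_two_mul _), if_pos (hs j), if_neg (by simp)]
      split_ifs
      · ring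
      · linear_combination (1 / 2) * Complex.I_sq
    · rw [slaterAmp_pairOrbital_eq_zero h0 hs, mul_zero]
      push Not at hs
      obtain ⟨j, hj⟩ := hs
      have hlt : 2 * j < 2 * (L + 1) := by
        by_contra h
        exact hj (dif_neg h)
      refine wallOmega_apply_of_ne (k := ⟨2 * j, hlt⟩) (even_two_mul j) fun h => hj ?_
      have := occ_val s ⟨2 * j, hlt⟩
      rw [h] at this
      exact this
  · rw [wallOmega_apply_of_ne (k := 0) (by simp) h0, Fin.eq_one_of_ne_zero _ h0]
    norm_num

/-! ### The relaxation function as a determinant -/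

/-- The orbitals on a ring with boundary sign `ζ`, evolved from `pairOrbital`. -/
def orbital (N : ℕ) (ζ t : ℝ) {M : ℕ} (i : Fin M) (k : ℤ) : ℂ :=
  (starRingEnd ℂ) (ringWave N ζ t (2 * ((i : ℕ) + 1) - 1 - k))

theorem orbital_add_period (N : ℕ) {ζ : ℝ} (hζ : ζ ^ 2 = 1) (t : ℝ) {M : ℕ} (i : Fin M) (k : ℤ) :
    orbital N ζ t i (k + N) = ζ * orbital N ζ t i k := by
  unfold orbital
  rw [← sub_sub, ringWave_sub_period N hζ, map_mul, Complex.conj_ofReal]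

theorem hasDerivAt_orbital {N : ℕ} (hN : 0 < N) {ζ : ℝ} (hζ : ζ ^ 2 = 1) (t : ℝ) {M : ℕ}
    (i : Fin M) (k : ℤ) : HasDerivAt (fun t => orbital N ζ t i k)
      (2 * (orbital N ζ t i (k + 1) - orbital N ζ t i (k - 1))) t := by
  have h := (hasDerivAt_ringWave hN hζ t (2 * ((i : ℕ) + 1) - 1 - k)).star
  refine h.congr_deriv ?_
  unfold orbital
  rw [← sub_sub, show 2 * (((i : ℕ) : ℤ) + 1) - 1 - (k - 1) = 2 * ((i : ℕ) + 1) - 1 - k + 1 by ring]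
  simp

theorem onBonds_orbital_zero {L : ℕ} (ζ : ℝ) :
    onBonds (2 * (L + 1)) (orbital (2 * (L + 1)) ζ 0 (M := L + 1)) = pairOrbital := by
  funext i k
  unfold onBonds orbital pairOrbital
  rw [ringWave_zero (by omega) (by omega)]
  split_ifs <;> first | omega | simp

/-- With A and B the Slater amplitudes of the two sectors, summing over the first spin gives |A +
B|² - |A - B|², that is, four times the real part of A times the conjugate of B. Cauchy–Binet sums
this over wall positions, and |α|² = 2^{-(L+1)} supplies the factor 1/2 of each overlap. -/
theorem relaxationN_eq_det (L : ℕ) (t : ℝ) :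
    relaxationN (2 * (L + 1)) t
      = ((Matrix.of fun i j : Fin (L + 1) =>
          overlapN (2 * (L + 1)) ((-1) ^ L) t ((i : ℕ) + 1) ((j : ℕ) + 1)).det.re : ℂ) := by
  have hζ : ((-1 : ℝ) ^ L) ^ 2 = 1 := by rw [← pow_mul, mul_comm, pow_mul]; norm_num
  have hζ' : (-(-1 : ℝ) ^ L) ^ 2 = 1 := by rwa [neg_sq]
  set N := 2 * (L + 1) with hN
  have hNpos : 0 < N := by omega
  set α : ℂ := ((1 - Complex.I) / 2) ^ (L + 1) with hα
  let φ : ℝ → Fin (L + 1) → ℤ → ℂ := fun t i => orbital N ((-1) ^ L) t i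
  let χ : ℝ → Fin (L + 1) → ℤ → ℂ := fun t i => orbital N (-(-1) ^ L) t i
  have h := relaxationN_eq_of_hasDerivAt (N := N) (by rw [hN]; exact even_two_mul _) (by omega)
    (fun t s => α / 2 * (wallState 1 (φ t) s + wallState (-1) (χ t) s)) ?_ ?_ t
  · rw [h]
    set A := fun T => slaterAmp (onBonds N (φ t)) T with hA
    set B := fun T => slaterAmp (onBonds N (χ t)) T with hB
    have hαα : α * (starRingEnd ℂ) α = (1 / 2) ^ (L + 1) := by
      rw [hα, map_pow, ← mul_pow]
      congr 1
      simp only [map_div₀, map_sub, map_one, Complex.conj_I, map_ofNat]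
      linear_combination (-1 / 4) * Complex.I_sq
    have h1 := sum_config_eq_sum_walls (L := L) (fun a T => (-1) ^ (a : ℕ)
      * ((α / 2 * (1 ^ (a : ℕ) * A T + (-1) ^ (a : ℕ) * B T))
        * (starRingEnd ℂ) (α / 2 * (1 ^ (a : ℕ) * A T + (-1) ^ (a : ℕ) * B T))))
      (fun a T hT => by simp [hA, hB, slaterAmp_of_card_ne _ hT])
    refine h1.trans ?_
    have h2 : ∀ T, B T = (starRingEnd ℂ)
        (slaterAmp (fun i k => (starRingEnd ℂ) (onBonds N (χ t) i k)) T) := fun T => by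
      rw [hB]
      simp only [slaterAmp]
      split_ifs
      · simp only [slaterDet]
        rw [RingHom.map_det]
        congr 1
        ext i j
        simp
      · simp
    have h3 : (Matrix.of fun i j : Fin (L + 1) =>
        overlapN N ((-1) ^ L) t ((i : ℕ) + 1) ((j : ℕ) + 1)).det
        = (1 / 2) ^ (L + 1) * ∑ T, (starRingEnd ℂ) (B T) * A T := by
      simp only [h2, Complex.conj_conj]
      rw [hA, sum_slaterAmp_mul]
      have := Matrix.det_smul (Matrix.of fun i j : Fin (L + 1) =>
        ∑ k, (starRingEnd ℂ) (onBonds N (χ t) i k) * onBonds N (φ t) j k) (1 / 2 : ℂ)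
      rw [Fintype.card_fin] at this
      rw [← this]
      congr 1
      ext i j
      rw [Matrix.of_apply, Matrix.smul_apply, Matrix.of_apply, overlapN, ← Fin.sum_univ_eq_sum_range
        (fun k => ringWave N (-(-1) ^ L) t (2 * ((i : ℕ) + 1) - 1 - k)
          * (starRingEnd ℂ) (ringWave N ((-1) ^ L) t (2 * ((j : ℕ) + 1) - 1 - k)))]
      simp only [onBonds, φ, χ, orbital, Complex.conj_conj, smul_eq_mul]
      ring
    rw [h3, Complex.re_eq_add_conj, map_mul, map_sum, Finset.mul_sum, Finset.mul_sum,
      ← Finset.sum_add_distrib, Finset.sum_div]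
    refine Finset.sum_congr rfl fun T _ => ?_
    simp only [map_mul, map_div₀, map_add, map_pow, map_one, map_ofNat, map_neg, Complex.conj_conj,
      Fin.val_zero, Fin.val_one, pow_zero, pow_one]
    linear_combination (1 / 2) * (A T * (starRingEnd ℂ) (B T) + B T * (starRingEnd ℂ) (A T)) * hαα
  · funext s
    simp only [wallState, φ, χ, hN]
    rw [wallOmega_eq, onBonds_orbital_zero, onBonds_orbital_zero]
    simp only [one_pow]
    ring
  · intro t s
    have hp := hasDerivAt_wallState (L := L) (η := 1) (ζ := ((-1 : ℝ) ^ L : ℝ)) (φ := φ) (by norm_num)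
      (by push_cast; ring) (fun t i k => orbital_add_period N hζ t i k)
      (fun t i k => hasDerivAt_orbital hNpos hζ t i k) t s
    have hm := hasDerivAt_wallState (L := L) (η := -1) (ζ := (-(-1 : ℝ) ^ L : ℝ)) (φ := χ)
      (by norm_num) (by push_cast; ring) (fun t i k => orbital_add_period N hζ' t i k)
      (fun t i k => hasDerivAt_orbital hNpos hζ' t i k) t s
    refine ((hp.add hm).const_mul (α / 2)).congr_deriv ?_
    rw [← Finset.sum_add_distrib, Finset.mul_sum]
    refine Finset.sum_congr rfl fun n _ => ?_
    ring

/-! ### The determinant in the window of integers centred at the origin -/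

/-- The integers `m` with `-M < 2m ≤ M`. -/
def window (M : ℕ) : Finset ℤ := (Finset.Ioc (-(M : ℤ)) M).filter fun m => -(M : ℤ) < 2 * m ∧ 2 * m ≤ M

theorem mem_window {M : ℕ} {m : ℤ} : m ∈ window M ↔ -(M : ℤ) < 2 * m ∧ 2 * m ≤ M := by
  rw [window, Finset.mem_filter, Finset.mem_Ioc]
  exact ⟨And.right, fun h => ⟨by omega, h⟩⟩

/-- The representative modulo `M` in the window of the index `i + 1`. -/
def wrap {M : ℕ} (i : Fin M) : window M :=
  ⟨if 2 * ((i : ℕ) + 1) ≤ M then (i : ℕ) + 1 else (i : ℕ) + 1 - M, by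
    have := i.2
    rw [mem_window]
    split_ifs <;> constructor <;> omega⟩

theorem bijective_wrap (M : ℕ) : Function.Bijective (wrap (M := M)) := by
  constructor
  · intro i j h
    have h' := congrArg Subtype.val h
    have hi := i.2
    have hj := j.2
    simp only [wrap] at h'
    split_ifs at h' <;> apply Fin.ext <;> omega
  · rintro ⟨m, hm⟩
    have hm' := mem_window.mp hm
    by_cases h : 1 ≤ m
    · refine ⟨⟨(m - 1).toNat, by omega⟩, Subtype.ext ?_⟩
      simp only [wrap]
      split_ifs <;> omega
    · refine ⟨⟨(m + M - 1).toNat, by omega⟩, Subtype.ext ?_⟩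
      simp only [wrap]
      split_ifs <;> omega

/-- The indices 1 and M are both close to the cut of the ring, so the deviation from the identity
sits at two ends; reducing modulo M collects it around 0. The rescalings of rows and columns
contribute the same product, whose square is 1. -/
theorem det_overlapN_eq_det_window (M : ℕ) {ζ : ℝ} (hζ : ζ ^ 2 = 1) (t : ℝ) :
    (Matrix.of fun i j : Fin M =>
        overlapN (2 * M) ζ t ((i : ℕ) + 1) ((j : ℕ) + 1)).det
      = (Matrix.of fun m n : window M => halfSign m * overlapN (2 * M) ζ t m n).det := by
  have hz : (ζ : ℂ) ^ 2 = 1 := by exact_mod_cast hζ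
  rw [← Matrix.det_submatrix_equiv_self (Equiv.ofBijective _ (bijective_wrap M))]
  let g : Fin M → ℂ := fun i => if 2 * ((i : ℕ) + 1) ≤ M then 1 else ζ
  have hg : (∏ i, g i) * ∏ i, g i = 1 := by
    rw [← Finset.prod_mul_distrib]
    refine Finset.prod_eq_one fun i _ => ?_
    simp only [g]
    split_ifs
    · norm_num
    · rw [← sq, hz]
  have e : ((Matrix.of fun m n : window M => halfSign m * overlapN (2 * M) ζ t m n).submatrix
      (Equiv.ofBijective _ (bijective_wrap M)) (Equiv.ofBijective _ (bijective_wrap M)))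
      = Matrix.of fun i j => g i * (Matrix.of fun i j => g j * (Matrix.of fun i j : Fin M =>
        overlapN (2 * M) ζ t ((i : ℕ) + 1) ((j : ℕ) + 1)) i j) i j := by
    ext i j
    have hi := i.2
    simp only [Matrix.submatrix_apply, Matrix.of_apply, Equiv.ofBijective_apply, wrap, g, halfSign]
    split_ifs <;>
      first
        | omega
        | ring1
        | (simp only [overlapN_sub_left hζ, overlapN_sub_right hζ] <;> ring1)
  rw [e, Matrix.det_mul_column, Matrix.det_mul_row, ← mul_assoc, hg, one_mul]

theorem exists_limitKernel_bound (t : ℝ) : ∃ C : ℝ, 0 ≤ C ∧ ∀ m n : ℤ,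
    ‖halfSign m * limitKernel t m n - kronecker m n‖ ≤ C * wt m * wt n := by
  obtain ⟨C, hC, hb⟩ := exists_overlapN_bound t
  refine ⟨C, hC, fun m n => ?_⟩
  have h := (((tendsto_overlapN (fun _ => 1) (fun _ => one_pow 2) t m n).const_mul
    (halfSign m)).sub_const (kronecker m n)).norm
  refine le_of_tendsto h ?_
  filter_upwards [eventually_gt_atTop (2 * m.natAbs + 2 * n.natAbs)] with M hM
  exact hb M 1 m n (by omega) (one_pow 2) (by omega) (by omega) (by omega) (by omega)

/-- The Fredholm determinant of the limit kernel on the integers, as a sum of principal minors. -/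
def fredholmDet (t : ℝ) : ℂ :=
  ∑' S : Finset ℤ,
    (Matrix.of fun m n : S => halfSign m * limitKernel t m n - kronecker m n).det

theorem ite_add_sub_kronecker {W : Finset ℤ} (f : ℤ → ℤ → ℂ) :
    (Matrix.of fun m n : W => (if m = n then 1 else 0) + (f m n - kronecker m n))
      = Matrix.of fun m n : W => f m n := by
  ext m n
  simp only [Matrix.of_apply, kronecker, Subtype.ext_iff]
  ring

/-- In the centred window the uniform product bound applies, so entrywise convergence suffices. -/
theorem tendsto_det_overlapN (t : ℝ) :
    Tendsto (fun L : ℕ => (Matrix.of fun i j : Fin (L + 1) =>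
      overlapN (2 * (L + 1)) ((-1) ^ L) t ((i : ℕ) + 1) ((j : ℕ) + 1)).det) atTop
      (𝓝 (fredholmDet t)) := by
  obtain ⟨C, hC, hb⟩ := exists_overlapN_bound t
  have hζ : ∀ L : ℕ, ((-1 : ℝ) ^ L) ^ 2 = 1 := fun L => by
    rw [← pow_mul, mul_comm, pow_mul]
    norm_num
  have h := tendsto_det_one_add (W := fun L : ℕ => window (L + 1)) (b := fun m : ℤ => wt m) (C := C)
    (κ := fun L m n => halfSign m * overlapN (2 * (L + 1)) ((-1) ^ L) t m n - kronecker m n)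
    (κlim := fun m n => halfSign m * limitKernel t m n - kronecker m n)
    (fun m => (wt_pos m).le) summable_wt (fun m => ?_) hC (fun L m hm n hn => ?_) (fun m n => ?_)
  · refine h.congr fun L => ?_
    rw [ite_add_sub_kronecker (fun m n => halfSign m * overlapN (2 * (L + 1)) ((-1) ^ L) t m n),
      det_overlapN_eq_det_window (L + 1) (hζ L)]
  · filter_upwards [eventually_gt_atTop (2 * m.natAbs)] with L hL
    rw [mem_window]
    omega
  · rw [mem_window] at hm hn
    exact hb (L + 1) _ m n L.succ_pos (hζ L) hm.1 hm.2 hn.1 hn.2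
  · refine Tendsto.sub_const (Tendsto.const_mul _ ?_) _
    -- The twist has to be given as a function of the ring size: N/2 - 1 equals L at N = 2(L + 1).
    refine ((tendsto_overlapN (fun N => (-1) ^ (N / 2 - 1)) (fun N => hζ _) t m n).comp
      (tendsto_add_atTop_nat 1)).congr fun L => ?_
    simp only [Function.comp_apply]
    rw [show 2 * (L + 1) / 2 - 1 = L by omega]

theorem tendsto_det_limitKernel (t : ℝ) :
    Tendsto (fun r : ℕ => (Matrix.of fun m n : Finset.Icc (1 - (r : ℤ)) r =>
      halfSign m * limitKernel t m n).det) atTop (𝓝 (fredholmDet t)) := by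
  obtain ⟨C, hC, hb⟩ := exists_limitKernel_bound t
  have h := tendsto_det_one_add (W := fun r : ℕ => Finset.Icc (1 - (r : ℤ)) r)
    (b := fun m : ℤ => wt m) (C := C)
    (κ := fun _ m n => halfSign m * limitKernel t m n - kronecker m n)
    (κlim := fun m n => halfSign m * limitKernel t m n - kronecker m n)
    (fun m => (wt_pos m).le) summable_wt (fun m => ?_) hC (fun r m _ n _ => hb m n)
    (fun m n => tendsto_const_nhds)
  · refine h.congr fun r => ?_
    rw [ite_add_sub_kronecker (fun m n => halfSign m * limitKernel t m n)]
  · filter_upwards [eventually_gt_atTop (m.natAbs)] with r hr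
    rw [Finset.mem_Icc]
    omega

/-! ### Reflection symmetry and factorization -/

/-- Multiplication by unipotent block matrices on both sides makes the matrix block triangular. -/
theorem det_fromBlocks_symm {n : Type*} [Fintype n] [DecidableEq n] (P Q : Matrix n n ℂ) :
    (Matrix.fromBlocks P Q Q P).det = (P + Q).det * (P - Q).det := by
  have h : Matrix.fromBlocks 1 1 0 1 * Matrix.fromBlocks P Q Q P * Matrix.fromBlocks 1 (-1) 0 1
      = Matrix.fromBlocks (P + Q) 0 Q (P - Q) := by
    simp only [Matrix.fromBlocks_multiply]
    congr 1 <;> (simp [sub_eq_add_neg, add_comm]; try abel)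
  have h' := congrArg Matrix.det h
  rw [Matrix.det_mul, Matrix.det_mul, Matrix.det_fromBlocks_zero₂₁, Matrix.det_fromBlocks_zero₂₁,
    Matrix.det_fromBlocks_zero₁₂] at h'
  simpa using h'

/-- The reflected column index is at most 0, so it never meets the diagonal, where the formula for K
is restricted to positive indices. -/
theorem matrixA_apply (r : ℕ) (t : ℝ) (i j : Fin r) :
    matrixA r t i j = limitKernel t ((i : ℕ) + 1) ((j : ℕ) + 1)
      + limitKernel t ((i : ℕ) + 1) (1 - ((j : ℕ) + 1)) := by
  rw [limitKernel_eq t (by omega), limitKernel_eq_of_ne t (by omega)]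
  rfl

/-- The indices `1, …, r` and their reflections `0, …, 1 - r`. -/
def reflectIndex (r : ℕ) : Fin r ⊕ Fin r → Finset.Icc (1 - (r : ℤ)) r
  | Sum.inl i => ⟨(i : ℕ) + 1, by rw [Finset.mem_Icc]; omega⟩
  | Sum.inr i => ⟨1 - ((i : ℕ) + 1), by rw [Finset.mem_Icc]; omega⟩

theorem bijective_reflectIndex (r : ℕ) : Function.Bijective (reflectIndex r) := by
  constructor
  · rintro (i | i) (j | j) h <;> have h' := congrArg Subtype.val h <;>
      simp only [reflectIndex] at h'
    · exact congrArg Sum.inl (Fin.ext (by omega))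
    · omega
    · omega
    · exact congrArg Sum.inr (Fin.ext (by omega))
  · rintro ⟨m, hm⟩
    rw [Finset.mem_Icc] at hm
    by_cases h : 1 ≤ m
    · refine ⟨Sum.inl ⟨(m - 1).toNat, by omega⟩, Subtype.ext ?_⟩
      simp only [reflectIndex]
      omega
    · refine ⟨Sum.inr ⟨(-m).toNat, by omega⟩, Subtype.ext ?_⟩
      simp only [reflectIndex]
      omega

theorem limitKernel_one_sub_left (t : ℝ) (m n : ℤ) :
    limitKernel t (1 - m) n = -limitKernel t m (1 - n) := by
  rw [← limitKernel_one_sub, sub_sub_cancel]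

/-- Listing the indices as 1, …, r followed by their reflections, oddness of the kernel and the row
sign give equal diagonal blocks P and equal off-diagonal blocks Q. Hermiticity with oddness
identifies P - Q as the adjoint of P + Q. -/
theorem det_limitKernel_eq (r : ℕ) (t : ℝ) :
    (Matrix.of fun m n : Finset.Icc (1 - (r : ℤ)) r => halfSign m * limitKernel t m n).det
      = (matrixA r t).det * (starRingEnd ℂ) (matrixA r t).det := by
  let P : Matrix (Fin r) (Fin r) ℂ :=
    Matrix.of fun i j => limitKernel t ((i : ℕ) + 1) ((j : ℕ) + 1)
  let Q : Matrix (Fin r) (Fin r) ℂ :=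
    Matrix.of fun i j => limitKernel t ((i : ℕ) + 1) (1 - ((j : ℕ) + 1))
  have hA : matrixA r t = P + Q := by
    ext i j
    exact matrixA_apply r t i j
  have hA' : (matrixA r t).conjTranspose = P - Q := by
    ext i j
    rw [Matrix.conjTranspose_apply, matrixA_apply, star_add, ← starRingEnd_apply,
      ← starRingEnd_apply, conj_limitKernel, conj_limitKernel, limitKernel_one_sub_left,
      ← sub_eq_add_neg]
    rfl
  have hdet : (P - Q).det = (starRingEnd ℂ) (matrixA r t).det := by
    rw [← hA', Matrix.det_conjTranspose]
    rfl
  rw [← Matrix.det_submatrix_equiv_self (Equiv.ofBijective _ (bijective_reflectIndex r)), ← hdet,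
    hA, ← det_fromBlocks_symm]
  congr 1
  ext (i | i) (j | j) <;>
    simp only [Matrix.submatrix_apply, Matrix.of_apply, Equiv.ofBijective_apply, reflectIndex,
      Matrix.fromBlocks_apply₁₁, Matrix.fromBlocks_apply₁₂, Matrix.fromBlocks_apply₂₁,
      Matrix.fromBlocks_apply₂₂, P, Q, halfSign]
  · rw [if_pos (by omega), one_mul]
  · rw [if_pos (by omega), one_mul]
  · rw [if_neg (by omega), limitKernel_one_sub_left]
    ring
  · rw [if_neg (by omega), limitKernel_one_sub]
    ring

/-- Convergence of |det A|² does not settle the phase, so the criterion by principal minors is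
applied to A itself, with the weights of an index and its reflection added. -/
theorem exists_tendsto_det_matrixA (t : ℝ) :
    ∃ D : ℂ, Tendsto (fun r : ℕ => (matrixA r t).det) atTop (𝓝 D) := by
  obtain ⟨C, hC, hb⟩ := exists_limitKernel_bound t
  let κ : ℕ → ℕ → ℂ := fun i j => limitKernel t (i + 1) (j + 1)
    + limitKernel t (i + 1) (1 - (j + 1)) - if i = j then 1 else 0
  let b : ℕ → ℝ := fun i => wt (i + 1) + wt (1 - (i + 1))
  have hs : Summable b := by
    refine (summable_wt.comp_injective (i := fun i : ℕ => (i : ℤ) + 1) ?_).add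
      (summable_wt.comp_injective (i := fun i : ℕ => 1 - ((i : ℤ) + 1)) ?_)
    · intro i j h
      simpa using h
    · intro i j h
      simpa using h
  refine ⟨_, (tendsto_det_one_add (W := fun r : ℕ => Finset.range r) (b := b) (C := C)
    (κ := fun _ => κ) (κlim := κ) (fun i => (add_pos (wt_pos _) (wt_pos _)).le) hs (fun i => ?_) hC
    (fun r i _ j _ => ?_) (fun i j => tendsto_const_nhds)).congr fun r => ?_⟩
  · filter_upwards [eventually_gt_atTop i] with r hr
    exact Finset.mem_range.mpr hr
  · have h1 := hb (i + 1) (j + 1)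
    have h2 := hb (i + 1) (1 - (j + 1))
    have e1 : halfSign ((i : ℤ) + 1) = 1 := if_pos (by omega)
    have e2 : kronecker ((i : ℤ) + 1) (1 - ((j : ℤ) + 1)) = 0 := if_neg (by omega)
    have e3 : kronecker ((i : ℤ) + 1) ((j : ℤ) + 1) = if i = j then 1 else 0 := by
      simp [kronecker]
    rw [e1, e2, one_mul, sub_zero] at h2
    rw [e1, e3, one_mul] at h1
    have h3 := (norm_add_le _ _).trans (add_le_add h1 h2)
    have e4 : κ i j = limitKernel t (i + 1) (j + 1) - (if i = j then 1 else 0)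
        + limitKernel t (i + 1) (1 - (j + 1)) := by
      simp only [κ]
      ring
    rw [e4]
    refine h3.trans ?_
    rw [← mul_add]
    have := wt_pos ((j : ℤ) + 1)
    have := wt_pos (1 - ((j : ℤ) + 1))
    have := wt_pos (1 - ((i : ℤ) + 1))
    simp only [b]
    gcongr
    linarith
  · let e : Fin r → Finset.range r := fun i => ⟨i, Finset.mem_range.mpr i.2⟩
    have he : Function.Bijective e :=
      ⟨fun i j h => Fin.ext (congrArg Subtype.val h),
        fun k => ⟨⟨k, Finset.mem_range.mp k.2⟩, rfl⟩⟩
    rw [← Matrix.det_submatrix_equiv_self (Equiv.ofBijective _ he)]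
    congr 1
    ext i j
    simp only [Matrix.submatrix_apply, Matrix.of_apply, Equiv.ofBijective_apply, e, κ,
      Subtype.mk.injEq, matrixA_apply]
    ring

end SpinHelix

end

theorem mainTheorem3 (t : ℝ) :
    (∀ m n : ℤ, 1 ≤ m → 1 ≤ n →
      Tendsto (fun L : ℕ => SpinHelix.PhiN (2 * (L + 1)) m n t) atTop
        (𝓝 ((-1 : ℂ) ^ (m - n) * (SpinHelix.kronecker m n + SpinHelix.kernelK m n t)))) ∧
    ∃ (S : ℝ) (D : ℂ),
      Tendsto (fun L : ℕ => SpinHelix.relaxationN (2 * (L + 1)) t) atTop (𝓝 (S : ℂ)) ∧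
      Tendsto (fun r : ℕ => SpinHelix.relaxationTrunc r t) atTop (𝓝 S) ∧
      Tendsto (fun r : ℕ => (SpinHelix.matrixA r t).det) atTop (𝓝 D) ∧
      (S : ℂ) = D * (starRingEnd ℂ) D := by
  refine ⟨fun m n _ hn => ?_, ?_⟩
  · rw [← SpinHelix.limitKernel_eq t hn]
    exact SpinHelix.tendsto_PhiN t m n
  · obtain ⟨D, hD⟩ := SpinHelix.exists_tendsto_det_matrixA t
    -- The exact factorization at each r passes to the limit; uniqueness of limits identifies the
    -- limit from finite rings with |D|², whose real part is itself.
    have hF : SpinHelix.fredholmDet t = D * (starRingEnd ℂ) D := by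
      refine tendsto_nhds_unique (SpinHelix.tendsto_det_limitKernel t) ?_
      simp only [SpinHelix.det_limitKernel_eq]
      exact hD.mul ((Complex.continuous_conj.tendsto D).comp hD)
    have hre : (‖D‖ ^ 2 : ℝ) = (SpinHelix.fredholmDet t).re := by
      rw [hF, Complex.mul_conj, Complex.ofReal_re, Complex.normSq_eq_norm_sq]
    refine ⟨‖D‖ ^ 2, D, ?_, hD.norm.pow 2, hD, ?_⟩
    · simp only [SpinHelix.relaxationN_eq_det]
      rw [hre]
      exact ((Complex.continuous_ofReal.comp Complex.continuous_re).tendsto _).comp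
        (SpinHelix.tendsto_det_overlapN t)
    · rw [Complex.mul_conj, Complex.normSq_eq_norm_sq]
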